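/- **Proposition (Mean oscillation estimate).** Let $d\ge 1$, $0<\sigma<2$ and $0<\nu\le\Lambda<\infty$. Let $K:\mathbb{R}^d\to\mathbb{R}$ be measurable with $$(2-\sigma)\frac{\nu}{|y|^{d+\sigma}}\le K(y)\le(2-\sigma)\frac{\Lambda}{|y|^{d+\sigma}}\qquad (y\neq 0)$$ and, if $\sigma=1$, assume moreover that $\int_{\partial B_\rho}yK(y)\,dS_\rho(y)=0$ for all $\rho>0$, where $dS_\rho$ is the surface measure on $\partial B_\rho$. Set $$Lu(x)=\int_{\mathbb{R}^d}\big(u(x+y)-u(x)-y\cdot\nabla u(x)\,\chi^{(\sigma)}(y)\big)K(y)\,dy,$$ where $\chi^{(\sigma)}\equiv0$ if $\sigma<1$, $\chi^{(1)}=1_{B_1}$, and $\chi^{(\sigma)}\equiv1$ if $\sigma>1$. Let $$-(-\Delta)^{\sigma/2}u(x)=\frac1c\,\mathrm{P.V.}\!\int_{\mathbb{R}^d}\frac{u(x+y)-u(x)}{|y|^{d+\sigma}}\,dy,\qquad c=\frac{\pi^{d/2}2^{2-\sigma}}{\sigma(2-\sigma)}\,\frac{\Gamma(2-\frac\sigma2)}{\Gamma(\frac{d+\sigma}2)}.$$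 Let $H^\sigma_2=\{u\in L_2(\mathbb{R}^d):(1-\Delta)^{\sigma/2}u\in L_2(\mathbb{R}^d)\}$, and let $C^\infty_b$ be the space of smooth functions on $\mathbb{R}^d$ which are bounded together with all their derivatives. Write $B_r(x)$ for the open ball of radius $r$ centered at $x$, $B_r=B_r(0)$, $(g)_{B}=\frac1{|B|}\int_{B}g\,dx$ for a ball $B$, and $\mathcal{M}g(x)=\sup_{\rho>0}(|g|)_{B_\rho(x)}$. Then for every $\alpha\in(0,\min\{1,\sigma\})$ there is a constant $N$, depending only on $d,\nu,\Lambda,\sigma,\alpha$, such that the following holds for all such $K$, all $\lambda>0$, $r>0$, $\kappa\ge2$, and all real-valued $f\in C^\infty(\mathbb{R}^d)\cap L_\infty(\mathbb{R}^d)$ and $u\in H^\sigma_2\cap C^\infty_b$ satisfying $Lu-\lambda u=f$ in $\mathbb{R}^d$: $$\lambda\big(|u-(u)_{B_r}|\big)_{B_r}+\big(|(-\Delta)^{\sigma/2}u-((-\Delta)^{\sigma/2}u)_{B_r}|\big)_{B_r}\le N\kappa^{-\alpha}\Big(\lambda\mathcal{M}u(0)+\mathcal{M}\big((-\Delta)^{\sigma/2}u\big)(0)\Big)+N\kappa^{d/2}\big(\mathcal{M}(f^2)(0)\big)^{1/2}.$$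 -/

import Mathlib

open MeasureTheory Metric Set Filter Topology
open scoped ENNReal ContDiff SchwartzMap

noncomputable section

namespace Nonlocal

/-- Surface measure of the sphere of radius `r` centered at the origin of `ℝ^d`, as a measure on
`ℝ^d`: the image of the surface measure of the unit sphere under `θ ↦ r θ`, times `r ^ (d - 1)`. -/
def surfaceMeasure (d : ℕ) (r : ℝ) : Measure (EuclideanSpace ℝ (Fin d)) :=
  ENNReal.ofReal (r ^ (d - 1)) •
    Measure.map
      (fun θ : sphere (0 : EuclideanSpace ℝ (Fin d)) 1 => r • (θ : EuclideanSpace ℝ (Fin d)))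
      (volume : Measure (EuclideanSpace ℝ (Fin d))).toSphere

/-- The translation invariant kernels: Lebesgue measurable, with the two-sided ellipticity bound of
order `σ` and constants `ν ≤ Λ`, and, if `σ = 1`, with vanishing first moment on every sphere. -/
structure IsKernel (d : ℕ) (σ ν Λ : ℝ) (K : EuclideanSpace ℝ (Fin d) → ℝ) : Prop where
  aemeasurable : AEMeasurable K volume
  lower : ∀ y, y ≠ 0 → (2 - σ) * (ν / ‖y‖ ^ ((d : ℝ) + σ)) ≤ K y
  upper : ∀ y, y ≠ 0 → K y ≤ (2 - σ) * (Λ / ‖y‖ ^ ((d : ℝ) + σ))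
  cancel : σ = 1 → ∀ r : ℝ, 0 < r → ∫ y, K y • y ∂(surfaceMeasure d r) = 0

/-- The truncation: `0` if `σ < 1`, the indicator of the unit ball if `σ = 1`, `1` if `σ > 1`. -/
def chi (d : ℕ) (σ : ℝ) (y : EuclideanSpace ℝ (Fin d)) : ℝ :=
  if σ < 1 then 0 else if σ = 1 then (ball 0 1).indicator (fun _ => 1) y else 1

/-- The non-local operator
`L u (x) = ∫ (u (x + y) - u x - y · ∇ u x χ(y)) K y dy`. -/
def nonlocalOp (d : ℕ) (σ : ℝ) (K : EuclideanSpace ℝ (Fin d) → ℝ)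
    (u : EuclideanSpace ℝ (Fin d) → ℝ) (x : EuclideanSpace ℝ (Fin d)) : ℝ :=
  ∫ y, (u (x + y) - u x - fderiv ℝ u x y * chi d σ y) * K y

/-- The normalizing constant `c(d, σ)` of the fractional Laplacian, for which the symbol of
`(-Δ)^(σ/2)` is `|ξ|^σ`. -/
def fracConst (d : ℕ) (σ : ℝ) : ℝ :=
  Real.pi ^ ((d : ℝ) / 2) * 2 ^ (2 - σ) / (σ * (2 - σ)) *
    (Real.Gamma (2 - σ / 2) / Real.Gamma (((d : ℝ) + σ) / 2))

/-- The fractional Laplacian `(-Δ)^(σ/2) u`, given by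
`-(-Δ)^(σ/2) u (x) = c(d, σ)⁻¹ P.V. ∫ (u (x + y) - u x) / |y|^(d + σ) dy`, the principal value being
the limit of the integrals over `|y| > ε` as `ε ↓ 0`. -/
def fracLaplacian (d : ℕ) (σ : ℝ) (u : EuclideanSpace ℝ (Fin d) → ℝ)
    (x : EuclideanSpace ℝ (Fin d)) : ℝ :=
  -((fracConst d σ)⁻¹ * limUnder (𝓝[>] (0 : ℝ)) (fun ε : ℝ =>
    ∫ y in {y : EuclideanSpace ℝ (Fin d) | ε < ‖y‖},
      (u (x + y) - u x) / ‖y‖ ^ ((d : ℝ) + σ)))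

/-- `u` belongs to the Bessel potential space `H^s_2`: `u` is in `L_2`, and the tempered
distribution it represents has `(1 - Δ)^(s/2) u ∈ L_2`. -/
def MemBesselTwo (d : ℕ) (s : ℝ) (u : EuclideanSpace ℝ (Fin d) → ℝ) : Prop :=
  ∃ v : Lp ℂ 2 (volume : Measure (EuclideanSpace ℝ (Fin d))),
    (∀ᵐ x, v x = (u x : ℂ)) ∧
      TemperedDistribution.MemSobolev s 2 (v : 𝓢'(EuclideanSpace ℝ (Fin d), ℂ))

/-- `C^∞_b`: smooth functions that are bounded together with all their derivatives. -/
def IsSmoothBounded (d : ℕ) (u : EuclideanSpace ℝ (Fin d) → ℝ) : Prop :=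
  ContDiff ℝ ∞ u ∧ ∀ n : ℕ, ∃ C : ℝ, ∀ x, ‖iteratedFDeriv ℝ n u x‖ ≤ C

/-- The (centered) Hardy-Littlewood maximal function. -/
def maximalFn (d : ℕ) (g : EuclideanSpace ℝ (Fin d) → ℝ) (x : EuclideanSpace ℝ (Fin d)) : ℝ≥0∞ :=
  ⨆ (r : ℝ) (_ : 0 < r), ⨍⁻ y in ball x r, ‖g y‖ₑ ∂volume

/-- The mean oscillation `(|g - (g)_{B_r}|)_{B_r}` over the ball `B_r` centered at the origin. -/
def meanOsc (d : ℕ) (g : EuclideanSpace ℝ (Fin d) → ℝ) (r : ℝ) : ℝ≥0∞ :=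
  ⨍⁻ x in ball (0 : EuclideanSpace ℝ (Fin d)) r, ‖g x - ⨍ y in ball 0 r, g y‖ₑ ∂volume

end Nonlocal

end

/-! Let `L` be the operator with kernel `K` and `A` the one with kernel `homKernel`. The gradient
term integrates to zero against an even kernel, so `(-Δ)^(σ/2)` is a constant multiple of `A`
(`fracLaplacian_eq_LL`) and it suffices to bound the oscillations of `λu` and `Au`.

Put `S = 2κr`, take a cutoff `η` equal to `1` on `B_{2S}` and supported in `B_{4S}`, solve `Lw - λw
= ηf`, and set `v = u - w`. The rough part `w` is controlled in `L_2` by Plancherel: the real part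
of the symbol of `K` lies below `ν` times the nonpositive symbol of `A`, so `λ‖w‖` and `ν‖Aw‖` are
at most `‖ηf‖` (`exists_solution`). Averaging over `B_r` instead of `B_{4S}` costs `(S/r)^(d/2)`,
whence the factor `κ^(d/2)`.

The regular part satisfies `Lv - λv = (1-η)f`, which vanishes in `B_{2S}`. Since `L` and `A` commute
(`LL_comm`), `Av` solves the same equation with right hand side `A((1-η)f)`, which inside `B_S` sees
`f` only through its tail. An interior Hölder estimate (`exists_holder`), whose constant does not
depend on `λ`, bounds the oscillation on `B_r` by `(r/S)^α` times the weighted `L_1` norm `tail`. A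
dyadic decomposition bounds `tail` by maximal functions.

The Hölder estimate is proved by doubling the variables. If it fails, `v x - v y - N B |x-y|^α - 32
B |x|^2` has a positive interior maximum. There, strict concavity of `t^α` makes the difference of
second differences very negative on a ball of increments near `(x-y)/2`. As `α < σ`, ellipticity
turns this into a contradiction for large `N`. The bound on `sup |v|` that this requires is removed
by a weighted maximum argument (`exists_sup_bound`). -/

noncomputable section

namespace Nonlocal

/-- The Euclidean space `ℝ^d`. -/
abbrev Euc (d : ℕ) := EuclideanSpace ℝ (Fin d)

/-- The exponent of decay at infinity of second differences of smooth bounded functions. -/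
def loExp (σ : ℝ) : ℝ := if σ ≤ 1 then 0 else 1

/-- The order of vanishing at the origin of second differences of smooth bounded functions. -/
def hiExp (σ : ℝ) : ℝ := if σ < 1 then 1 else 2

/-- The weight that dominates second differences of smooth bounded functions. -/
def wt {d : ℕ} (σ : ℝ) (y : Euc d) : ℝ := min (‖y‖ ^ loExp σ) (‖y‖ ^ hiExp σ)

/-- The homogeneous kernel of order `-(d + σ)`. -/
def homKernel (d : ℕ) (σ : ℝ) (y : Euc d) : ℝ := ‖y‖ ^ (-((d : ℝ) + σ))

/-- The second difference in the definition of the non-local operator. -/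
def sd {d : ℕ} {F : Type*} [NormedAddCommGroup F] [NormedSpace ℝ F] (σ : ℝ) (u : Euc d → F)
    (y x : Euc d) : F := u (x + y) - u x - chi d σ y • fderiv ℝ u x y

/-- The non-local operator on vector valued functions. -/
def LL {d : ℕ} {F : Type*} [NormedAddCommGroup F] [NormedSpace ℝ F] (σ : ℝ) (K : Euc d → ℝ)
    (u : Euc d → F) (x : Euc d) : F := ∫ y, K y • sd σ u y x

/-- Kernels with a two-sided bound, with vanishing first moment on annuli if `σ = 1`. -/
structure Ker (d : ℕ) (σ ν Λ : ℝ) (K : Euc d → ℝ) : Prop where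
  aem : AEMeasurable K volume
  lower : ∀ y, y ≠ 0 → ν * homKernel d σ y ≤ K y
  upper : ∀ y, y ≠ 0 → K y ≤ Λ * homKernel d σ y
  cancel : σ = 1 → ∀ a b : ℝ, 0 < a → a ≤ b → ∫ y in ball 0 b \ ball 0 a, K y • y = 0

/-- `u` is of class `C^n`, and it and its derivatives up to order `n` are bounded by `C`. -/
def BD {d : ℕ} {F : Type*} [NormedAddCommGroup F] [NormedSpace ℝ F] (n : ℕ) (C : ℝ)
    (u : Euc d → F) : Prop :=
  ContDiff ℝ n u ∧ ∀ k ≤ n, ∀ x, ‖iteratedFDeriv ℝ k u x‖ ≤ C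

/-! ### Weights and radial integrability. -/

section weights

variable {d : ℕ} {σ : ℝ}

lemma homKernel_nonneg (y : Euc d) : 0 ≤ homKernel d σ y := by
  unfold homKernel; positivity

lemma wt_nonneg (y : Euc d) : 0 ≤ wt σ y := by unfold wt; positivity

lemma measurable_homKernel : Measurable (homKernel d σ) := by
  unfold homKernel; fun_prop

lemma measurable_chi : Measurable (chi d σ) := by
  unfold chi
  split_ifs
  · fun_prop
  · exact measurable_const.indicator measurableSet_ball
  · fun_prop

lemma chi_nonneg (y : Euc d) : 0 ≤ chi d σ y := by
  unfold chi
  split_ifs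
  · rfl
  · exact indicator_nonneg (fun _ _ => zero_le_one) y
  · exact zero_le_one

lemma chi_le_one (y : Euc d) : chi d σ y ≤ 1 := by
  unfold chi
  split_ifs
  · exact zero_le_one
  · exact indicator_le_self' (fun _ _ => zero_le_one) y
  · rfl

lemma chi_neg (y : Euc d) : chi d σ (-y) = chi d σ y := by
  unfold chi
  split_ifs
  · rfl
  · simp [indicator]
  · rfl

/-- A radial function that is dominated by powers at the origin and at infinity is integrable. -/
lemma integrable_radial (hd : 0 < d) {f : ℝ → ℝ} (hf : Measurable f) {p q A B : ℝ}
    (hp : σ < p) (hq : q < σ)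
    (h0 : ∀ t, 0 < t → t ≤ 1 → |f t| ≤ A * t ^ p) (h1 : ∀ t, 1 < t → |f t| ≤ B * t ^ q) :
    Integrable (fun y : Euc d => f ‖y‖ * homKernel d σ y) := by
  have : Nontrivial (Euc d) := by
    have : Nonempty (Fin d) := ⟨⟨0, hd⟩⟩
    infer_instance
  have := (integrable_fun_norm_addHaar (F := ℝ) (volume : Measure (Euc d))
    (f := fun t => f t * t ^ (-((d : ℝ) + σ)))).2 ?_
  · exact this
  -- The polar Jacobian leaves the power `s - σ - 1`, integrable at the origin for `s > σ` and at
  -- infinity for `s < σ`.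
  have key : ∀ s t : ℝ, 0 < t →
      (t ^ s * t ^ (-((d : ℝ) + σ))) * t ^ (d - 1) = t ^ (s - σ - 1) := by
    intro s t ht
    have : ((d - 1 : ℕ) : ℝ) = (d : ℝ) - 1 := by
      rw [Nat.cast_sub hd]; simp
    rw [← Real.rpow_natCast t (d - 1), this, ← Real.rpow_add ht, ← Real.rpow_add ht]
    congr 1; ring
  rw [← Ioc_union_Ioi_eq_Ioi (zero_le_one' ℝ)]
  simp only [finrank_euclideanSpace, Fintype.card_fin, smul_eq_mul]
  refine IntegrableOn.union ?_ ?_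
  · have hi : IntegrableOn (fun t : ℝ => A * t ^ (p - σ - 1)) (Ioc 0 1) := by
      refine Integrable.const_mul ?_ A
      rw [← IntegrableOn, ← intervalIntegrable_iff_integrableOn_Ioc_of_le zero_le_one]
      exact intervalIntegral.intervalIntegrable_rpow' (by linarith)
    refine Integrable.mono' hi (by fun_prop) ?_
    refine (ae_restrict_mem measurableSet_Ioc).mono fun t ht => ?_
    rw [← key p t ht.1, norm_mul, norm_mul, Real.norm_eq_abs, Real.norm_eq_abs, Real.norm_eq_abs,
      abs_of_nonneg (pow_nonneg ht.1.le _), abs_of_nonneg (Real.rpow_nonneg ht.1.le _)]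
    have h2 : 0 ≤ t ^ (d - 1) := pow_nonneg ht.1.le _
    have h3 : 0 ≤ t ^ (-((d : ℝ) + σ)) := Real.rpow_nonneg ht.1.le _
    calc t ^ (d - 1) * (|f t| * t ^ (-((d : ℝ) + σ)))
        ≤ t ^ (d - 1) * ((A * t ^ p) * t ^ (-((d : ℝ) + σ))) := by
          gcongr; exact h0 t ht.1 ht.2
      _ = _ := by ring
  · have hi : IntegrableOn (fun t : ℝ => B * t ^ (q - σ - 1)) (Ioi 1) :=
      Integrable.const_mul (integrableOn_Ioi_rpow_of_lt (by linarith) zero_lt_one) B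
    refine Integrable.mono' hi (by fun_prop) ?_
    refine (ae_restrict_mem measurableSet_Ioi).mono fun t ht => ?_
    have ht0 : (0 : ℝ) < t := zero_lt_one.trans ht
    rw [← key q t ht0, norm_mul, norm_mul, Real.norm_eq_abs, Real.norm_eq_abs, Real.norm_eq_abs,
      abs_of_nonneg (pow_nonneg ht0.le _), abs_of_nonneg (Real.rpow_nonneg ht0.le _)]
    have h2 : 0 ≤ t ^ (d - 1) := pow_nonneg ht0.le _
    have h3 : 0 ≤ t ^ (-((d : ℝ) + σ)) := Real.rpow_nonneg ht0.le _
    calc t ^ (d - 1) * (|f t| * t ^ (-((d : ℝ) + σ)))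
        ≤ t ^ (d - 1) * ((B * t ^ q) * t ^ (-((d : ℝ) + σ))) := by
          gcongr; exact h1 t ht
      _ = _ := by ring

lemma lt_hiExp (hσ2 : σ < 2) : σ < hiExp σ := by
  unfold hiExp; split_ifs <;> assumption

lemma loExp_lt (hσ : 0 < σ) : loExp σ < σ := by
  unfold loExp; split_ifs with h
  · exact hσ
  · exact not_le.1 h

lemma integrable_wt (hd : 0 < d) (hσ : 0 < σ) (hσ2 : σ < 2) :
    Integrable (fun y : Euc d => wt σ y * homKernel d σ y) := by
  refine integrable_radial hd (f := fun t => min (t ^ loExp σ) (t ^ hiExp σ)) (by fun_prop)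
    (lt_hiExp hσ2) (loExp_lt hσ) (A := 1) (B := 1) ?_ ?_
  · intro t ht _
    rw [abs_of_nonneg (by positivity), one_mul]; exact min_le_right _ _
  · intro t ht
    rw [abs_of_nonneg (le_min (by positivity) (by positivity)), one_mul]; exact min_le_left _ _

lemma ae_ne_zero (hd : 0 < d) : ∀ᵐ y : Euc d, y ≠ 0 := by
  have : Nontrivial (Euc d) := by
    have : Nonempty (Fin d) := ⟨⟨0, hd⟩⟩
    infer_instance
  exact (compl_mem_ae_iff.2 (measure_singleton (0 : Euc d)))

lemma Ker.abs_le {ν Λ : ℝ} {K : Euc d → ℝ} (hν : 0 ≤ ν) (hK : Ker d σ ν Λ K) {y : Euc d}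
    (hy : y ≠ 0) : |K y| ≤ Λ * homKernel d σ y := by
  rw [abs_of_nonneg ((mul_nonneg hν (homKernel_nonneg y)).trans (hK.lower y hy))]
  exact hK.upper y hy

lemma Ker.nonneg {ν Λ : ℝ} {K : Euc d → ℝ} (hν : 0 ≤ ν) (hK : Ker d σ ν Λ K) {y : Euc d}
    (hy : y ≠ 0) : 0 ≤ K y :=
  (mul_nonneg hν (homKernel_nonneg y)).trans (hK.lower y hy)

end weights

/-! ### Second differences and the operator on functions with bounded derivatives. -/

section bounded

variable {d : ℕ} {σ : ℝ} {F : Type*} [NormedAddCommGroup F] [NormedSpace ℝ F] {n : ℕ} {C : ℝ}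
  {u v : Euc d → F}

lemma BD.norm_le (h : BD n C u) (x : Euc d) : ‖u x‖ ≤ C := by
  simpa using h.2 0 (Nat.zero_le _) x

lemma BD.nonneg (h : BD n C u) : 0 ≤ C := (norm_nonneg _).trans (h.norm_le 0)

lemma BD.continuous (h : BD n C u) : Continuous u := h.1.continuous

lemma BD.mono {C' : ℝ} {m : ℕ} (h : BD n C u) (hC : C ≤ C') (hm : m ≤ n) : BD m C' u :=
  ⟨h.1.of_le (by exact_mod_cast hm), fun k hk x => (h.2 k (hk.trans hm) x).trans hC⟩

lemma BD.differentiable (h : BD (n + 1) C u) : Differentiable ℝ u :=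
  h.1.differentiable (by simp)

lemma BD.fderiv (h : BD (n + 1) C u) : BD n C (fderiv ℝ u) := by
  refine ⟨?_, fun k hk x => ?_⟩
  · exact h.1.fderiv_right (m := n) (by simp)
  · rw [norm_iteratedFDeriv_fderiv]; exact h.2 (k + 1) (by omega) x

lemma BD.of_fderiv (h0 : Differentiable ℝ u) (h1 : ∀ x, ‖u x‖ ≤ C) (h2 : BD n C (_root_.fderiv ℝ u)) :
    BD (n + 1) C u := by
  refine ⟨?_, fun k hk x => ?_⟩
  · have := contDiff_succ_iff_fderiv (𝕜 := ℝ) (n := n) (f := u)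
    push_cast
    exact this.2 ⟨h0, by simp, h2.1⟩
  · cases k with
    | zero => simpa using h1 x
    | succ k => rw [← norm_iteratedFDeriv_fderiv]; exact h2.2 k (by omega) x

lemma BD.zero_iff : BD 0 C u ↔ Continuous u ∧ ∀ x, ‖u x‖ ≤ C := by
  refine ⟨fun h => ⟨h.continuous, h.norm_le⟩, fun h => ⟨?_, fun k hk x => ?_⟩⟩
  · exact_mod_cast contDiff_zero.2 h.1
  · obtain rfl : k = 0 := by omega
    simpa using h.2 x

lemma BD.norm_sub_le (h : BD 1 C u) (x y : Euc d) : ‖u (x + y) - u x‖ ≤ C * ‖y‖ := by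
  have := Convex.norm_image_sub_le_of_norm_fderiv_le (𝕜 := ℝ) (f := u) (s := univ) (C := C)
    (fun x _ => h.differentiable x) (fun x _ => h.fderiv.norm_le x) convex_univ
    (mem_univ x) (mem_univ (x + y))
  simpa using this

lemma BD.norm_sub_fderiv_le (h : BD 2 C u) (x y : Euc d) :
    ‖u (x + y) - u x - _root_.fderiv ℝ u x y‖ ≤ C * ‖y‖ ^ 2 := by
  have hx : x ∈ closedBall x ‖y‖ := mem_closedBall_self (norm_nonneg _)
  have hy : x + y ∈ closedBall x ‖y‖ := by simp
  have := Convex.norm_image_sub_le_of_norm_fderiv_le' (𝕜 := ℝ) (f := u) (s := closedBall x ‖y‖)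
    (C := C * ‖y‖) (φ := _root_.fderiv ℝ u x)
    (fun x _ => h.differentiable (n := 1) x) (fun z hz => ?_) (convex_closedBall _ _) hx hy
  · simpa [sq, mul_assoc] using this
  · have := h.fderiv.norm_sub_le x (z - x)
    rw [add_sub_cancel] at this
    refine this.trans ?_
    have h2 := h.nonneg
    gcongr
    rw [← dist_eq_norm]; exact hz

/-- Taylor expansion of the order permitted by the truncation for small `y`, and the trivial bounds
on `u` and its gradient for large `y`. The exponents satisfy `loExp σ < σ < hiExp σ`, so this
majorant is integrable against the kernel. -/
lemma norm_sd_le (hσ : 0 < σ) (h : BD 2 C u) (y x : Euc d) : ‖sd σ u y x‖ ≤ 4 * C * wt σ y := by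
  have hC := h.nonneg
  have h0 : ‖u (x + y) - u x‖ ≤ 2 * C := by
    have := norm_sub_le (u (x + y)) (u x)
    linarith [h.norm_le (x + y), h.norm_le x]
  have h1 := (h.mono le_rfl (by norm_num : 1 ≤ 2)).norm_sub_le x y
  have h2 := h.norm_sub_fderiv_le x y
  have h3 : ‖_root_.fderiv ℝ u x y‖ ≤ C * ‖y‖ :=
    (ContinuousLinearMap.le_opNorm _ _).trans (by gcongr; exact h.fderiv.norm_le x)
  have hy := norm_nonneg y
  unfold sd wt chi loExp hiExp
  rcases lt_trichotomy σ 1 with hs | hs | hs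
  · simp only [hs, hs.le, if_true, zero_smul, sub_zero, Real.rpow_zero, Real.rpow_one]
    rcases min_choice (1 : ℝ) ‖y‖ with e | e <;> rw [e] <;> nlinarith
  · subst hs
    simp only [lt_irrefl, le_refl, if_true, if_false, Real.rpow_zero, Real.rpow_two]
    by_cases hy1 : ‖y‖ < 1
    · rw [indicator_of_mem (by simpa using hy1), one_smul, min_eq_right (by nlinarith)]
      nlinarith [mul_nonneg hC (sq_nonneg ‖y‖)]
    · rw [indicator_of_notMem (by simpa using hy1), zero_smul, sub_zero,
        min_eq_left (by nlinarith)]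
      nlinarith
  · simp only [hs.not_gt, hs.not_ge, hs.ne', if_false, one_smul, Real.rpow_one, Real.rpow_two]
    rcases le_or_gt ‖y‖ 1 with hy1 | hy1
    · rw [min_eq_right (by nlinarith)]
      nlinarith [mul_nonneg hC (sq_nonneg ‖y‖)]
    · rw [min_eq_left (by nlinarith)]
      have := norm_sub_le (u (x + y) - u x) (_root_.fderiv ℝ u x y)
      nlinarith [mul_nonneg hC hy]

lemma aestronglyMeasurable_sd (hu : Continuous u) (x : Euc d) :
    AEStronglyMeasurable (fun y => sd σ u y x) volume := by
  unfold sd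
  have h1 : Continuous fun y => u (x + y) - u x := by fun_prop
  exact h1.aestronglyMeasurable.sub
    (measurable_chi.aestronglyMeasurable.smul (_root_.fderiv ℝ u x).continuous.aestronglyMeasurable)

lemma norm_smul_sd_le {ν Λ : ℝ} {K : Euc d → ℝ} (hσ : 0 < σ) (hν : 0 ≤ ν)
    (hK : Ker d σ ν Λ K) (h : BD 2 C u) (x : Euc d) {y : Euc d} (hy : y ≠ 0) :
    ‖K y • sd σ u y x‖ ≤ 4 * C * Λ * (wt σ y * homKernel d σ y) := by
  rw [norm_smul]
  calc ‖K y‖ * ‖sd σ u y x‖ ≤ (Λ * homKernel d σ y) * (4 * C * wt σ y) :=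
        mul_le_mul (hK.abs_le hν hy) (norm_sd_le hσ h y x) (norm_nonneg _)
          ((abs_nonneg _).trans (hK.abs_le hν hy))
    _ = _ := by ring

lemma integrable_smul_sd {ν Λ : ℝ} {K : Euc d → ℝ} (hd : 0 < d) (hσ : 0 < σ) (hσ2 : σ < 2)
    (hν : 0 ≤ ν) (hK : Ker d σ ν Λ K) (h : BD 2 C u) (x : Euc d) :
    Integrable (fun y => K y • sd σ u y x) := by
  refine Integrable.mono' ((integrable_wt hd hσ hσ2).const_mul (4 * C * Λ)) ?_ ?_
  · exact hK.aem.aestronglyMeasurable.smul (aestronglyMeasurable_sd h.continuous x)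
  · exact (ae_ne_zero hd).mono fun y hy => norm_smul_sd_le hσ hν hK h x hy

lemma norm_LL_le {ν Λ : ℝ} {K : Euc d → ℝ} (hd : 0 < d) (hσ : 0 < σ) (hσ2 : σ < 2)
    (hν : 0 ≤ ν) (hK : Ker d σ ν Λ K) (h : BD 2 C u) (x : Euc d) :
    ‖LL σ K u x‖ ≤ 4 * C * Λ * ∫ y : Euc d, wt σ y * homKernel d σ y := by
  rw [← integral_const_mul]
  refine norm_integral_le_of_norm_le ((integrable_wt hd hσ hσ2).const_mul (4 * C * Λ)) ?_
  exact (ae_ne_zero hd).mono fun y hy => norm_smul_sd_le hσ hν hK h x hy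

lemma symm_snd_deriv (h : BD 2 C u) (x y z : Euc d) :
    _root_.fderiv ℝ (_root_.fderiv ℝ u) x y z = _root_.fderiv ℝ (_root_.fderiv ℝ u) x z y := by
  have := ContDiffAt.isSymmSndFDerivAt (𝕜 := ℝ) (h.1.contDiffAt (x := x)) (by simp)
  exact this y z

/-- Differentiating the gradient term puts the increment in the second slot of the Hessian, while
`sd` of the derivative has it in the first; symmetry of the Hessian reconciles them. -/
lemma hasFDerivAt_sd (h : BD 2 C u) (y x : Euc d) :
    HasFDerivAt (fun x => sd σ u y x) (sd σ (_root_.fderiv ℝ u) y x) x := by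
  have hu := h.differentiable (n := 1)
  have hu' := h.fderiv.differentiable (n := 0)
  have h1 : HasFDerivAt (fun x => u (x + y)) (_root_.fderiv ℝ u (x + y)) x := by
    rw [hasFDerivAt_comp_add_right]; exact (hu _).hasFDerivAt
  have h2 : HasFDerivAt (fun x => _root_.fderiv ℝ u x y)
      ((_root_.fderiv ℝ (_root_.fderiv ℝ u) x).flip y) x :=
    ((hu' x).hasFDerivAt.clm_apply (hasFDerivAt_const y x)).congr_fderiv (by
      ext z; simp)
  have h3 := (h1.sub (hu x).hasFDerivAt).sub (h2.const_smul (chi d σ y))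
  refine h3.congr_fderiv ?_
  unfold sd
  congr 2
  ext z
  simpa using symm_snd_deriv h x z y

/-- Each derivative of a second difference is the second difference of a derivative with values in a
larger space. Hence the induction varies the target `F`, and operators on vector valued functions
are needed. -/
lemma BD.sd (hσ : 0 < σ) (h : BD (n + 2) C u) (y : Euc d) :
    BD n (4 * C * wt σ y) (Nonlocal.sd σ u y) := by
  induction n generalizing F with
  | zero =>
    refine BD.zero_iff.2 ⟨?_, norm_sd_le hσ h y⟩
    exact continuous_iff_continuousAt.2 fun x => (hasFDerivAt_sd h y x).continuousAt
  | succ n ih =>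
    have h2 : BD 2 C u := h.mono le_rfl (by omega)
    refine BD.of_fderiv (fun x => (hasFDerivAt_sd h2 y x).differentiableAt)
      (norm_sd_le hσ h2 y) ?_
    have : _root_.fderiv ℝ (Nonlocal.sd σ u y) = Nonlocal.sd σ (_root_.fderiv ℝ u) y :=
      funext fun x => (hasFDerivAt_sd h2 y x).fderiv
    rw [this]
    exact ih h.fderiv

lemma hasFDerivAt_LL {ν Λ : ℝ} {K : Euc d → ℝ} (hd : 0 < d) (hσ : 0 < σ) (hσ2 : σ < 2)
    (hν : 0 ≤ ν) (hK : Ker d σ ν Λ K) (h : BD 3 C u) (x : Euc d) :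
    HasFDerivAt (LL σ K u) (LL σ K (_root_.fderiv ℝ u) x) x := by
  have h2 : BD 2 C u := h.mono le_rfl (by omega)
  refine hasFDerivAt_integral_of_dominated_of_fderiv_le (𝕜 := ℝ) (s := univ)
    (F := fun x y => K y • Nonlocal.sd σ u y x)
    (F' := fun x y => K y • Nonlocal.sd σ (_root_.fderiv ℝ u) y x) univ_mem
    (Eventually.of_forall fun x => (integrable_smul_sd hd hσ hσ2 hν hK h2 x).1)
    (integrable_smul_sd hd hσ hσ2 hν hK h2 x)
    (integrable_smul_sd hd hσ hσ2 hν hK h.fderiv x).1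
    ((ae_ne_zero hd).mono fun y hy x _ => norm_smul_sd_le hσ hν hK h.fderiv x hy)
    ((integrable_wt hd hσ hσ2).const_mul _)
    (Eventually.of_forall fun y x _ => ((hasFDerivAt_sd h2 y x).const_smul (K y)))

lemma BD.LL {ν Λ : ℝ} {K : Euc d → ℝ} (hd : 0 < d) (hσ : 0 < σ) (hσ2 : σ < 2)
    (hν : 0 ≤ ν) (hK : Ker d σ ν Λ K) (h : BD (n + 3) C u) :
    BD n (4 * C * Λ * ∫ y : Euc d, wt σ y * homKernel d σ y) (Nonlocal.LL σ K u) := by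
  have h3 : BD 3 C u := h.mono le_rfl (by omega)
  have h2 : BD 2 C u := h.mono le_rfl (by omega)
  induction n generalizing F with
  | zero =>
    refine BD.zero_iff.2 ⟨?_, norm_LL_le hd hσ hσ2 hν hK h2⟩
    exact continuous_iff_continuousAt.2 fun x => (hasFDerivAt_LL hd hσ hσ2 hν hK h3 x).continuousAt
  | succ n ih =>
    refine BD.of_fderiv (fun x => (hasFDerivAt_LL hd hσ hσ2 hν hK h3 x).differentiableAt)
      (norm_LL_le hd hσ hσ2 hν hK h2) ?_
    have : _root_.fderiv ℝ (Nonlocal.LL σ K u) = Nonlocal.LL σ K (_root_.fderiv ℝ u) :=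
      funext fun x => (hasFDerivAt_LL hd hσ hσ2 hν hK h3 x).fderiv
    rw [this]
    exact ih h.fderiv (h.fderiv.mono le_rfl (by omega)) (h.fderiv.mono le_rfl (by omega))

end bounded

end Nonlocal

end

noncomputable section

namespace Nonlocal

/-! ### Commutation of two translation invariant operators. -/

section commute

variable {d : ℕ} {σ : ℝ} {F : Type*} [NormedAddCommGroup F] [NormedSpace ℝ F] {C : ℝ}
  {u v : Euc d → F}

lemma sd_sd_comm (h : BD 4 C u) (x y z : Euc d) :
    sd σ (sd σ u z) y x = sd σ (sd σ u y) z x := by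
  have h2 : BD 2 C u := h.mono le_rfl (by omega)
  have e : ∀ y, fderiv ℝ (sd σ u y) x = sd σ (fderiv ℝ u) y x :=
    fun y => (hasFDerivAt_sd h2 y x).fderiv
  have e1 : ∀ y z, sd σ (sd σ u z) y x =
      sd σ u z (x + y) - sd σ u z x - chi d σ y • fderiv ℝ (sd σ u z) x y := fun _ _ => rfl
  rw [e1, e1, e, e]
  unfold sd
  simp only [_root_.sub_apply, _root_.smul_apply, smul_sub]
  rw [symm_snd_deriv h2 x y z, smul_comm (chi d σ z) (chi d σ y), add_right_comm x z y]
  abel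

/-- Two translation invariant operators commute on smooth bounded functions. -/
lemma LL_comm [CompleteSpace F] {ν₁ Λ₁ ν₂ Λ₂ : ℝ} {K₁ K₂ : Euc d → ℝ} (hd : 0 < d) (hσ : 0 < σ)
    (hσ2 : σ < 2) (hν₁ : 0 ≤ ν₁) (hν₂ : 0 ≤ ν₂) (hK₁ : Ker d σ ν₁ Λ₁ K₁) (hK₂ : Ker d σ ν₂ Λ₂ K₂)
    (h : BD 4 C u) (x : Euc d) :
    LL σ K₁ (LL σ K₂ u) x = LL σ K₂ (LL σ K₁ u) x := by
  have h3 : BD 3 C u := h.mono le_rfl (by omega)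
  have h2 : BD 2 C u := h.mono le_rfl (by omega)
  -- A second difference of `LL σ K u` can be taken under the integral sign; both compositions then
  -- become iterated integrals of one function of `(y, z)`, and Fubini applies.
  have step : ∀ {ν Λ : ℝ} {K : Euc d → ℝ}, 0 ≤ ν → Ker d σ ν Λ K → ∀ y,
      sd σ (LL σ K u) y x = ∫ z, K z • sd σ (sd σ u y) z x := by
    intro ν Λ K hν hK y
    have i1 := integrable_smul_sd hd hσ hσ2 hν hK h2 (x + y)
    have i2 := integrable_smul_sd hd hσ hσ2 hν hK h2 x
    have i3 := integrable_smul_sd hd hσ hσ2 hν hK (h.fderiv.mono le_rfl (by omega)) x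
    have : sd σ (LL σ K u) y x =
      LL σ K u (x + y) - LL σ K u x - chi d σ y • fderiv ℝ (LL σ K u) x y := rfl
    rw [this, (hasFDerivAt_LL hd hσ hσ2 hν hK h3 x).fderiv]
    unfold LL
    have i4 := (i3.apply_continuousLinearMap y).smul (chi d σ y)
    rw [ContinuousLinearMap.integral_apply i3, ← integral_sub i1 i2, ← integral_smul]
    refine (integral_sub (i1.sub i2) i4).symm.trans ?_
    congr 1
    ext z
    rw [sd_sd_comm h x z y]
    have e : sd σ (sd σ u z) y x =
      sd σ u z (x + y) - sd σ u z x - chi d σ y • fderiv ℝ (sd σ u z) x y := rfl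
    rw [e, (hasFDerivAt_sd h2 z x).fderiv]
    simp only [Pi.sub_apply, Pi.smul_apply, _root_.smul_apply, smul_sub]
    rw [smul_comm (K z)]
  have e1 : LL σ K₁ (LL σ K₂ u) x = ∫ y, ∫ z, K₁ y • K₂ z • sd σ (sd σ u y) z x := by
    conv_lhs => unfold LL
    congr 1; ext y
    change K₁ y • sd σ (LL σ K₂ u) y x = _
    rw [step hν₂ hK₂, integral_smul]
  have e2 : LL σ K₂ (LL σ K₁ u) x = ∫ z, ∫ y, K₁ y • K₂ z • sd σ (sd σ u y) z x := by
    conv_lhs => unfold LL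
    congr 1; ext z
    change K₂ z • sd σ (LL σ K₁ u) z x = _
    rw [step hν₁ hK₁, ← integral_smul]
    congr 1; ext y
    rw [sd_sd_comm h x z y, smul_comm]
  rw [e1, e2]
  refine integral_integral_swap ?_
  -- The factor `16` is `4 * 4`: the bound for second differences is applied twice, using four
  -- derivatives of `u`.
  refine Integrable.mono' (g := fun p : Euc d × Euc d => 16 * C * Λ₁ * Λ₂ *
    ((wt σ p.1 * homKernel d σ p.1) * (wt σ p.2 * homKernel d σ p.2))) ?_ ?_ ?_
  · exact ((integrable_wt hd hσ hσ2).mul_prod (integrable_wt hd hσ hσ2)).const_mul _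
  · refine (hK₁.aem.aestronglyMeasurable.comp_fst).smul
      ((hK₂.aem.aestronglyMeasurable.comp_snd).smul ?_)
    have hu := h.continuous
    have hu1 := h.fderiv.continuous
    have hu2 := h.fderiv.fderiv.continuous
    have hc1 : AEStronglyMeasurable (fun p : Euc d × Euc d => chi d σ p.1) volume :=
      (measurable_chi.comp measurable_fst).aestronglyMeasurable
    have hc2 : AEStronglyMeasurable (fun p : Euc d × Euc d => chi d σ p.2) volume :=
      (measurable_chi.comp measurable_snd).aestronglyMeasurable
    have : (fun p : Euc d × Euc d => sd σ (sd σ u p.1) p.2 x) = fun p =>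
        (u (x + p.2 + p.1) - u (x + p.2) - chi d σ p.1 • fderiv ℝ u (x + p.2) p.1)
        - (u (x + p.1) - u x - chi d σ p.1 • fderiv ℝ u x p.1)
        - chi d σ p.2 • (fderiv ℝ u (x + p.1) p.2 - fderiv ℝ u x p.2
            - chi d σ p.1 • fderiv ℝ (fderiv ℝ u) x p.1 p.2) := by
      ext p
      have e : sd σ (sd σ u p.1) p.2 x = sd σ u p.1 (x + p.2) - sd σ u p.1 x -
        chi d σ p.2 • fderiv ℝ (sd σ u p.1) x p.2 := rfl
      rw [e, (hasFDerivAt_sd h2 p.1 x).fderiv]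
      simp [sd]
    rw [this]
    have m1 : Continuous fun p : Euc d × Euc d => u (x + p.2 + p.1) - u (x + p.2) := by fun_prop
    have m2 : Continuous fun p : Euc d × Euc d => fderiv ℝ u (x + p.2) p.1 := by fun_prop
    have m3 : Continuous fun p : Euc d × Euc d => u (x + p.1) - u x := by fun_prop
    have m4 : Continuous fun p : Euc d × Euc d => fderiv ℝ u x p.1 := by fun_prop
    have m5 : Continuous fun p : Euc d × Euc d => fderiv ℝ u (x + p.1) p.2 - fderiv ℝ u x p.2 := by
      fun_prop
    have m6 : Continuous fun p : Euc d × Euc d => fderiv ℝ (fderiv ℝ u) x p.1 p.2 := by fun_prop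
    exact ((m1.aestronglyMeasurable.sub (hc1.smul m2.aestronglyMeasurable)).sub
      (m3.aestronglyMeasurable.sub (hc1.smul m4.aestronglyMeasurable))).sub
      (hc2.smul (m5.aestronglyMeasurable.sub (hc1.smul m6.aestronglyMeasurable)))
  · have a1 : ∀ᵐ p : Euc d × Euc d, p.1 ≠ 0 :=
      Measure.quasiMeasurePreserving_fst.ae (ae_ne_zero hd)
    have a2 : ∀ᵐ p : Euc d × Euc d, p.2 ≠ 0 :=
      Measure.quasiMeasurePreserving_snd.ae (ae_ne_zero hd)
    filter_upwards [a1, a2] with p hp1 hp2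
    have b1 := hK₁.abs_le hν₁ hp1
    have b2 := hK₂.abs_le hν₂ hp2
    have b3 := norm_sd_le hσ (BD.sd (n := 2) hσ h p.1) p.2 x
    simp only [Function.uncurry]
    rw [norm_smul, norm_smul, Real.norm_eq_abs, Real.norm_eq_abs]
    calc |K₁ p.1| * (|K₂ p.2| * ‖sd σ (sd σ u p.1) p.2 x‖)
        ≤ (Λ₁ * homKernel d σ p.1) * ((Λ₂ * homKernel d σ p.2) *
          (4 * (4 * C * wt σ p.1) * wt σ p.2)) := by
          refine mul_le_mul b1 (mul_le_mul b2 b3 (norm_nonneg _) ((abs_nonneg _).trans b2))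
            (by positivity) ((abs_nonneg _).trans b1)
      _ = _ := by ring

end commute

/-! ### Linearity of the operator and of the class `BD`. -/

section algebra

variable {d : ℕ} {σ : ℝ} {F : Type*} [NormedAddCommGroup F] [NormedSpace ℝ F] {n : ℕ} {C C' : ℝ}
  {u v : Euc d → F}

lemma BD.add (hu : BD n C u) (hv : BD n C' v) : BD n (C + C') (u + v) := by
  refine ⟨hu.1.add hv.1, fun k hk x => ?_⟩
  rw [iteratedFDeriv_add_apply (hu.1.contDiffAt.of_le (by exact_mod_cast hk))
    (hv.1.contDiffAt.of_le (by exact_mod_cast hk))]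
  exact (norm_add_le _ _).trans (add_le_add (hu.2 k hk x) (hv.2 k hk x))

lemma BD.const_smul (hu : BD n C u) (c : ℝ) : BD n (|c| * C) (c • u) := by
  refine ⟨contDiff_const.smul hu.1, fun k hk x => ?_⟩
  rw [iteratedFDeriv_const_smul_apply (hu.1.contDiffAt.of_le (by exact_mod_cast hk)), norm_smul]
  exact mul_le_mul_of_nonneg_left (hu.2 k hk x) (abs_nonneg _)

lemma BD.sub (hu : BD n C u) (hv : BD n C' v) : BD n (C + C') (u - v) := by
  have := hu.add (hv.const_smul (-1))
  simpa [sub_eq_add_neg] using this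

variable {ν Λ : ℝ} {K : Euc d → ℝ}

lemma LL_sub (hd : 0 < d) (hσ : 0 < σ) (hσ2 : σ < 2)
    (hν : 0 ≤ ν) (hK : Ker d σ ν Λ K) (hu : BD 2 C u) (hv : BD 2 C' v) (x : Euc d) :
    LL σ K (u - v) x = LL σ K u x - LL σ K v x := by
  unfold LL
  rw [← integral_sub (integrable_smul_sd hd hσ hσ2 hν hK hu x)
    (integrable_smul_sd hd hσ hσ2 hν hK hv x)]
  congr 1; ext y
  unfold sd
  rw [fderiv_sub (hu.differentiable (n := 1) x) (hv.differentiable (n := 1) x)]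
  simp only [Pi.sub_apply, _root_.sub_apply, smul_sub]
  abel

lemma LL_smul (c : ℝ) (x : Euc d) : LL σ K (c • u) x = c • LL σ K u x := by
  unfold LL
  rw [← integral_smul]
  congr 1; ext y
  unfold sd
  rw [fderiv_const_smul_field]
  simp only [Pi.smul_apply, _root_.smul_apply, smul_sub]
  rw [smul_comm c (K y), smul_comm c (K y), smul_comm c (K y), smul_comm c (chi d σ y)]

lemma nonlocalOp_eq_LL (u : Euc d → ℝ) (x : Euc d) : nonlocalOp d σ K u x = LL σ K u x := by
  unfold nonlocalOp LL sd
  congr 1; ext y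
  simp only [smul_eq_mul]; ring

end algebra

/-! ### The fractional Laplacian as the operator with homogeneous kernel. -/

section fractional

variable {d : ℕ} {σ : ℝ} {C : ℝ}

lemma homKernel_neg (y : Euc d) : homKernel d σ (-y) = homKernel d σ y := by
  simp [homKernel]

/-- Reflection invariance of Lebesgue measure; no integrability is needed, as the integral is `0` by
default otherwise. -/
lemma integral_eq_zero_of_odd {F : Type*} [NormedAddCommGroup F] [NormedSpace ℝ F]
    {g : Euc d → F} (hg : ∀ y, g (-y) = -g y) : ∫ y, g y = 0 := by
  have h := integral_neg_eq_self g (volume : Measure (Euc d))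
  simp only [hg, integral_neg] at h
  have h2 : (2 : ℝ) • ∫ y, g y = 0 := by
    rw [two_smul]; nth_rewrite 1 [← h]; simp
  simpa using h2

lemma ker_homKernel : Ker d σ 1 1 (homKernel d σ) where
  aem := measurable_homKernel.aemeasurable
  lower y _ := by rw [one_mul]
  upper y _ := by rw [one_mul]
  cancel _ a b _ _ := by
    rw [← integral_indicator (measurableSet_ball.diff measurableSet_ball)]
    refine integral_eq_zero_of_odd fun y => ?_
    simp only [indicator, homKernel_neg, Set.mem_sdiff, mem_ball_zero_iff, norm_neg, smul_neg]
    split_ifs <;> simp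

/-- Outside each ball the gradient term may be inserted for free because it is odd; the resulting
integrand is absolutely integrable, so the principal value is a limit by dominated convergence. -/
lemma fracLaplacian_eq_LL (hd : 0 < d) (hσ : 0 < σ) (hσ2 : σ < 2) {u : Euc d → ℝ} (h : BD 2 C u)
    (x : Euc d) :
    fracLaplacian d σ u x = -((fracConst d σ)⁻¹ * LL σ (homKernel d σ) u x) := by
  unfold fracLaplacian
  congr 2
  refine Tendsto.limUnder_eq ?_
  have hi := integrable_smul_sd hd hσ hσ2 zero_le_one ker_homKernel h x
  have hm : ∀ ε : ℝ, MeasurableSet {y : Euc d | ε < ‖y‖} := fun ε =>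
    measurableSet_lt measurable_const measurable_norm
  have key : ∀ ε : ℝ, 0 < ε → ∫ y in {y : Euc d | ε < ‖y‖},
      (u (x + y) - u x) / ‖y‖ ^ ((d : ℝ) + σ) =
      ∫ y, {y : Euc d | ε < ‖y‖}.indicator (fun y => homKernel d σ y • sd σ u y x) y := by
    intro ε hε
    -- The truncated integrand is bounded by `2 * C` times the kernel. The power bound near the
    -- origin holds with constant `2 * C * ε ^ (-hiExp σ)` since nothing is left where `t ≤ ε`.
    have i2 : Integrable (fun y => {y : Euc d | ε < ‖y‖}.indicator
        (fun y => (u (x + y) - u x) / ‖y‖ ^ ((d : ℝ) + σ)) y) := by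
      have hb : Integrable (fun y : Euc d => (Ioi ε).indicator (fun _ => 2 * C) ‖y‖ *
          homKernel d σ y) := by
        refine integrable_radial hd (f := (Ioi ε).indicator (fun _ => 2 * C))
          (measurable_const.indicator measurableSet_Ioi) (p := hiExp σ) (q := 0)
          (lt_hiExp hσ2) hσ (A := 2 * C * ε ^ (-hiExp σ)) (B := 2 * C) ?_ ?_
        · intro t ht _
          have hC := h.nonneg
          by_cases hεt : t ∈ Ioi ε
          · rw [indicator_of_mem hεt, abs_of_nonneg (by positivity), mul_assoc,
              Real.rpow_neg hε.le]
            have hp : 0 < hiExp σ := hσ.trans (lt_hiExp hσ2)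
            have : 1 ≤ (ε ^ hiExp σ)⁻¹ * t ^ hiExp σ := by
              rw [inv_mul_eq_div, one_le_div (by positivity)]
              exact Real.rpow_le_rpow hε.le (le_of_lt hεt) hp.le
            nlinarith
          · rw [indicator_of_notMem hεt, abs_zero]; positivity
        · intro t ht
          have hC := h.nonneg
          rw [Real.rpow_zero, mul_one]
          by_cases hεt : t ∈ Ioi ε
          · rw [indicator_of_mem hεt, abs_of_nonneg (by positivity)]
          · rw [indicator_of_notMem hεt, abs_zero]; positivity
      refine Integrable.mono' hb ?_ (Eventually.of_forall fun y => ?_)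
      · refine AEStronglyMeasurable.indicator ?_ (hm ε)
        have hu := h.continuous
        have : Measurable fun y : Euc d => (u (x + y) - u x) / ‖y‖ ^ ((d : ℝ) + σ) := by fun_prop
        exact this.aestronglyMeasurable
      · by_cases hy : y ∈ {y : Euc d | ε < ‖y‖}
        · rw [indicator_of_mem hy, indicator_of_mem (show ‖y‖ ∈ Ioi ε from hy), norm_div,
            div_eq_mul_inv, homKernel, Real.rpow_neg (norm_nonneg _), Real.norm_eq_abs (‖y‖ ^ _),
            abs_of_nonneg (Real.rpow_nonneg (norm_nonneg _) _)]
          gcongr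
          have := norm_sub_le (u (x + y)) (u x)
          linarith [h.norm_le (x + y), h.norm_le x]
        · rw [indicator_of_notMem hy, indicator_of_notMem (show ‖y‖ ∉ Ioi ε from hy)]
          simp
    rw [← integral_indicator (hm ε), ← sub_eq_zero, ← integral_sub i2 (hi.indicator (hm ε))]
    refine integral_eq_zero_of_odd fun y => ?_
    by_cases hy : y ∈ {y : Euc d | ε < ‖y‖}
    · have hy' : -y ∈ {y : Euc d | ε < ‖y‖} := by simpa using hy
      rw [indicator_of_mem hy, indicator_of_mem hy, indicator_of_mem hy', indicator_of_mem hy',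
        homKernel_neg]
      simp only [sd, chi_neg, homKernel, Real.rpow_neg (norm_nonneg _), map_neg, smul_eq_mul,
        norm_neg, div_eq_mul_inv]
      ring
    · have hy' : -y ∉ {y : Euc d | ε < ‖y‖} := by simpa using hy
      rw [indicator_of_notMem hy, indicator_of_notMem hy, indicator_of_notMem hy',
        indicator_of_notMem hy']
      simp
  refine Tendsto.congr' (f₁ := fun ε : ℝ =>
      ∫ y, {y : Euc d | ε < ‖y‖}.indicator (fun y => homKernel d σ y • sd σ u y x) y)
    (eventually_mem_nhdsWithin.mono fun ε hε => (key ε hε).symm) ?_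
  unfold LL
  refine tendsto_integral_filter_of_dominated_convergence
    (fun y => ‖homKernel d σ y • sd σ u y x‖) ?_ ?_ hi.norm ?_
  · exact Eventually.of_forall fun ε => hi.1.indicator (hm ε)
  · exact Eventually.of_forall fun ε => Eventually.of_forall fun y =>
      norm_indicator_le_norm_self _ _
  · refine (ae_ne_zero hd).mono fun y hy => ?_
    refine tendsto_const_nhds.congr' ?_
    have : ∀ᶠ ε : ℝ in 𝓝[>] 0, ε < ‖y‖ :=
      nhdsWithin_le_nhds (eventually_lt_nhds (norm_pos_iff.2 hy))
    refine this.mono fun ε hε => ?_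
    have hy' : y ∈ {y : Euc d | ε < ‖y‖} := hε
    simp only [indicator_of_mem hy']

end fractional

end Nonlocal

end

noncomputable section

namespace Nonlocal

/-! ### Interior Hölder estimate by doubling the variables. -/

section holder

variable {d : ℕ} {σ : ℝ}

/-- The tail weight `(1 + |y|) ^ (-(d + σ))`. -/
def om (d : ℕ) (σ : ℝ) (y : Euc d) : ℝ := (1 + ‖y‖) ^ (-((d : ℝ) + σ))

/-- The weighted `L_1` norm that measures the tail of a function. -/
def tail (d : ℕ) (σ : ℝ) (v : Euc d → ℝ) : ℝ := ∫ y, |v y| * om d σ y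

lemma om_nonneg (y : Euc d) : 0 ≤ om d σ y := by unfold om; positivity

lemma measurable_om : Measurable (om d σ) := by unfold om; fun_prop

lemma integrable_om (hσ : 0 < σ) : Integrable (om d σ) := by
  unfold om
  refine integrable_one_add_norm ?_
  simp [hσ]

lemma integrable_mul_om (hσ : 0 < σ) {v : Euc d → ℝ} (hv : AEStronglyMeasurable v volume) {C : ℝ}
    (hC : ∀ x, |v x| ≤ C) : Integrable (fun y => |v y| * om d σ y) := by
  refine (integrable_om hσ).bdd_mul (c := C) ?_ ?_
  · exact hv.norm
  · exact Eventually.of_forall fun x => by simpa using hC x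

lemma tail_nonneg (v : Euc d → ℝ) : 0 ≤ tail d σ v :=
  integral_nonneg fun y => mul_nonneg (abs_nonneg _) (om_nonneg y)

/-- Strict concavity at `3/2` and `1/2`, whose mean is `1`, plus continuity. With `a = x - y` and
`z` close to `a/2`, these are the ratios of `|a + z|` and `|a - z|` to `|a|`. -/
lemma exists_rpow_concave_gap {α : ℝ} (h0 : 0 < α) (h1 : α < 1) :
    ∃ ε c : ℝ, 0 < ε ∧ ε ≤ 1 / 4 ∧ 0 < c ∧ (3 / 2 + ε) ^ α + (1 / 2 + ε) ^ α ≤ 2 - c := by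
  have hs := (Real.strictConcaveOn_rpow h0 h1).2 (show (3 / 2 : ℝ) ∈ Ici 0 by norm_num)
    (show (1 / 2 : ℝ) ∈ Ici 0 by norm_num) (by norm_num) (by norm_num : (0 : ℝ) < 1 / 2)
    (by norm_num : (0 : ℝ) < 1 / 2) (by norm_num)
  norm_num at hs
  have hlt : (3 / 2 + (0 : ℝ)) ^ α + (1 / 2 + 0) ^ α < 2 := by
    rw [add_zero, add_zero]; norm_num; linarith
  have hc : ContinuousAt (fun ε : ℝ => (3 / 2 + ε) ^ α + (1 / 2 + ε) ^ α) 0 := by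
    have h := (Real.continuous_rpow_const h0.le)
    have : Continuous (fun ε : ℝ => (3 / 2 + ε) ^ α + (1 / 2 + ε) ^ α) := by fun_prop
    exact this.continuousAt
  have hev := hc.eventually (eventually_lt_nhds hlt)
  obtain ⟨δ, hδ, h⟩ := Metric.eventually_nhds_iff.1 hev
  have h2 := h (y := min (δ / 2) (1 / 4)) (by
    rw [Real.dist_eq, sub_zero, abs_of_pos (by positivity)]
    exact (min_le_left _ _).trans_lt (by linarith))
  refine ⟨min (δ / 2) (1 / 4), 2 - ((3 / 2 + min (δ / 2) (1 / 4)) ^ α +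
    (1 / 2 + min (δ / 2) (1 / 4)) ^ α), by positivity, min_le_right _ _, by linarith, by linarith⟩

/-- The left side is what remains of the quadratic penalty `|x + z|^2 - |x|^2` after the truncated
gradient is subtracted. -/
lemma wt_near {z : Euc d} (hz : ‖z‖ < 1 / 8) :
    (1 - chi d σ z) * ‖z‖ + ‖z‖ ^ 2 ≤ 2 * wt σ z := by
  have h0 := norm_nonneg z
  unfold wt chi loExp hiExp
  rcases lt_trichotomy σ 1 with hs | hs | hs
  · simp only [hs, hs.le, if_true, sub_zero, Real.rpow_zero, Real.rpow_one]
    rw [min_eq_right (by linarith)]; nlinarith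
  · subst hs
    simp only [lt_irrefl, le_refl, if_true, if_false, Real.rpow_zero, Real.rpow_two]
    rw [indicator_of_mem (by simp; linarith), min_eq_right (by nlinarith)]; nlinarith
  · simp only [hs.not_gt, hs.not_ge, hs.ne', if_false, Real.rpow_one, Real.rpow_two]
    rw [min_eq_right (by nlinarith)]; nlinarith

lemma wt_far {z : Euc d} (hz : 1 / 8 ≤ ‖z‖) : 1 ≤ 64 * wt σ z := by
  have h0 := norm_nonneg z
  unfold wt loExp hiExp
  rcases lt_trichotomy σ 1 with hs | hs | hs
  · simp only [hs, hs.le, if_true, Real.rpow_zero, Real.rpow_one]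
    rcases min_choice (1 : ℝ) ‖z‖ with e | e <;> rw [e] <;> linarith
  · subst hs
    simp only [lt_irrefl, le_refl, if_true, if_false, Real.rpow_zero, Real.rpow_two]
    rcases min_choice (1 : ℝ) (‖z‖ ^ 2) with e | e <;> rw [e] <;> nlinarith
  · simp only [hs.not_gt, hs.not_ge, if_false, Real.rpow_one, Real.rpow_two]
    rcases min_choice ‖z‖ (‖z‖ ^ 2) with e | e <;> rw [e] <;> nlinarith

lemma wt_far_chi {z : Euc d} (hz : 1 / 8 ≤ ‖z‖) : chi d σ z * ‖z‖ ≤ 64 * wt σ z := by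
  have h0 := norm_nonneg z
  have h1 := wt_far (σ := σ) hz
  rcases lt_trichotomy σ 1 with hs | hs | hs
  · have : chi d σ z = 0 := by simp [chi, hs]
    rw [this]; linarith
  · subst hs
    by_cases hz1 : ‖z‖ < 1
    · nlinarith [chi_le_one (σ := 1) z, chi_nonneg (σ := 1) z]
    · have : chi d 1 z = 0 := by simp [chi, hz1]
      rw [this]; linarith
  · unfold wt chi loExp hiExp
    simp only [hs.not_gt, hs.not_ge, hs.ne', if_false, Real.rpow_one, Real.rpow_two]
    rcases min_choice ‖z‖ (‖z‖ ^ 2) with e | e <;> rw [e] <;> nlinarith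

lemma homKernel_le_om (hσ : 0 < σ) {x z : Euc d} (hx : ‖x‖ ≤ 1 / 2) (hz : 1 / 8 ≤ ‖z‖) :
    homKernel d σ z ≤ 13 ^ ((d : ℝ) + σ) * om d σ (x + z) := by
  unfold homKernel om
  have hs : 0 ≤ (d : ℝ) + σ := by positivity
  -- Here `1 + 1/2 ≤ 12 |z|`, because `|z| ≥ 1/8`.
  have h1 : 1 + ‖x + z‖ ≤ 13 * ‖z‖ := by
    have := norm_add_le x z
    linarith
  rw [Real.rpow_neg (norm_nonneg _), Real.rpow_neg (by positivity)]
  rw [← div_eq_mul_inv, inv_eq_one_div, div_le_div_iff₀ (by positivity) (by positivity), one_mul,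
    ← Real.mul_rpow (by norm_num) (norm_nonneg _)]
  exact Real.rpow_le_rpow (by positivity) h1 hs

lemma homKernel_anti (hσ : 0 < σ) {z : Euc d} {r : ℝ} (hz : z ≠ 0) (h : ‖z‖ ≤ r) :
    r ^ (-((d : ℝ) + σ)) ≤ homKernel d σ z := by
  unfold homKernel
  have : 0 < ‖z‖ := norm_pos_iff.2 hz
  refine Real.rpow_le_rpow_of_nonpos this h ?_
  have : (0 : ℝ) ≤ d := by positivity
  linarith

/-- First order condition at an interior maximum of the doubled functional. -/
lemma fderiv_sub_of_max {v : Euc d → ℝ} {C : ℝ} (hv : BD 2 C v) {C₂ : ℝ} {x y : Euc d}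
    (h : ∀ z : Euc d, ‖z‖ < 1 / 8 →
      v (x + z) - v x - (v (y + z) - v y) ≤ C₂ * (‖x + z‖ ^ 2 - ‖x‖ ^ 2)) (z : Euc d) :
    fderiv ℝ v x z - fderiv ℝ v y z = 2 * C₂ * inner ℝ x z := by
  have hd := hv.differentiable (n := 1)
  -- Moving both points by the same `z` keeps `x - y` fixed, so the Hölder penalty is absent and
  -- only the quadratic one contributes to the gradient.
  have hmax : IsLocalMax (fun z => v (x + z) - v (y + z) - C₂ * ‖x + z‖ ^ 2) 0 := by
    filter_upwards [Metric.ball_mem_nhds (0 : Euc d) (by norm_num : (0 : ℝ) < 1 / 8)] with z hz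
    have := h z (by simpa using hz)
    simp only [add_zero]
    linarith
  have h1 : ∀ x : Euc d, HasFDerivAt (fun z => v (x + z)) (fderiv ℝ v x) 0 := fun x => by
    rw [hasFDerivAt_comp_add_left, add_zero]; exact (hd x).hasFDerivAt
  have h2 : HasFDerivAt (fun z : Euc d => ‖x + z‖ ^ 2) (2 • innerSL ℝ x) 0 := by
    have := (hasStrictFDerivAt_norm_sq (x + 0)).hasFDerivAt
    rw [add_zero] at this
    have h3 := (hasFDerivAt_comp_add_left (𝕜 := ℝ) (f := fun z : Euc d => ‖z‖ ^ 2)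
      (f' := 2 • innerSL ℝ x) (x := 0) x)
    rw [h3, add_zero]
    exact this
  have h3 := ((h1 x).sub (h1 y)).sub (h2.const_mul C₂)
  have h4 := hmax.hasFDerivAt_eq_zero h3
  have h5 := DFunLike.congr_fun h4 z
  simp at h5
  linarith

/-- If the one-sided Hölder bound fails, the doubled functional has a positive interior maximum. -/
lemma exists_max_of_not_holder {v : Euc d → ℝ} (hv : Continuous v) {α B N : ℝ} (hα : 0 < α)
    (hB : 0 < B) (hN : 2 * 16 ^ α ≤ N) (hvB : ∀ x ∈ closedBall (0 : Euc d) 1, |v x| ≤ B)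
    {y₀ : Euc d} (hy₀ : ‖y₀‖ ≤ 1 / 2) (hcon : N * B * ‖y₀‖ ^ α < v 0 - v y₀) :
    ∃ x y : Euc d, ‖x‖ ≤ 1 / 4 ∧ ‖y‖ ≤ 5 / 16 ∧ x ≠ y ∧ ‖x - y‖ < 1 / 16 ∧ v y ≤ v x ∧
      (∀ z : Euc d, ‖z‖ < 1 / 8 →
        v (x + z) - v x - (v (y + z) - v y) ≤ 32 * B * (‖x + z‖ ^ 2 - ‖x‖ ^ 2)) ∧
      (∀ z : Euc d, ‖z‖ < 1 / 8 → v (x + z) - v x - (v (y + z) - v y) ≤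
        N * B * (‖x - y + z‖ ^ α + ‖x - y - z‖ ^ α - 2 * ‖x - y‖ ^ α)
          + 32 * B * (‖x + z‖ ^ 2 - ‖x‖ ^ 2)) := by
  have h16 : 0 < (16 : ℝ) ^ α := by positivity
  have hN0 : 0 < N := by linarith
  -- The Hölder penalty forces `x` and `y` together, and the quadratic penalty localizes `x`. The
  -- failing pair `(0, y₀)` makes the maximum positive.
  obtain ⟨Φ, hΦ⟩ : ∃ Φ : Euc d × Euc d → ℝ, ∀ x y, Φ (x, y) =
      v x - v y - N * B * ‖x - y‖ ^ α - 32 * B * ‖x‖ ^ 2 :=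
    ⟨fun p => v p.1 - v p.2 - N * B * ‖p.1 - p.2‖ ^ α - 32 * B * ‖p.1‖ ^ 2, fun _ _ => rfl⟩
  have hcont : Continuous Φ := by
    have e : Φ = fun p => v p.1 - v p.2 - N * B * ‖p.1 - p.2‖ ^ α - 32 * B * ‖p.1‖ ^ 2 :=
      funext fun p => hΦ p.1 p.2
    have h2 := Real.continuous_rpow_const hα.le
    have h3 : Continuous fun p : Euc d × Euc d => ‖p.1 - p.2‖ ^ α := h2.comp (by fun_prop)
    rw [e]
    fun_prop
  have hcomp : IsCompact (closedBall (0 : Euc d) (1 / 2) ×ˢ closedBall (0 : Euc d) (1 / 2)) :=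
    (isCompact_closedBall _ _).prod (isCompact_closedBall _ _)
  obtain ⟨⟨x, y⟩, hxy, hmax⟩ := hcomp.exists_isMaxOn
    ⟨(0, y₀), by simp, by simpa using hy₀⟩ hcont.continuousOn
  obtain ⟨hx, hy⟩ := hxy
  simp only [mem_closedBall_zero_iff] at hx hy
  have hM : ∀ x' y' : Euc d, ‖x'‖ ≤ 1 / 2 → ‖y'‖ ≤ 1 / 2 → Φ (x', y') ≤ Φ (x, y) :=
    fun x' y' h1 h2 => hmax (show (x', y') ∈ _ from ⟨by simpa using h1, by simpa using h2⟩)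
  have hpos : 0 < Φ (x, y) := by
    refine lt_of_lt_of_le ?_ (hM 0 y₀ (by simp) hy₀)
    rw [hΦ, zero_sub, norm_neg, norm_zero]
    linarith
  clear hmax hcomp hcont
  have hvx := abs_le.1 (hvB x (by simp; linarith))
  have hvy := abs_le.1 (hvB y (by simp; linarith))
  simp only [hΦ] at hpos hM
  have hA0 : 0 ≤ N * B * ‖x - y‖ ^ α := by positivity
  have hX0 : 0 ≤ 32 * B * ‖x‖ ^ 2 := by positivity
  -- At a positive maximum both penalties are below `v x - v y ≤ 2 * B`; `32` is chosen so that
  -- `|x|^2 < 1/16`, and `N ≥ 2 * 16^α` so that `|x - y| < 1/16`.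
  have hx4 : ‖x‖ ≤ 1 / 4 := by
    have h1 : B * (32 * ‖x‖ ^ 2) < B * 2 := by linarith
    have h2 := lt_of_mul_lt_mul_left h1 hB.le
    refine abs_le_of_sq_le_sq' (a := ‖x‖) (b := 1 / 4) ?_ (by norm_num) |>.2
    linarith
  have ha16 : ‖x - y‖ < 1 / 16 := by
    by_contra! h
    have h1 : B * (N * ‖x - y‖ ^ α) < B * 2 := by linarith
    have h2 := lt_of_mul_lt_mul_left h1 hB.le
    have h3 : (1 / 16 : ℝ) ^ α ≤ ‖x - y‖ ^ α := Real.rpow_le_rpow (by norm_num) h hα.le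
    have h4 : (16 : ℝ) ^ α * (1 / 16 : ℝ) ^ α = 1 := by
      rw [← Real.mul_rpow (by norm_num) (by norm_num)]; norm_num
    have h5 : 2 * 16 ^ α * (1 / 16 : ℝ) ^ α ≤ N * ‖x - y‖ ^ α := by gcongr
    linarith
  have nx : ∀ z : Euc d, ‖z‖ < 1 / 8 → ‖x + z‖ ≤ 1 / 2 := fun z hz => by
    have := norm_add_le x z
    linarith
  have hy4 : ‖y‖ ≤ 5 / 16 := by
    have h : y = x - (x - y) := by abel
    rw [h]
    have := norm_sub_le x (x - y)
    linarith
  have ny : ∀ z : Euc d, ‖z‖ < 1 / 8 → ‖y + z‖ ≤ 1 / 2 := fun z hz => by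
    have := norm_add_le y z
    linarith
  refine ⟨x, y, hx4, hy4, ?_, ha16, by linarith, fun z hz => ?_, fun z hz => ?_⟩
  · rintro rfl
    linarith
  · have h := hM (x + z) (y + z) (nx z hz) (ny z hz)
    rw [add_sub_add_right_eq_sub] at h
    linarith
  -- Moving one point at a time and adding the two comparisons produces the second difference of
  -- `|·|^α` at `x - y`.
  · have h1 := hM (x + z) y (nx z hz) hy
    have h2 := hM x (y + z) hx (ny z hz)
    rw [add_sub_right_comm] at h1
    rw [← sub_sub] at h2
    linarith

/-- Bounds on the difference of second differences at a maximum of the doubled functional. -/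
lemma sd_sub_sd_bounds {v : Euc d → ℝ} {C B M α ε c : ℝ} (hv : BD 2 C v) (hB : 0 < B)
    (hM : 0 ≤ M) (hα : 0 < α) (hε : 0 < ε) (hε4 : ε ≤ 1 / 4)
    (hgap : (3 / 2 + ε) ^ α + (1 / 2 + ε) ^ α ≤ 2 - c)
    (hvB : ∀ x ∈ closedBall (0 : Euc d) 1, |v x| ≤ B) {x y : Euc d} (hx : ‖x‖ ≤ 1 / 4)
    (hy : ‖y‖ ≤ 5 / 16) (ha : ‖x - y‖ < 1 / 16)
    (inc : ∀ z : Euc d, ‖z‖ < 1 / 8 →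
        v (x + z) - v x - (v (y + z) - v y) ≤ 32 * B * (‖x + z‖ ^ 2 - ‖x‖ ^ 2))
    (inc' : ∀ z : Euc d, ‖z‖ < 1 / 8 → v (x + z) - v x - (v (y + z) - v y) ≤
        M * (‖x - y + z‖ ^ α + ‖x - y - z‖ ^ α - 2 * ‖x - y‖ ^ α)
          + 32 * B * (‖x + z‖ ^ 2 - ‖x‖ ^ 2)) :
    (∀ z : Euc d, ‖z‖ < 1 / 8 → sd σ v z x - sd σ v z y ≤ 64 * B * wt σ z) ∧
    (∀ z : Euc d, 1 / 8 ≤ ‖z‖ →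
      sd σ v z x - sd σ v z y ≤ |v (x + z)| + |v (y + z)| + 2176 * B * wt σ z) ∧
    (∀ z ∈ ball ((1 / 2 : ℝ) • (x - y)) (ε * ‖x - y‖), ‖z‖ ≤ ‖x - y‖ ∧
      sd σ v z x - sd σ v z y ≤ 64 * B * wt σ z - c * (M * ‖x - y‖ ^ α)) := by
  have grad := fderiv_sub_of_max hv inc
  -- By the first order condition, the gradients of `v` enter only through the gradient of the
  -- quadratic penalty.
  have hE : ∀ z, sd σ v z x - sd σ v z y = v (x + z) - v x - (v (y + z) - v y) -
      chi d σ z * (2 * (32 * B) * inner ℝ x z) := by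
    intro z
    rw [← grad z]
    simp only [sd, smul_eq_mul]
    ring
  have hin : ∀ z : Euc d, |2 * (32 * B) * inner ℝ x z| ≤ 32 * B * ‖z‖ := by
    intro z
    have h1 := abs_real_inner_le_norm x z
    rw [abs_mul, abs_of_pos (by positivity : 0 < 2 * (32 * B))]
    have h2 : |inner ℝ x z| ≤ 1 / 4 * ‖z‖ := h1.trans (by gcongr)
    have h3 : 2 * (32 * B) * |inner ℝ x z| ≤ 2 * (32 * B) * (1 / 4 * ‖z‖) := by gcongr
    have h4 : 0 ≤ B * ‖z‖ := by positivity
    linarith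
  have near : ∀ z : Euc d, ‖z‖ < 1 / 8 →
      32 * B * (‖x + z‖ ^ 2 - ‖x‖ ^ 2) - chi d σ z * (2 * (32 * B) * inner ℝ x z)
        ≤ 64 * B * wt σ z := by
    intro z hz
    have h1 := mul_le_mul_of_nonneg_left (wt_near (σ := σ) hz) (by positivity : 0 ≤ 32 * B)
    have h2 := abs_le.1 (hin z)
    have h3 := chi_le_one (σ := σ) z
    rw [norm_add_sq_real]
    have h4 : (1 - chi d σ z) * (2 * (32 * B) * inner ℝ x z) ≤
        (1 - chi d σ z) * (32 * B * ‖z‖) :=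
      mul_le_mul_of_nonneg_left h2.2 (by linarith)
    linarith
  refine ⟨fun z hz => ?_, fun z hz => ?_, fun z hz => ?_⟩
  · rw [hE]
    linarith [inc z hz, near z hz]
  -- Constant `2176 = 2 * 64 + 32 * 64`: the values `v x` and `v y`, then the gradient term.
  · have h1 := mul_le_mul_of_nonneg_left (wt_far (σ := σ) hz) hB.le
    have h2 := mul_le_mul_of_nonneg_left (wt_far_chi (σ := σ) hz) hB.le
    have h3 := abs_le.1 (hin z)
    have h4 := mul_le_mul_of_nonneg_left h3.1 (chi_nonneg (σ := σ) z)
    have h6 := le_abs_self (v (x + z))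
    have h7 := neg_abs_le (v (y + z))
    have hvx := abs_le.1 (hvB x (by simp; linarith))
    have hvy := abs_le.1 (hvB y (by simp; linarith))
    rw [hE]
    linarith
  · have han := norm_nonneg (x - y)
    rw [mem_ball, dist_eq_norm] at hz
    have e1 : ‖(1 / 2 : ℝ) • (x - y)‖ = 1 / 2 * ‖x - y‖ := by rw [norm_smul]; norm_num
    have e2 : ‖(3 / 2 : ℝ) • (x - y)‖ = 3 / 2 * ‖x - y‖ := by rw [norm_smul]; norm_num
    have n0 : ‖z‖ ≤ 1 / 2 * ‖x - y‖ + ε * ‖x - y‖ := by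
      calc ‖z‖ = ‖(1 / 2 : ℝ) • (x - y) + (z - (1 / 2 : ℝ) • (x - y))‖ := by rw [add_sub_cancel]
        _ ≤ _ := norm_add_le _ _
        _ ≤ _ := by rw [e1]; linarith
    have n1 : ‖x - y + z‖ ≤ (3 / 2 + ε) * ‖x - y‖ := by
      calc ‖x - y + z‖ = ‖(3 / 2 : ℝ) • (x - y) + (z - (1 / 2 : ℝ) • (x - y))‖ := by
            congr 1; module
        _ ≤ _ := norm_add_le _ _
        _ ≤ _ := by rw [e2]; linarith
    have n2 : ‖x - y - z‖ ≤ (1 / 2 + ε) * ‖x - y‖ := by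
      calc ‖x - y - z‖ = ‖(1 / 2 : ℝ) • (x - y) - (z - (1 / 2 : ℝ) • (x - y))‖ := by
            congr 1; module
        _ ≤ _ := norm_sub_le _ _
        _ ≤ _ := by rw [e1]; linarith
    have n3 : ‖z‖ ≤ ‖x - y‖ := by
      have : ε * ‖x - y‖ ≤ 1 / 4 * ‖x - y‖ := by gcongr
      linarith
    refine ⟨n3, ?_⟩
    have hz8 : ‖z‖ < 1 / 8 := by linarith
    have m1 : ‖x - y + z‖ ^ α ≤ (3 / 2 + ε) ^ α * ‖x - y‖ ^ α := by
      rw [← Real.mul_rpow (by positivity) han]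
      exact Real.rpow_le_rpow (norm_nonneg _) n1 hα.le
    have m2 : ‖x - y - z‖ ^ α ≤ (1 / 2 + ε) ^ α * ‖x - y‖ ^ α := by
      rw [← Real.mul_rpow (by positivity) han]
      exact Real.rpow_le_rpow (norm_nonneg _) n2 hα.le
    have m0 := mul_le_mul_of_nonneg_right hgap (by positivity : 0 ≤ ‖x - y‖ ^ α)
    have m3 : ‖x - y + z‖ ^ α + ‖x - y - z‖ ^ α - 2 * ‖x - y‖ ^ α ≤ -c * ‖x - y‖ ^ α := by
      linarith
    have m4 := mul_le_mul_of_nonneg_left m3 hM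
    rw [hE]
    linarith [inc' z hz8, near z hz8]

/-- Integration of the pointwise bounds against `K`. Upper ellipticity handles the positive
contributions, with the values of `v` far away absorbed in `tail`; the gain `q` on the small ball is
weighted by the lower bound of `K` there. -/
lemma LL_sub_LL_le (hd : 0 < d) (hσ : 0 < σ) (hσ2 : σ < 2) {ν Λ : ℝ} (hν : 0 < ν)
    (hΛ : 0 < Λ) {K : Euc d → ℝ} (hK : Ker d σ ν Λ K) {v : Euc d → ℝ} {C B q ρ : ℝ}
    (hv : BD 2 C v) (hB : 0 < B) (hq : 0 ≤ q) (hρ : 0 < ρ) {x y : Euc d} (hx : ‖x‖ ≤ 1 / 2)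
    (hy : ‖y‖ ≤ 1 / 2)
    (Enear : ∀ z : Euc d, ‖z‖ < 1 / 8 → sd σ v z x - sd σ v z y ≤ 64 * B * wt σ z)
    (Efar : ∀ z : Euc d, 1 / 8 ≤ ‖z‖ →
      sd σ v z x - sd σ v z y ≤ |v (x + z)| + |v (y + z)| + 2176 * B * wt σ z)
    (Eball : ∀ z ∈ ball ((1 / 2 : ℝ) • (x - y)) ρ, ‖z‖ ≤ ‖x - y‖ ∧
      sd σ v z x - sd σ v z y ≤ 64 * B * wt σ z - q) :
    LL σ K v x - LL σ K v y ≤ 2240 * B * Λ * (∫ y : Euc d, wt σ y * homKernel d σ y)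
      + 2 * (Λ * 13 ^ ((d : ℝ) + σ) * tail d σ v)
      - ρ ^ d * volume.real (ball (0 : Euc d) 1) * (ν * ‖x - y‖ ^ (-((d : ℝ) + σ)) * q) := by
  obtain ⟨D, hD⟩ : ∃ D : ℝ, D = 13 ^ ((d : ℝ) + σ) := ⟨_, rfl⟩
  obtain ⟨k, hk⟩ : ∃ k : ℝ, k = ν * ‖x - y‖ ^ (-((d : ℝ) + σ)) * q := ⟨_, rfl⟩
  obtain ⟨S, hS⟩ : ∃ S, S = ball ((1 / 2 : ℝ) • (x - y)) ρ := ⟨_, rfl⟩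
  have hSm : MeasurableSet S := hS ▸ measurableSet_ball
  have hD0 : 0 < D := by rw [hD]; positivity
  rw [← hS] at Eball
  rw [← hD, ← hk]
  have iK : Integrable (fun z => K z * (sd σ v z x - sd σ v z y)) := by
    have := (integrable_smul_sd hd hσ hσ2 hν.le hK hv x).sub
      (integrable_smul_sd hd hσ hσ2 hν.le hK hv y)
    refine this.congr (Eventually.of_forall fun z => ?_)
    simp only [Pi.sub_apply, smul_eq_mul]; ring
  have hLL : LL σ K v x - LL σ K v y = ∫ z, K z * (sd σ v z x - sd σ v z y) := by
    unfold LL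
    rw [← integral_sub (integrable_smul_sd hd hσ hσ2 hν.le hK hv x)
      (integrable_smul_sd hd hσ hσ2 hν.le hK hv y)]
    congr 1; ext z
    simp only [smul_eq_mul]; ring
  have it := integrable_mul_om hσ hv.continuous.aestronglyMeasurable hv.norm_le
  have i1 : Integrable (fun z => 2240 * B * Λ * (wt σ z * homKernel d σ z)) :=
    (integrable_wt hd hσ hσ2).const_mul _
  have i2 : ∀ x : Euc d, Integrable (fun z => Λ * D * (|v (x + z)| * om d σ (x + z))) :=
    fun x => (it.comp_add_left x).const_mul _
  have i3 : Integrable (S.indicator fun _ => k) := by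
    refine (integrable_indicator_iff hSm).2 (integrableOn_const ?_)
    rw [hS]; exact measure_ball_lt_top.ne
  have i5 : Integrable (fun z => Λ * D * (|v (x + z)| * om d σ (x + z)) +
    Λ * D * (|v (y + z)| * om d σ (y + z))) := (i2 x).add (i2 y)
  have i4 : Integrable (fun z => 2240 * B * Λ * (wt σ z * homKernel d σ z)
      + (Λ * D * (|v (x + z)| * om d σ (x + z)) + Λ * D * (|v (y + z)| * om d σ (y + z)))) :=
    i1.add i5
  have hle : ∫ z, K z * (sd σ v z x - sd σ v z y) ≤
      ∫ z, (2240 * B * Λ * (wt σ z * homKernel d σ z)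
      + (Λ * D * (|v (x + z)| * om d σ (x + z)) + Λ * D * (|v (y + z)| * om d σ (y + z)))
      - S.indicator (fun _ => k) z) := by
    refine integral_mono_ae iK (i4.sub i3) ?_
    filter_upwards [ae_ne_zero hd] with z hz
    have k0 := hK.nonneg hν.le hz
    have k1 := hK.upper z hz
    have k2 := hK.lower z hz
    have w0 := wt_nonneg (σ := σ) z
    have h0 := homKernel_nonneg (σ := σ) z
    have t : ∀ x : Euc d, 0 ≤ Λ * D * (|v (x + z)| * om d σ (x + z)) := fun x =>
      mul_nonneg (by positivity) (mul_nonneg (abs_nonneg _) (om_nonneg _))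
    have tx := t x
    have ty := t y
    have wle : ∀ b : ℝ, b ≤ 2240 →
        K z * (b * B * wt σ z) ≤ 2240 * B * Λ * (wt σ z * homKernel d σ z) := by
      intro b hb
      calc K z * (b * B * wt σ z) ≤ K z * (2240 * B * wt σ z) := by gcongr
        _ ≤ (Λ * homKernel d σ z) * (2240 * B * wt σ z) := by gcongr
        _ = _ := by ring
    have w1 := wle 64 (by norm_num)
    have w2 := wle 2176 (by norm_num)
    by_cases hzS : z ∈ S
    · obtain ⟨n1, n2⟩ := Eball z hzS
      rw [indicator_of_mem hzS]
      have h1 := mul_le_mul_of_nonneg_left n2 k0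
      have h2 : k ≤ K z * q := by
        rw [hk]
        refine mul_le_mul_of_nonneg_right ?_ hq
        refine le_trans ?_ k2
        exact mul_le_mul_of_nonneg_left (homKernel_anti hσ hz n1) hν.le
      linarith
    · rw [indicator_of_notMem hzS, sub_zero]
      rcases lt_or_ge ‖z‖ (1 / 8) with hz8 | hz8
      · have h1 := mul_le_mul_of_nonneg_left (Enear z hz8) k0
        linarith
      · have h1 := mul_le_mul_of_nonneg_left (Efar z hz8) k0
        have g1 : ∀ x : Euc d, ‖x‖ ≤ 1 / 2 →
            K z * |v (x + z)| ≤ Λ * D * (|v (x + z)| * om d σ (x + z)) := by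
          intro x hx
          have := homKernel_le_om hσ hx hz8
          rw [← hD] at this
          calc K z * |v (x + z)| ≤ (Λ * (D * om d σ (x + z))) * |v (x + z)| := by
                gcongr
                exact k1.trans (by gcongr)
            _ = _ := by ring
        linarith [g1 x hx, g1 y hy]
  rw [hLL]
  refine hle.trans (le_of_eq ?_)
  rw [integral_sub i4 i3, integral_add i1 i5, integral_add (i2 x) (i2 y), integral_const_mul,
    integral_const_mul, integral_const_mul,
    integral_add_left_eq_self (fun z => |v z| * om d σ z) x,
    integral_add_left_eq_self (fun z => |v z| * om d σ z) y,
    integral_indicator hSm, setIntegral_const, smul_eq_mul]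
  have hvol : volume.real S = ρ ^ d * volume.real (ball (0 : Euc d) 1) := by
    rw [hS, measureReal_def, Measure.addHaar_ball_of_pos _ _ hρ, ENNReal.toReal_mul,
      ENNReal.toReal_ofReal (by positivity), measureReal_def]
    simp
  rw [hvol, tail]
  ring

lemma volume_real_ball_pos {r : ℝ} (hr : 0 < r) (x : Euc d) : 0 < volume.real (ball x r) :=
  ENNReal.toReal_pos (measure_ball_pos _ _ hr).ne' measure_ball_lt_top.ne

/-- One-sided interior Hölder estimate with a bound `B` for the solution, its tail, and the right
hand side, obtained by doubling the variables. -/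
lemma exists_holder_one_sided (hd : 0 < d) (hσ : 0 < σ) (hσ2 : σ < 2) {ν Λ α : ℝ} (hν : 0 < ν)
    (hΛ : 0 < Λ) (hα : 0 < α) (hα1 : α < 1) (hασ : α < σ) :
    ∃ N : ℝ, 0 < N ∧ ∀ K : Euc d → ℝ, Ker d σ ν Λ K → ∀ lam B C : ℝ, 0 ≤ lam → 0 < B →
      ∀ v : Euc d → ℝ, BD 2 C v → (∀ x ∈ closedBall (0 : Euc d) 1, |v x| ≤ B) → tail d σ v ≤ B →
      (∀ x ∈ ball (0 : Euc d) 1, |LL σ K v x - lam * v x| ≤ B) →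
      ∀ y : Euc d, ‖y‖ ≤ 1 / 2 → v 0 - v y ≤ N * B * ‖y‖ ^ α := by
  obtain ⟨ε, c, hε, hε4, hc, hgap⟩ := exists_rpow_concave_gap hα hα1
  obtain ⟨W, hW⟩ : ∃ W, W = ∫ y : Euc d, wt σ y * homKernel d σ y := ⟨_, rfl⟩
  obtain ⟨V, hV⟩ : ∃ V, V = volume.real (ball (0 : Euc d) 1) := ⟨_, rfl⟩
  obtain ⟨D, hD⟩ : ∃ D : ℝ, D = 13 ^ ((d : ℝ) + σ) := ⟨_, rfl⟩
  have hW0 : 0 ≤ W :=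
    hW ▸ integral_nonneg fun y => mul_nonneg (wt_nonneg y) (homKernel_nonneg y)
  have hV0 : 0 < V := hV ▸ volume_real_ball_pos one_pos 0
  have hD0 : 0 < D := by rw [hD]; positivity
  obtain ⟨P, hP⟩ : ∃ P, P = ν * c * ε ^ d * V := ⟨_, rfl⟩
  have hP0 : 0 < P := by rw [hP]; positivity
  -- The two right hand sides account for `2`; the extra `1` makes the final inequality strict.
  obtain ⟨Q, hQ⟩ : ∃ Q, Q = 3 + Λ * 2240 * W + 2 * (Λ * D) := ⟨_, rfl⟩
  have hQ0 : 0 < Q := by rw [hQ]; positivity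
  obtain ⟨N, hN⟩ : ∃ N, N = Q / P + 2 * (16 : ℝ) ^ α := ⟨_, rfl⟩
  have hN0 : 0 < N := by rw [hN]; positivity
  refine ⟨N, hN0, ?_⟩
  intro K hK lam B C hlam hB v hv hvB hvT hvF y₀ hy₀
  by_contra! hcon
  obtain ⟨x, y, hx, hy, hxy, ha, hvxy, inc, inc'⟩ := exists_max_of_not_holder hv.continuous hα hB
    (by rw [hN]; have : 0 < Q / P := by positivity
        linarith) hvB hy₀ hcon
  have han : 0 < ‖x - y‖ := norm_pos_iff.2 (sub_ne_zero.2 hxy)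
  obtain ⟨E1, E2, E3⟩ := sd_sub_sd_bounds (σ := σ) hv hB (by positivity : 0 ≤ N * B) hα hε hε4
    hgap hvB hx hy ha inc inc'
  have hle := LL_sub_LL_le hd hσ hσ2 hν hΛ hK hv hB (by positivity) (by positivity)
    (hx.trans (by norm_num)) (hy.trans (by norm_num)) E1 E2 E3
  rw [← hW, ← hV, ← hD] at hle
  -- The powers of `|x - y|` combine to `α - σ < 0`, so `|x - y| < 1` only helps. This is where `α <
  -- σ` is used.
  have hfin : P * N * B ≤ (ε * ‖x - y‖) ^ d * V *
      (ν * ‖x - y‖ ^ (-((d : ℝ) + σ)) * (c * (N * B * ‖x - y‖ ^ α))) := by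
    have e2 : ‖x - y‖ ^ d * ‖x - y‖ ^ (-((d : ℝ) + σ)) * ‖x - y‖ ^ α = ‖x - y‖ ^ (α - σ) := by
      rw [← Real.rpow_natCast, ← Real.rpow_add han, ← Real.rpow_add han]
      congr 1; ring
    have e : (ε * ‖x - y‖) ^ d * V *
        (ν * ‖x - y‖ ^ (-((d : ℝ) + σ)) * (c * (N * B * ‖x - y‖ ^ α))) =
        P * N * B * (‖x - y‖ ^ (α - σ)) := by
      rw [← e2, hP, mul_pow]; ring
    rw [e]
    have : 1 ≤ ‖x - y‖ ^ (α - σ) :=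
      Real.one_le_rpow_of_pos_of_le_one_of_nonpos han (by linarith) (by linarith)
    exact le_mul_of_one_le_right (by positivity) this
  have hF1 := abs_le.1 (hvF x (by simp; linarith))
  have hF2 := abs_le.1 (hvF y (by simp; linarith))
  -- The zeroth order term has a favourable sign at the maximum, so `N` does not depend on `lam`.
  have hdiff : 0 ≤ lam * (v x - v y) := mul_nonneg hlam (by linarith)
  have hPN : Q ≤ P * N := by
    rw [hN, mul_add, mul_div_cancel₀ _ hP0.ne']
    have : 0 ≤ P * (2 * (16 : ℝ) ^ α) := by positivity
    linarith
  have hPNB := mul_le_mul_of_nonneg_right hPN hB.le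
  have hT : Λ * D * tail d σ v ≤ Λ * D * B := by gcongr
  rw [hQ] at hPNB
  linarith

end holder

end Nonlocal

end

noncomputable section

namespace Nonlocal

/-! ### Cancellation on annuli, scaling and change of truncation. -/

section kernel

variable {d : ℕ} {σ ν Λ : ℝ} {K : Euc d → ℝ}

lemma nontrivial_euc (hd : 0 < d) : Nontrivial (Euc d) := by
  have : Nonempty (Fin d) := ⟨⟨0, hd⟩⟩
  infer_instance

lemma integral_sphere_eq_zero {r : ℝ} (hr : 0 < r)
    (h : ∫ y, K y • y ∂(surfaceMeasure d r) = 0) :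
    ∫ θ : sphere (0 : Euc d) 1, K (r • (θ : Euc d)) • (r • (θ : Euc d))
      ∂(volume : Measure (Euc d)).toSphere = 0 := by
  have hemb : MeasurableEmbedding (fun θ : sphere (0 : Euc d) 1 => r • (θ : Euc d)) :=
    (measurableEmbedding_const_smul₀ hr.ne').comp
      (MeasurableEmbedding.subtype_coe isClosed_sphere.measurableSet)
  rw [surfaceMeasure, integral_smul_measure, hemb.integral_map] at h
  have h2 : (ENNReal.ofReal (r ^ (d - 1))).toReal ≠ 0 := by
    rw [ENNReal.toReal_ofReal (by positivity)]; positivity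
  exact (smul_eq_zero.1 h).resolve_left h2

/-- Polar coordinates and Fubini, integrating over the sphere first. -/
lemma integral_eq_zero_of_sphere {g : Euc d → Euc d} (hd : 0 < d) (hg : Integrable g)
    (h : ∀ r : ℝ, 0 < r → ∫ θ : sphere (0 : Euc d) 1, g (r • (θ : Euc d))
      ∂(volume : Measure (Euc d)).toSphere = 0) : ∫ y, g y = 0 := by
  have := nontrivial_euc hd
  let μ : Measure (Euc d) := volume
  have hmp := μ.measurePreserving_homeomorphUnitSphereProd
  have hme := (homeomorphUnitSphereProd (Euc d)).measurableEmbedding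
  have hval : ∀ p : sphere (0 : Euc d) 1 × Ioi (0 : ℝ),
      (((homeomorphUnitSphereProd (Euc d)).symm p : ({0}ᶜ : Set (Euc d))) : Euc d) =
        (p.2 : ℝ) • (p.1 : Euc d) := fun p => rfl
  let G : sphere (0 : Euc d) 1 × Ioi (0 : ℝ) → Euc d := fun p => g ((p.2 : ℝ) • (p.1 : Euc d))
  have hG : ∀ x : ({0}ᶜ : Set (Euc d)), G (homeomorphUnitSphereProd (Euc d) x) = g x := by
    intro x
    change g _ = _
    rw [← hval, Homeomorph.symm_apply_apply]
  have e1 : ∫ y, g y = ∫ x : ({(0)}ᶜ : Set (Euc d)), g x ∂(μ.comap (↑)) := by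
    rw [integral_subtype_comap (measurableSet_singleton _).compl g, restrict_compl_singleton]
  have e2 : ∫ x : ({(0)}ᶜ : Set (Euc d)), g x ∂(μ.comap (↑)) =
      ∫ p, G p ∂(μ.toSphere.prod (.volumeIoiPow (Module.finrank ℝ (Euc d) - 1))) := by
    rw [← hmp.integral_comp hme]
    simp only [hG]
  have hGi : Integrable G (μ.toSphere.prod (.volumeIoiPow (Module.finrank ℝ (Euc d) - 1))) := by
    rw [← hmp.integrable_comp_emb hme]
    have : G ∘ (homeomorphUnitSphereProd (Euc d)) = fun x : ({0}ᶜ : Set (Euc d)) => g x :=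
      funext hG
    rw [this]
    have h3 := (integrableOn_iff_comap_subtypeVal (μ := μ) (f := g)
      (measurableSet_singleton (0 : Euc d)).compl).1 hg.integrableOn
    exact h3
  rw [e1, e2, integral_prod_symm _ hGi]
  refine integral_eq_zero_of_ae (Eventually.of_forall fun r => ?_)
  exact h r r.2

lemma integrable_kernel_annulus (hν : 0 ≤ ν) (hd : 0 < d) (hK : AEMeasurable K volume)
    (hΛ : 0 ≤ Λ) (hσ : 0 < σ) (lower : ∀ y, y ≠ 0 → ν * homKernel d σ y ≤ K y)
    (upper : ∀ y, y ≠ 0 → K y ≤ Λ * homKernel d σ y) {a b : ℝ} (ha : 0 < a) :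
    Integrable ((ball 0 b \ ball (0 : Euc d) a).indicator fun y => K y • y) := by
  have hm : MeasurableSet (ball 0 b \ ball (0 : Euc d) a) :=
    measurableSet_ball.diff measurableSet_ball
  rw [integrable_indicator_iff hm]
  refine Measure.integrableOn_of_bounded (M := Λ * a ^ (-((d : ℝ) + σ)) * b)
    (ne_top_of_le_ne_top measure_ball_lt_top.ne (measure_mono sdiff_subset))
    (hK.aestronglyMeasurable.smul aestronglyMeasurable_id) ?_
  filter_upwards [ae_restrict_mem hm, ae_restrict_of_ae (ae_ne_zero hd)] with y hy hy0
  have h1 : ‖y‖ < b := by simpa using hy.1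
  have h2 : a ≤ ‖y‖ := by simpa using hy.2
  rw [norm_smul, Real.norm_eq_abs,
    abs_of_nonneg ((mul_nonneg hν (homKernel_nonneg y)).trans (lower y hy0))]
  have h3 : homKernel d σ y ≤ a ^ (-((d : ℝ) + σ)) := by
    unfold homKernel
    refine Real.rpow_le_rpow_of_nonpos ha h2 ?_
    have : (0 : ℝ) ≤ d := by positivity
    linarith
  refine mul_le_mul ((upper y hy0).trans (by gcongr)) h1.le (norm_nonneg _) (by positivity)

lemma IsKernel.ker (hd : 0 < d) (hσ : 0 < σ) (hσ2 : σ < 2) (hν : 0 < ν) (hνΛ : ν ≤ Λ)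
    (h : IsKernel d σ ν Λ K) : Ker d σ ((2 - σ) * ν) ((2 - σ) * Λ) K := by
  have h2 : 0 ≤ 2 - σ := by linarith
  have hdiv : ∀ (y : Euc d) (a : ℝ), (2 - σ) * (a / ‖y‖ ^ ((d : ℝ) + σ)) =
      (2 - σ) * a * homKernel d σ y := by
    intro y a
    rw [homKernel, Real.rpow_neg (norm_nonneg _)]; ring
  have lower : ∀ y, y ≠ 0 → (2 - σ) * ν * homKernel d σ y ≤ K y := fun y hy => by
    rw [← hdiv]; exact h.lower y hy
  have upper : ∀ y, y ≠ 0 → K y ≤ (2 - σ) * Λ * homKernel d σ y := fun y hy => by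
    rw [← hdiv]; exact h.upper y hy
  refine ⟨h.aemeasurable, lower, upper, ?_⟩
  intro hs a b ha hab
  have hm : MeasurableSet (ball 0 b \ ball (0 : Euc d) a) :=
    measurableSet_ball.diff measurableSet_ball
  rw [← integral_indicator hm]
  refine integral_eq_zero_of_sphere hd
    (integrable_kernel_annulus (by positivity) hd h.aemeasurable
      (mul_nonneg h2 (hν.le.trans hνΛ)) hσ lower upper ha) fun r hr => ?_
  have hnorm : ∀ θ : sphere (0 : Euc d) 1, ‖r • (θ : Euc d)‖ = r := by
    intro θ
    rw [norm_smul, norm_eq_of_mem_sphere, mul_one, Real.norm_eq_abs, abs_of_pos hr]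
  have key := integral_sphere_eq_zero hr (h.cancel hs r hr)
  by_cases hr2 : r < b ∧ a ≤ r
  · refine Eq.trans ?_ key
    congr 1; ext1 θ
    refine indicator_of_mem ?_ _
    simp [hnorm, hr2]
  · refine integral_eq_zero_of_ae (Eventually.of_forall fun θ => ?_)
    refine indicator_of_notMem ?_ _
    simpa [hnorm] using hr2

lemma homKernel_smul {ρ : ℝ} (hρ : 0 < ρ) (y : Euc d) :
    homKernel d σ (ρ • y) = ρ ^ (-((d : ℝ) + σ)) * homKernel d σ y := by
  unfold homKernel
  rw [norm_smul, Real.norm_eq_abs, abs_of_pos hρ, Real.mul_rpow hρ.le (norm_nonneg _)]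

/-- The factor is dictated by the homogeneity of the bounds; since the class of kernels is
preserved, estimates on the unit ball transfer to every ball. -/
lemma Ker.scale (hK : Ker d σ ν Λ K) {ρ : ℝ} (hρ : 0 < ρ) :
    Ker d σ ν Λ (fun y => ρ ^ ((d : ℝ) + σ) * K (ρ • y)) := by
  have hp : 0 < ρ ^ ((d : ℝ) + σ) := by positivity
  have hone : ρ ^ ((d : ℝ) + σ) * ρ ^ (-((d : ℝ) + σ)) = 1 := by
    rw [← Real.rpow_add hρ, add_neg_cancel, Real.rpow_zero]
  have hh : ∀ (c : ℝ) (y : Euc d), c * homKernel d σ y =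
      ρ ^ ((d : ℝ) + σ) * (c * homKernel d σ (ρ • y)) := by
    intro c y
    rw [homKernel_smul hρ]
    linear_combination (-c * homKernel d σ y) * hone
  have hne : ∀ y : Euc d, y ≠ 0 → ρ • y ≠ 0 := fun y hy => smul_ne_zero hρ.ne' hy
  refine ⟨?_, fun y hy => ?_, fun y hy => ?_, fun hs a b ha hab => ?_⟩
  · have hq : Measure.QuasiMeasurePreserving (fun y : Euc d => ρ • y) volume volume := by
      refine ⟨measurable_const_smul ρ, ?_⟩
      rw [Measure.map_addHaar_smul _ hρ.ne']
      exact Measure.smul_absolutelyContinuous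
    exact (hK.aem.comp_quasiMeasurePreserving hq).const_mul _
  · rw [hh]; exact mul_le_mul_of_nonneg_left (hK.lower _ (hne y hy)) hp.le
  · rw [hh Λ]; exact mul_le_mul_of_nonneg_left (hK.upper _ (hne y hy)) hp.le
  · have hc := hK.cancel hs (ρ * a) (ρ * b) (by positivity) (by gcongr)
    have hm : ∀ a b : ℝ, MeasurableSet (ball 0 b \ ball (0 : Euc d) a) := fun a b =>
      measurableSet_ball.diff measurableSet_ball
    rw [← integral_indicator (hm _ _)] at hc ⊢
    have e : (fun y => (ball 0 b \ ball (0 : Euc d) a).indicator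
        (fun y => (ρ ^ ((d : ℝ) + σ) * K (ρ • y)) • y) y) =
        fun y => (ρ ^ ((d : ℝ) + σ) * ρ⁻¹) •
          (ball 0 (ρ * b) \ ball (0 : Euc d) (ρ * a)).indicator (fun z => K z • z) (ρ • y) := by
      ext1 y
      have hiff : y ∈ ball 0 b \ ball (0 : Euc d) a ↔
          ρ • y ∈ ball 0 (ρ * b) \ ball (0 : Euc d) (ρ * a) := by
        simp [norm_smul, abs_of_pos hρ, hρ]
      by_cases hy : y ∈ ball 0 b \ ball (0 : Euc d) a
      · rw [indicator_of_mem hy, indicator_of_mem (hiff.1 hy), smul_smul, smul_smul]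
        congr 1
        field_simp
      · rw [indicator_of_notMem hy, indicator_of_notMem (fun h => hy (hiff.2 h)), smul_zero]
    rw [e, integral_smul, Measure.integral_comp_smul volume
      ((ball 0 (ρ * b) \ ball (0 : Euc d) (ρ * a)).indicator (fun z => K z • z)) ρ, hc]
    simp

lemma chi_smul_eq (hs : σ ≠ 1) (z w : Euc d) : chi d σ z = chi d σ w := by
  unfold chi; simp [hs]

/-- The truncation in the operator can be taken at any scale. -/
lemma LL_eq_truncated (hd : 0 < d) (hσ : 0 < σ) (hσ2 : σ < 2) (hν : 0 ≤ ν) (hΛ : 0 ≤ Λ)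
    (hK : Ker d σ ν Λ K) {v : Euc d → ℝ} {C : ℝ} (hv : BD 2 C v) {ρ : ℝ} (hρ : 0 < ρ)
    (x : Euc d) :
    ∫ z, K z * (v (x + z) - v x - chi d σ (ρ⁻¹ • z) * fderiv ℝ v x z) = LL σ K v x := by
  by_cases hs : σ = 1
  · have hm : ∀ a b : ℝ, MeasurableSet (ball 0 b \ ball (0 : Euc d) a) := fun a b =>
      measurableSet_ball.diff measurableSet_ball
    have hann : ∀ a b : ℝ, 0 < a → a ≤ b →
        Integrable (fun z => fderiv ℝ v x
          ((ball 0 b \ ball (0 : Euc d) a).indicator (fun z => K z • z) z)) ∧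
        ∫ z, fderiv ℝ v x ((ball 0 b \ ball (0 : Euc d) a).indicator (fun z => K z • z) z) = 0 := by
      intro a b ha hab
      have hi := integrable_kernel_annulus hν hd hK.aem hΛ hσ hK.lower hK.upper (b := b) ha
      refine ⟨(fderiv ℝ v x).integrable_comp hi, ?_⟩
      rw [ContinuousLinearMap.integral_comp_comm _ hi, integral_indicator (hm _ _),
        hK.cancel hs a b ha hab, map_zero]
    have hiL := integrable_smul_sd hd hσ hσ2 hν hK hv x
    have hchi : ∀ z : Euc d, chi d σ (ρ⁻¹ • z) = if ‖z‖ < ρ then 1 else 0 := by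
      intro z
      simp only [chi, hs, lt_irrefl, if_true, if_false, indicator, mem_ball_zero_iff, norm_smul,
        norm_inv, Real.norm_eq_abs, abs_of_pos hρ]
      simp only [inv_mul_lt_iff₀ hρ, mul_one]
    have hchi1 : ∀ z : Euc d, chi d σ z = if ‖z‖ < 1 then 1 else 0 := by
      intro z
      simp only [chi, hs, lt_irrefl, if_true, if_false, indicator, mem_ball_zero_iff]
    -- The two truncations differ on the annulus between radii `ρ` and `1`, where the first moment
    -- of the kernel vanishes. For `σ ≠ 1` the truncation is constant.
    rcases le_total ρ 1 with h1 | h1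
    · obtain ⟨i, e⟩ := hann ρ 1 hρ h1
      rw [← add_zero (LL σ K v x), ← e, LL, ← integral_add hiL i]
      congr 1; ext z
      rw [sd, hchi, hchi1]
      by_cases a1 : ‖z‖ < ρ
      · simp [a1, a1.trans_le h1, indicator]
      · by_cases a2 : ‖z‖ < 1
        · simp [a1, a2, indicator]; ring
        · simp [a1, a2, indicator]
    · obtain ⟨i, e⟩ := hann 1 ρ one_pos h1
      rw [← sub_zero (LL σ K v x), ← e, LL, ← integral_sub hiL i]
      congr 1; ext z
      rw [sd, hchi, hchi1]
      by_cases a1 : ‖z‖ < 1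
      · simp [a1, a1.trans_le h1, indicator]
      · by_cases a2 : ‖z‖ < ρ
        · simp [a1, a2, indicator]; ring
        · simp [a1, a2, indicator]
  · unfold LL sd
    congr 1; ext z
    rw [chi_smul_eq hs (ρ⁻¹ • z) z]; rfl

lemma BD.comp_affine {F : Type*} [NormedAddCommGroup F] [NormedSpace ℝ F] {n : ℕ} {C : ℝ}
    {v : Euc d → F} (hv : BD n C v) (x₀ : Euc d) (ρ : ℝ) :
    ∃ C', BD n C' (fun x => v (x₀ + ρ • x)) := by
  induction n generalizing F C with
  | zero =>
    refine ⟨C, BD.zero_iff.2 ⟨?_, fun x => hv.norm_le _⟩⟩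
    have := hv.continuous
    fun_prop
  | succ n ih =>
    obtain ⟨C', h⟩ := ih hv.fderiv
    have hder : ∀ x, HasFDerivAt (fun x => v (x₀ + ρ • x)) (ρ • _root_.fderiv ℝ v (x₀ + ρ • x)) x := by
      intro x
      have h1 := (hv.differentiable (x₀ + ρ • x)).hasFDerivAt
      have h2 : HasFDerivAt (fun x : Euc d => x₀ + ρ • x) (ρ • ContinuousLinearMap.id ℝ (Euc d)) x :=
        ((hasFDerivAt_id x).const_smul ρ).const_add x₀
      refine (h1.comp x h2).congr_fderiv ?_
      ext z; simp
    have hf : _root_.fderiv ℝ (fun x => v (x₀ + ρ • x)) = ρ • fun x => _root_.fderiv ℝ v (x₀ + ρ • x) :=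
      funext fun x => (hder x).fderiv
    refine ⟨max C (|ρ| * C'), BD.of_fderiv (fun x => (hder x).differentiableAt)
      (fun x => (hv.norm_le _).trans (le_max_left _ _)) ?_⟩
    rw [hf]
    exact (h.const_smul ρ).mono (le_max_right _ _) le_rfl

/-- The substitution `z = ρ • y` rescales the truncation as well, which `LL_eq_truncated` undoes. -/
lemma LL_scale (hd : 0 < d) (hσ : 0 < σ) (hσ2 : σ < 2) (hν : 0 ≤ ν) (hΛ : 0 ≤ Λ)
    (hK : Ker d σ ν Λ K) {v : Euc d → ℝ} {C : ℝ} (hv : BD 2 C v) {ρ : ℝ} (hρ : 0 < ρ)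
    (x₀ x : Euc d) :
    LL σ (fun y => ρ ^ ((d : ℝ) + σ) * K (ρ • y)) (fun x => v (x₀ + ρ • x)) x =
      ρ ^ σ * LL σ K v (x₀ + ρ • x) := by
  have hder : fderiv ℝ (fun x => v (x₀ + ρ • x)) x = ρ • fderiv ℝ v (x₀ + ρ • x) := by
    have h1 := (hv.differentiable (n := 1) (x₀ + ρ • x)).hasFDerivAt
    have h2 : HasFDerivAt (fun x : Euc d => x₀ + ρ • x) (ρ • ContinuousLinearMap.id ℝ (Euc d)) x :=
      ((hasFDerivAt_id x).const_smul ρ).const_add x₀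
    refine ((h1.comp x h2).congr_fderiv ?_).fderiv
    ext z; simp
  rw [← LL_eq_truncated hd hσ hσ2 hν hΛ hK hv hρ]
  have e : LL σ (fun y => ρ ^ ((d : ℝ) + σ) * K (ρ • y)) (fun x => v (x₀ + ρ • x)) x =
      ∫ y, ρ ^ ((d : ℝ) + σ) * (fun z => K z * (v (x₀ + ρ • x + z) - v (x₀ + ρ • x) -
        chi d σ (ρ⁻¹ • z) * fderiv ℝ v (x₀ + ρ • x) z)) (ρ • y) := by
    unfold LL sd
    congr 1; ext y
    rw [hder]
    simp only [smul_eq_mul, smul_add, _root_.smul_apply, map_smul, inv_smul_smul₀ hρ.ne', add_assoc]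
    ring
  rw [e, integral_const_mul, Measure.integral_comp_smul volume (fun z => K z *
    (v (x₀ + ρ • x + z) - v (x₀ + ρ • x) - chi d σ (ρ⁻¹ • z) * fderiv ℝ v (x₀ + ρ • x) z)) ρ,
    smul_eq_mul, ← mul_assoc]
  congr 1
  rw [finrank_euclideanSpace, Fintype.card_fin, abs_of_pos (by positivity), Real.rpow_add hρ,
    Real.rpow_natCast]
  field_simp

end kernel

end Nonlocal

end

noncomputable section

namespace Nonlocal

/-! ### From bounded solutions to bounds by the tail. -/

section interior

variable {d : ℕ} {σ ν Λ : ℝ} {K : Euc d → ℝ}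

/-- Since `1 + |x₀ + ρ y| ≤ 2 (1 + |y|)`, the weights compare up to `2^(d+σ)`; the change of
variables costs `ρ^(-d)`. -/
lemma tail_comp_affine_le (hσ : 0 < σ) {v : Euc d → ℝ} {C : ℝ} (hv : Continuous v)
    (hC : ∀ x, |v x| ≤ C) {x₀ : Euc d} (hx₀ : ‖x₀‖ ≤ 1) {ρ : ℝ} (hρ : 0 < ρ) (hρ1 : ρ ≤ 1) :
    tail d σ (fun x => v (x₀ + ρ • x)) ≤ (ρ ^ d)⁻¹ * (2 ^ ((d : ℝ) + σ) * tail d σ v) := by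
  have hs : 0 ≤ (d : ℝ) + σ := by positivity
  have it := integrable_mul_om hσ hv.aestronglyMeasurable hC
  have hpt : ∀ y : Euc d, om d σ y ≤ 2 ^ ((d : ℝ) + σ) * om d σ (x₀ + ρ • y) := by
    intro y
    have h1 : 1 + ‖x₀ + ρ • y‖ ≤ 2 * (1 + ‖y‖) := by
      have h2 := norm_add_le x₀ (ρ • y)
      rw [norm_smul, Real.norm_eq_abs, abs_of_pos hρ] at h2
      have h3 : ρ * ‖y‖ ≤ 1 * ‖y‖ := by gcongr
      have := norm_nonneg y
      linarith
    unfold om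
    rw [Real.rpow_neg (by positivity), Real.rpow_neg (by positivity), ← div_eq_mul_inv,
      inv_eq_one_div, div_le_div_iff₀ (by positivity) (by positivity), one_mul,
      ← Real.mul_rpow (by norm_num) (by positivity)]
    exact Real.rpow_le_rpow (by positivity) h1 hs
  have hi : Integrable (fun y => 2 ^ ((d : ℝ) + σ) *
      (|v (x₀ + ρ • y)| * om d σ (x₀ + ρ • y))) := by
    refine Integrable.const_mul ?_ _
    exact (it.comp_add_left x₀).comp_smul hρ.ne'
  have hcv : Continuous fun x => v (x₀ + ρ • x) := by fun_prop
  calc tail d σ (fun x => v (x₀ + ρ • x))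
      ≤ ∫ y, 2 ^ ((d : ℝ) + σ) * (|v (x₀ + ρ • y)| * om d σ (x₀ + ρ • y)) := by
        refine integral_mono (integrable_mul_om hσ hcv.aestronglyMeasurable fun x => hC _) hi
          fun y => ?_
        have := mul_le_mul_of_nonneg_left (hpt y) (abs_nonneg (v (x₀ + ρ • y)))
        linarith
    _ = _ := by
        rw [integral_const_mul, Measure.integral_comp_smul volume
          (fun y => |v (x₀ + y)| * om d σ (x₀ + y)) ρ,
          integral_add_left_eq_self (fun y => |v y| * om d σ y) x₀, finrank_euclideanSpace,
          Fintype.card_fin, abs_of_pos (by positivity), smul_eq_mul, tail]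
        ring

lemma LL_neg (v : Euc d → ℝ) (x : Euc d) : LL σ K (-v) x = -LL σ K v x := by
  have := LL_smul (σ := σ) (K := K) (u := v) (-1) x
  simpa using this

lemma exists_holder_of_bounded (hd : 0 < d) (hσ : 0 < σ) (hσ2 : σ < 2) {α : ℝ} (hν : 0 < ν)
    (hΛ : 0 < Λ) (hα : 0 < α) (hα1 : α < 1) (hασ : α < σ) :
    ∃ N : ℝ, 0 < N ∧ ∀ K : Euc d → ℝ, Ker d σ ν Λ K → ∀ lam B C : ℝ, 0 ≤ lam → 0 < B →
      ∀ v : Euc d → ℝ, BD 2 C v → (∀ x ∈ closedBall (0 : Euc d) 1, |v x| ≤ B) → tail d σ v ≤ B →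
      (∀ x ∈ ball (0 : Euc d) 1, |LL σ K v x - lam * v x| ≤ B) →
      ∀ y : Euc d, ‖y‖ ≤ 1 / 2 → |v y - v 0| ≤ N * B * ‖y‖ ^ α := by
  obtain ⟨N, hN, h⟩ := exists_holder_one_sided hd hσ hσ2 hν hΛ hα hα1 hασ
  refine ⟨N, hN, fun K hK lam B C hlam hB v hv hvB hvT hvF y hy => abs_le.2 ⟨?_, ?_⟩⟩
  · linarith [h K hK lam B C hlam hB v hv hvB hvT hvF y hy]
  · have hv' : BD 2 C (-v) := by simpa using hv.const_smul (-1)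
    have := h K hK lam B C hlam hB (-v) hv' (fun x hx => by simpa using hvB x hx)
      (by simpa [tail] using hvT) (fun x hx => by
        rw [LL_neg, Pi.neg_apply, ← abs_neg]
        refine le_trans (le_of_eq ?_) (hvF x hx)
        congr 1; ring) y hy
    simp only [Pi.neg_apply] at this
    linarith

/-- Compare `v 0` with the mean of `|v|` over the small ball, where the tail weight is bounded
below. -/
lemma abs_le_of_osc_le (hσ : 0 < σ) {v : Euc d → ℝ} {C : ℝ} (hv : Continuous v)
    (hC : ∀ x, |v x| ≤ C) {ε δ : ℝ} (hε : 0 < ε) (hε1 : ε ≤ 1)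
    (h : ∀ y : Euc d, ‖y‖ ≤ ε → |v y - v 0| ≤ δ) :
    |v 0| ≤ 2 ^ ((d : ℝ) + σ) * (volume.real (ball (0 : Euc d) ε))⁻¹ * tail d σ v + δ := by
  have hV := volume_real_ball_pos hε (0 : Euc d)
  have it := integrable_mul_om hσ hv.aestronglyMeasurable hC
  have hlow : ∀ y ∈ ball (0 : Euc d) ε, |v 0| - δ ≤ 2 ^ ((d : ℝ) + σ) * (|v y| * om d σ y) := by
    intro y hy
    rw [mem_ball_zero_iff] at hy
    have h1 : 1 ≤ 2 ^ ((d : ℝ) + σ) * om d σ y := by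
      unfold om
      rw [Real.rpow_neg (by positivity), ← div_eq_mul_inv, one_le_div (by positivity)]
      exact Real.rpow_le_rpow (by positivity) (by linarith) (by positivity)
    have h2 := h y hy.le
    have h3 := abs_sub_abs_le_abs_sub (v 0) (v y)
    rw [abs_sub_comm] at h3
    have h4 := mul_le_mul_of_nonneg_left h1 (abs_nonneg (v y))
    linarith
  have h1 : (|v 0| - δ) * volume.real (ball (0 : Euc d) ε) ≤
      2 ^ ((d : ℝ) + σ) * tail d σ v := by
    calc (|v 0| - δ) * volume.real (ball (0 : Euc d) ε)
        = ∫ y in ball (0 : Euc d) ε, (|v 0| - δ) := by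
          rw [setIntegral_const, smul_eq_mul, mul_comm]
      _ ≤ ∫ y in ball (0 : Euc d) ε, 2 ^ ((d : ℝ) + σ) * (|v y| * om d σ y) :=
          setIntegral_mono_on (integrableOn_const measure_ball_lt_top.ne)
            (it.const_mul _).integrableOn measurableSet_ball hlow
      _ ≤ ∫ y, 2 ^ ((d : ℝ) + σ) * (|v y| * om d σ y) :=
          setIntegral_le_integral (it.const_mul _) (Eventually.of_forall fun y =>
            mul_nonneg (by positivity) (mul_nonneg (abs_nonneg _) (om_nonneg y)))
      _ = _ := by rw [integral_const_mul, tail]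
  rw [← le_div_iff₀ hV] at h1
  rw [div_eq_mul_inv] at h1
  linarith

/-- Interior bound of a solution by its tail and the right hand side. -/
lemma exists_sup_bound (hd : 0 < d) (hσ : 0 < σ) (hσ2 : σ < 2) (hν : 0 < ν) (hΛ : 0 < Λ) :
    ∃ N : ℝ, 0 < N ∧ ∀ K : Euc d → ℝ, Ker d σ ν Λ K → ∀ lam F₀ C : ℝ, 0 ≤ lam → 0 ≤ F₀ →
      ∀ v : Euc d → ℝ, BD 2 C v → (∀ x ∈ ball (0 : Euc d) 1, |LL σ K v x - lam * v x| ≤ F₀) →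
      ∀ x : Euc d, ‖x‖ ≤ 1 / 2 → |v x| ≤ N * (tail d σ v + F₀) := by
  obtain ⟨α, hα, hα'⟩ : ∃ α : ℝ, 0 < α ∧ α < min 1 σ := exists_between (lt_min one_pos hσ)
  obtain ⟨N₀, hN₀, H⟩ := exists_holder_of_bounded hd hσ hσ2 hν hΛ hα
    (hα'.trans_le (min_le_left _ _)) (hα'.trans_le (min_le_right _ _))
  obtain ⟨D, hD⟩ : ∃ D : ℝ, D = 2 ^ ((d : ℝ) + σ) := ⟨_, rfl⟩
  have hD0 : 0 < D := by rw [hD]; positivity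
  -- This smallness lets the oscillation term be absorbed in the left hand side below.
  obtain ⟨ε, hε, hε2, hεN⟩ : ∃ ε : ℝ, 0 < ε ∧ ε ≤ 1 / 2 ∧ 2 ^ d * (N₀ * ε ^ α) ≤ 1 / 2 := by
    have hc : ContinuousAt (fun ε : ℝ => 2 ^ d * (N₀ * ε ^ α)) 0 := by
      have := Real.continuous_rpow_const hα.le
      exact (continuous_const.mul (continuous_const.mul this)).continuousAt
    have hev := hc.eventually (eventually_lt_nhds (b := 1 / 2)
      (by simp only [Real.zero_rpow hα.ne']; norm_num))
    obtain ⟨δ, hδ, h⟩ := Metric.eventually_nhds_iff.1 hev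
    refine ⟨min (δ / 2) (1 / 2), by positivity, min_le_right _ _, (h ?_).le⟩
    rw [Real.dist_eq, sub_zero, abs_of_pos (by positivity)]
    exact (min_le_left _ _).trans_lt (by linarith)
  obtain ⟨V, hV⟩ : ∃ V : ℝ, V = (volume.real (ball (0 : Euc d) ε))⁻¹ := ⟨_, rfl⟩
  have hV0 : 0 < V := by rw [hV]; exact inv_pos.2 (volume_real_ball_pos hε 0)
  refine ⟨2 ^ d * (2 ^ (d + 1) * (D * V * D) + D + 1), by positivity, ?_⟩
  intro K hK lam F₀ C hlam hF₀ v hv hvF x hx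
  obtain ⟨T, hT⟩ : ∃ T, T = tail d σ v := ⟨_, rfl⟩
  have hT0 : 0 ≤ T := hT ▸ tail_nonneg v
  rw [← hT]
  -- The exponent `d` of the weight matches the loss `ρ^(-d)` in the tail under rescaling.
  have hcont : Continuous fun x : Euc d => (1 - ‖x‖) ^ d * |v x| := by
    have := hv.continuous
    fun_prop
  obtain ⟨x₀, hx₀, hmax⟩ := (isCompact_closedBall (0 : Euc d) 1).exists_isMaxOn
    ⟨0, by simp⟩ hcont.continuousOn
  rw [mem_closedBall_zero_iff] at hx₀
  obtain ⟨Q, hQ⟩ : ∃ Q, Q = (1 - ‖x₀‖) ^ d * |v x₀| := ⟨_, rfl⟩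
  have hQmax : ∀ x : Euc d, ‖x‖ ≤ 1 → (1 - ‖x‖) ^ d * |v x| ≤ Q := fun x hx => by
    rw [hQ]; exact hmax (by simpa using hx)
  have hsuff : Q ≤ (2 ^ (d + 1) * (D * V * D) + D + 1) * (T + F₀) := by
    rcases le_or_gt Q 0 with hQ0 | hQ0
    · exact hQ0.trans (by positivity)
    have hx1 : ‖x₀‖ < 1 := by
      refine lt_of_le_of_ne hx₀ fun h => ?_
      rw [hQ, h, sub_self, zero_pow hd.ne', zero_mul] at hQ0
      exact lt_irrefl _ hQ0
    -- On `B_ρ(x₀)` the distance to the unit sphere is at least `ρ`, so maximality gives `|v| ≤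
    -- ρ^(-d) Q` there.
    obtain ⟨ρ, hρ⟩ : ∃ ρ, ρ = (1 - ‖x₀‖) / 2 := ⟨_, rfl⟩
    have hρ0 : 0 < ρ := by rw [hρ]; linarith
    have hρ1 : ρ ≤ 1 := by rw [hρ]; have := norm_nonneg x₀; linarith
    have hin : ∀ x : Euc d, ‖x‖ ≤ 1 → ‖x₀ + ρ • x‖ ≤ 1 - ρ := by
      intro x hx
      have h2 := norm_add_le x₀ (ρ • x)
      rw [norm_smul, Real.norm_eq_abs, abs_of_pos hρ0] at h2
      have h3 : ρ * ‖x‖ ≤ ρ * 1 := by gcongr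
      linarith
    have hρd : 0 < ρ ^ d := by positivity
    have hinv : 1 ≤ (ρ ^ d)⁻¹ := (one_le_inv₀ hρd).2 (pow_le_one₀ hρ0.le hρ1)
    -- One number dominating the supremum, the tail and the right hand side of the rescaled problem.
    obtain ⟨B, hB⟩ : ∃ B, B = (ρ ^ d)⁻¹ * (Q + D * T + F₀) := ⟨_, rfl⟩
    have hB0 : 0 < B := by rw [hB]; positivity
    obtain ⟨C', hv'⟩ := hv.comp_affine x₀ ρ
    have htail : tail d σ (fun x => v (x₀ + ρ • x)) ≤ (ρ ^ d)⁻¹ * (D * T) := by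
      rw [hD, hT]
      exact tail_comp_affine_le hσ hv.continuous hv.norm_le hx₀ hρ0 hρ1
    have hosc := H _ (hK.scale hρ0) (ρ ^ σ * lam) B C' (by positivity) hB0 _ hv' (fun x hx => by
        rw [mem_closedBall_zero_iff] at hx
        have h1 := hin x hx
        have h2 := hQmax (x₀ + ρ • x) (by linarith)
        have h3 : ρ ^ d * |v (x₀ + ρ • x)| ≤ Q := by
          refine le_trans ?_ h2
          gcongr
          linarith
        rw [hB]
        calc |v (x₀ + ρ • x)| = (ρ ^ d)⁻¹ * (ρ ^ d * |v (x₀ + ρ • x)|) := by field_simp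
          _ ≤ (ρ ^ d)⁻¹ * (Q + D * T + F₀) := by
            gcongr
            have : 0 ≤ D * T := by positivity
            linarith)
      (htail.trans (by rw [hB]; gcongr; linarith))
      (fun x hx => by
        rw [mem_ball_zero_iff] at hx
        have h1 := hin x hx.le
        have h2 := hvF (x₀ + ρ • x) (by rw [mem_ball_zero_iff]; linarith)
        rw [LL_scale hd hσ hσ2 hν.le hΛ.le hK hv hρ0, mul_assoc, ← mul_sub, abs_mul,
          abs_of_pos (by positivity)]
        have h3 : ρ ^ σ ≤ 1 := Real.rpow_le_one hρ0.le hρ1 hσ.le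
        have h4 : F₀ ≤ Q + D * T + F₀ := by
          have : 0 ≤ D * T := by positivity
          linarith
        rw [hB]
        calc ρ ^ σ * |LL σ K v (x₀ + ρ • x) - lam * v (x₀ + ρ • x)| ≤ 1 * F₀ := by gcongr
          _ ≤ (ρ ^ d)⁻¹ * (Q + D * T + F₀) := by gcongr)
    have h0 := abs_le_of_osc_le hσ hv'.continuous hv'.norm_le hε (by linarith)
      (δ := N₀ * B * ε ^ α) (fun y hy => (hosc y (hy.trans hε2)).trans (by gcongr))
    rw [smul_zero, add_zero, ← hD, ← hV] at h0
    have h1 : |v x₀| ≤ (ρ ^ d)⁻¹ * (D * V * (D * T) + N₀ * ε ^ α * (Q + D * T + F₀)) := by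
      calc |v x₀| ≤ D * V * ((ρ ^ d)⁻¹ * (D * T)) + N₀ * B * ε ^ α := h0.trans (by gcongr)
        _ = _ := by rw [hB]; ring
    have h2 : Q = 2 ^ d * (ρ ^ d * |v x₀|) := by
      rw [hQ, hρ, div_pow]; field_simp
    have h3 : ρ ^ d * |v x₀| ≤ D * V * (D * T) + N₀ * ε ^ α * (Q + D * T + F₀) := by
      calc ρ ^ d * |v x₀| ≤ ρ ^ d *
            ((ρ ^ d)⁻¹ * (D * V * (D * T) + N₀ * ε ^ α * (Q + D * T + F₀))) := by gcongr
        _ = _ := by field_simp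
    have h4 : Q ≤ 2 ^ d * (D * V * (D * T)) + 1 / 2 * (Q + D * T + F₀) := by
      have h5 : 2 ^ d * (N₀ * ε ^ α) * (Q + D * T + F₀) ≤ 1 / 2 * (Q + D * T + F₀) :=
        mul_le_mul_of_nonneg_right hεN (by positivity)
      have h6 := mul_le_mul_of_nonneg_left h3 (by positivity : (0 : ℝ) ≤ 2 ^ d)
      rw [← h2] at h6
      linarith
    have h7 : 0 ≤ 2 ^ (d + 1) * (D * V * D) * F₀ := by positivity
    have h8 : 0 ≤ D * F₀ := by positivity
    rw [pow_succ] at h7 ⊢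
    linarith
  have h1 := hQmax x (by linarith)
  have h2 : (1 / 2 : ℝ) ^ d ≤ (1 - ‖x‖) ^ d := by gcongr; linarith
  have h3 : (1 / 2 : ℝ) ^ d * |v x| ≤ Q := (mul_le_mul_of_nonneg_right h2 (abs_nonneg _)).trans h1
  have h4 : |v x| = 2 ^ d * ((1 / 2 : ℝ) ^ d * |v x|) := by
    rw [← mul_assoc, ← mul_pow]; norm_num
  rw [h4, mul_assoc]
  exact mul_le_mul_of_nonneg_left (h3.trans hsuff) (by positivity)

/-- Interior Hölder estimate in the unit ball in terms of the tail and the right hand side. -/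
lemma exists_holder_unit (hd : 0 < d) (hσ : 0 < σ) (hσ2 : σ < 2) {α : ℝ} (hν : 0 < ν)
    (hΛ : 0 < Λ) (hα : 0 < α) (hα1 : α < 1) (hασ : α < σ) :
    ∃ N : ℝ, 0 < N ∧ ∀ K : Euc d → ℝ, Ker d σ ν Λ K → ∀ lam F₀ C : ℝ, 0 ≤ lam → 0 ≤ F₀ →
      ∀ v : Euc d → ℝ, BD 2 C v → (∀ x ∈ ball (0 : Euc d) 1, |LL σ K v x - lam * v x| ≤ F₀) →
      ∀ y : Euc d, ‖y‖ ≤ 1 / 4 → |v y - v 0| ≤ N * (tail d σ v + F₀) * ‖y‖ ^ α := by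
  obtain ⟨N₀, hN₀, H⟩ := exists_holder_of_bounded hd hσ hσ2 hν hΛ hα hα1 hασ
  obtain ⟨N₁, hN₁, H₁⟩ := exists_sup_bound (d := d) hd hσ hσ2 hν hΛ
  obtain ⟨D, hD⟩ : ∃ D : ℝ, D = ((1 / 2 : ℝ) ^ d)⁻¹ * 2 ^ ((d : ℝ) + σ) := ⟨_, rfl⟩
  have hD0 : 0 < D := by rw [hD]; positivity
  refine ⟨N₀ * (N₁ + D + 1) * 2 ^ α, by positivity, ?_⟩
  intro K hK lam F₀ C hlam hF₀ v hv hvF y hy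
  have hT0 := tail_nonneg (σ := σ) v
  have hh : (0 : ℝ) < 1 / 2 := by norm_num
  obtain ⟨C', hv'⟩ := hv.comp_affine 0 (1 / 2)
  have hDT : 0 ≤ D * tail d σ v := by positivity
  have hDF : 0 ≤ D * F₀ := by positivity
  have hNF : 0 ≤ N₁ * (tail d σ v + F₀) := by positivity
  -- The bounded estimate at scale `1/2`, with the supremum bound inserted. The extra `δ`, removed
  -- at the end, keeps the bound positive when tail and right hand side vanish.
  have key : ∀ δ : ℝ, 0 < δ →
      |v y - v 0| ≤ N₀ * ((N₁ + D + 1) * (tail d σ v + F₀) + δ) * ‖(2 : ℝ) • y‖ ^ α := by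
    intro δ hδ
    have := H _ (hK.scale hh) ((1 / 2) ^ σ * lam) ((N₁ + D + 1) * (tail d σ v + F₀) + δ) C'
      (by positivity) (by positivity) _ hv' (fun x hx => by
        rw [mem_closedBall_zero_iff] at hx
        rw [zero_add]
        refine (H₁ K hK lam F₀ C hlam hF₀ v hv hvF _ ?_).trans (by linarith)
        rw [norm_smul]; norm_num; linarith)
      ((tail_comp_affine_le hσ hv.continuous hv.norm_le (by simp) hh (by norm_num)).trans (by
        rw [← mul_assoc, ← hD]
        linarith))
      (fun x hx => by
        rw [mem_ball_zero_iff] at hx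
        have h2 := hvF (0 + (1 / 2 : ℝ) • x) (by
          rw [mem_ball_zero_iff, zero_add, norm_smul]; norm_num; linarith)
        rw [LL_scale hd hσ hσ2 hν.le hΛ.le hK hv hh, mul_assoc, ← mul_sub, abs_mul,
          abs_of_pos (by positivity)]
        have h3 : (1 / 2 : ℝ) ^ σ ≤ 1 := Real.rpow_le_one hh.le (by norm_num) hσ.le
        calc (1 / 2 : ℝ) ^ σ * _ ≤ 1 * F₀ := by gcongr
          _ ≤ _ := by linarith)
      ((2 : ℝ) • y) (by rw [norm_smul]; norm_num; linarith)
    rw [smul_smul, smul_zero] at this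
    norm_num at this
    exact this
  refine le_of_forall_pos_le_add fun δ hδ => ?_
  obtain ⟨A, hA⟩ : ∃ A, A = N₀ * ‖(2 : ℝ) • y‖ ^ α := ⟨_, rfl⟩
  have hA0 : 0 ≤ A := by rw [hA]; positivity
  refine (key (δ / (A + 1)) (by positivity)).trans ?_
  have e1 : N₀ * ((N₁ + D + 1) * (tail d σ v + F₀) + δ / (A + 1)) * ‖(2 : ℝ) • y‖ ^ α =
      N₀ * (N₁ + D + 1) * 2 ^ α * (tail d σ v + F₀) * ‖y‖ ^ α + A * (δ / (A + 1)) := by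
    rw [hA, norm_smul, Real.mul_rpow (by norm_num) (norm_nonneg _), Real.norm_ofNat]
    ring
  rw [e1]
  gcongr
  rw [mul_div_assoc', div_le_iff₀ (by positivity)]
  linarith

/-- Interior Hölder estimate at scale `R`. -/
lemma exists_holder (hd : 0 < d) (hσ : 0 < σ) (hσ2 : σ < 2) {α : ℝ} (hν : 0 < ν)
    (hΛ : 0 < Λ) (hα : 0 < α) (hα1 : α < 1) (hασ : α < σ) :
    ∃ N : ℝ, 0 < N ∧ ∀ K : Euc d → ℝ, Ker d σ ν Λ K → ∀ lam F₀ C R : ℝ, 0 ≤ lam → 0 ≤ F₀ → 0 < R →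
      ∀ v : Euc d → ℝ, BD 2 C v → (∀ x ∈ ball (0 : Euc d) R, |LL σ K v x - lam * v x| ≤ F₀) →
      ∀ y : Euc d, ‖y‖ ≤ R / 4 →
        |v y - v 0| ≤ N * (tail d σ (fun x => v (R • x)) + R ^ σ * F₀) * (‖y‖ / R) ^ α := by
  obtain ⟨N, hN, H⟩ := exists_holder_unit hd hσ hσ2 hν hΛ hα hα1 hασ
  refine ⟨N, hN, fun K hK lam F₀ C R hlam hF₀ hR v hv hvF y hy => ?_⟩
  obtain ⟨C', hv'⟩ := hv.comp_affine 0 R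
  have e : (fun x => v (0 + R • x)) = fun x => v (R • x) := by simp
  have := H _ (hK.scale hR) (R ^ σ * lam) (R ^ σ * F₀) C' (by positivity) (by positivity) _ hv'
    (fun x hx => by
      rw [mem_ball_zero_iff] at hx
      rw [LL_scale hd hσ hσ2 hν.le hΛ.le hK hv hR, mul_assoc, ← mul_sub, abs_mul,
          abs_of_pos (by positivity)]
      refine mul_le_mul_of_nonneg_left (hvF _ ?_) (by positivity)
      rw [mem_ball_zero_iff, zero_add, norm_smul, Real.norm_eq_abs, abs_of_pos hR]
      nlinarith) (R⁻¹ • y) (by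
        rw [norm_smul, norm_inv, Real.norm_eq_abs, abs_of_pos hR, inv_mul_le_iff₀ hR]; linarith)
  rw [smul_inv_smul₀ hR.ne', smul_zero, zero_add, e, norm_smul, norm_inv, Real.norm_eq_abs,
    abs_of_pos hR, inv_mul_eq_div] at this
  simpa using this

end interior

end Nonlocal

end

noncomputable section

namespace Nonlocal

open scoped FourierTransform

/-! ### Composition with continuous linear maps. -/

section composition

variable {d : ℕ} {σ ν Λ : ℝ} {K : Euc d → ℝ} {F G : Type*} [NormedAddCommGroup F]
  [NormedSpace ℝ F] [NormedAddCommGroup G] [NormedSpace ℝ G] {n : ℕ} {C : ℝ} {u : Euc d → F}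

lemma BD.clm_comp (h : BD n C u) (L : F →L[ℝ] G) : BD n (‖L‖ * C) (fun x => L (u x)) := by
  refine ⟨L.contDiff.comp h.1, fun k hk x => ?_⟩
  refine (L.norm_iteratedFDeriv_comp_left (h.1.contDiffAt (x := x)) (by exact_mod_cast hk)).trans ?_
  exact mul_le_mul_of_nonneg_left (h.2 k hk x) (norm_nonneg _)

lemma LL_clm_comp [CompleteSpace F] [CompleteSpace G] (hd : 0 < d) (hσ : 0 < σ) (hσ2 : σ < 2)
    (hν : 0 ≤ ν) (hK : Ker d σ ν Λ K) (h : BD 2 C u) (L : F →L[ℝ] G) (x : Euc d) :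
    LL σ K (fun x => L (u x)) x = L (LL σ K u x) := by
  unfold LL
  rw [← L.integral_comp_comm (integrable_smul_sd hd hσ hσ2 hν hK h x)]
  congr 1; ext y
  have h1 : fderiv ℝ (fun x => L (u x)) x = L ∘L fderiv ℝ u x :=
    (L.hasFDerivAt.comp x (h.differentiable (n := 1) x).hasFDerivAt).fderiv
  unfold sd
  rw [h1]
  simp

end composition

/-! ### Plane waves and the Fourier symbol. -/

section wave

variable {d : ℕ} {σ ν Λ : ℝ} {K : Euc d → ℝ}

/-- The plane wave `x ↦ exp (-2 π i ξ · x)`. -/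
def wave (ξ x : Euc d) : ℂ := Complex.exp (↑(-2 * Real.pi * inner ℝ ξ x) * Complex.I)

/-- The derivative of the phase of a plane wave. -/
def phase (ξ : Euc d) : Euc d →L[ℝ] ℂ :=
  (ContinuousLinearMap.toSpanSingleton ℝ ((-2 * Real.pi : ℝ) * Complex.I)) ∘L innerSL ℝ ξ

lemma phase_apply (ξ y : Euc d) : phase ξ y = ↑(-2 * Real.pi * inner ℝ ξ y) * Complex.I := by
  simp [phase]; ring

lemma norm_phase_le (ξ : Euc d) : ‖phase ξ‖ ≤ 2 * Real.pi * ‖ξ‖ := by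
  refine ContinuousLinearMap.opNorm_le_bound _ (by positivity) fun y => ?_
  rw [phase_apply, norm_mul, Complex.norm_I, mul_one, Complex.norm_real, Real.norm_eq_abs, abs_mul,
    abs_mul, abs_neg, abs_two, abs_of_pos Real.pi_pos]
  have := abs_real_inner_le_norm ξ y
  have h2 := Real.pi_pos
  calc 2 * Real.pi * |inner ℝ ξ y| ≤ 2 * Real.pi * (‖ξ‖ * ‖y‖) := by gcongr
    _ = _ := by ring

lemma norm_wave (ξ x : Euc d) : ‖wave ξ x‖ = 1 := Complex.norm_exp_ofReal_mul_I _

lemma wave_add (ξ x y : Euc d) : wave ξ (x + y) = wave ξ x * wave ξ y := by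
  unfold wave
  rw [← Complex.exp_add, inner_add_right]
  congr 1
  push_cast; ring

lemma continuous_wave : Continuous fun p : Euc d × Euc d => wave p.1 p.2 := by
  unfold wave; fun_prop

lemma hasFDerivAt_wave (ξ x : Euc d) : HasFDerivAt (wave ξ) (wave ξ x • phase ξ) x := by
  have h1 : HasFDerivAt (fun x => phase ξ x) (phase ξ) x := (phase ξ).hasFDerivAt
  have h2 := h1.cexp
  have e : (fun x => Complex.exp (phase ξ x)) = wave ξ := by
    ext x; rw [phase_apply, wave]
  rw [e] at h2
  refine h2.congr_fderiv ?_
  rw [phase_apply, wave]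

lemma fderiv_wave (ξ x : Euc d) : fderiv ℝ (wave ξ) x = wave ξ x • phase ξ :=
  (hasFDerivAt_wave ξ x).fderiv

/-- The bound is polynomial in the frequency, so moments of the density suffice to apply Fubini in
`LL_fourier`. -/
lemma BD_wave (ξ : Euc d) (n : ℕ) : BD n ((1 + 2 * Real.pi * ‖ξ‖) ^ n) (wave ξ) := by
  have hp := Real.pi_pos
  have h1 : 1 ≤ 1 + 2 * Real.pi * ‖ξ‖ := by
    have : 0 ≤ 2 * Real.pi * ‖ξ‖ := by positivity
    linarith
  induction n with
  | zero =>
    refine BD.zero_iff.2 ⟨?_, fun x => by simp [norm_wave]⟩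
    exact continuous_iff_continuousAt.2 fun x => (hasFDerivAt_wave ξ x).continuousAt
  | succ n ih =>
    refine BD.of_fderiv (fun x => (hasFDerivAt_wave ξ x).differentiableAt)
      (fun x => by rw [norm_wave]; exact one_le_pow₀ h1) ?_
    have e : fderiv ℝ (wave ξ) = fun x =>
        (ContinuousLinearMap.toSpanSingleton ℂ (phase ξ)).restrictScalars ℝ (wave ξ x) := by
      ext1 x; rw [fderiv_wave]; simp
    rw [e]
    refine (ih.clm_comp _).mono ?_ le_rfl
    rw [pow_succ']
    gcongr
    rw [ContinuousLinearMap.norm_restrictScalars, ContinuousLinearMap.norm_toSpanSingleton]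
    have := norm_phase_le ξ
    linarith

lemma sd_wave (ξ y x : Euc d) :
    sd σ (wave ξ) y x = wave ξ x * (wave ξ y - 1 - chi d σ y * phase ξ y) := by
  unfold sd
  rw [wave_add, fderiv_wave]
  simp only [_root_.smul_apply, smul_eq_mul, Complex.real_smul]
  ring

lemma wave_zero (ξ : Euc d) : wave ξ 0 = 1 := by simp [wave]

/-- The Fourier symbol of the non-local operator. -/
def symbol (σ : ℝ) (K : Euc d → ℝ) (ξ : Euc d) : ℂ := LL σ K (wave ξ) 0

lemma LL_wave (ξ x : Euc d) : LL σ K (wave ξ) x = wave ξ x * symbol σ K ξ := by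
  unfold symbol LL
  rw [← integral_const_mul]
  congr 1; ext y
  rw [sd_wave, sd_wave, wave_zero, one_mul, mul_smul_comm]

lemma aestronglyMeasurable_sd_wave (x : Euc d) {μ : Measure (Euc d × Euc d)} :
    AEStronglyMeasurable (fun p : Euc d × Euc d => sd σ (wave p.1) p.2 x) μ := by
  simp only [sd_wave, phase_apply]
  have h1 : Continuous fun p : Euc d × Euc d => wave p.1 x :=
    continuous_wave.comp (continuous_fst.prodMk continuous_const)
  have h2 := continuous_wave (d := d)
  have h3 : Measurable fun p : Euc d × Euc d => ((chi d σ p.2 : ℝ) : ℂ) :=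
    Complex.measurable_ofReal.comp (measurable_chi.comp measurable_snd)
  have h4 : Continuous fun p : Euc d × Euc d =>
      ((-2 * Real.pi * inner ℝ p.1 p.2 : ℝ) : ℂ) * Complex.I := by fun_prop
  exact (h1.measurable.mul ((h2.measurable.sub measurable_const).sub
    (h3.mul h4.measurable))).aestronglyMeasurable

lemma aestronglyMeasurable_symbol (hK : AEMeasurable K volume) :
    AEStronglyMeasurable (symbol σ K) volume := by
  unfold symbol LL
  refine AEStronglyMeasurable.integral_prod_right'
    (f := fun p : Euc d × Euc d => K p.2 • sd σ (wave p.1) p.2 0) ?_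
  exact hK.aestronglyMeasurable.comp_snd.smul (aestronglyMeasurable_sd_wave 0)

lemma re_sd_wave_nonpos (ξ y : Euc d) : (sd σ (wave ξ) y 0).re ≤ 0 := by
  have h1 : (wave ξ y).re ≤ 1 := (Complex.re_le_norm _).trans (norm_wave ξ y).le
  rw [sd_wave, wave_zero, one_mul, phase_apply]
  simpa using h1

lemma re_symbol (hd : 0 < d) (hσ : 0 < σ) (hσ2 : σ < 2) (hν : 0 ≤ ν)
    (hK : Ker d σ ν Λ K) (ξ : Euc d) :
    (symbol σ K ξ).re = ∫ y, K y * (sd σ (wave ξ) y 0).re := by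
  have hi := integrable_smul_sd hd hσ hσ2 hν hK (BD_wave ξ 2) 0
  have := integral_re hi
  simp only [RCLike.re_to_complex] at this
  unfold symbol LL
  rw [← this]
  congr 1; ext y
  simp

/-- The real part of the second difference of a wave is `cos - 1 ≤ 0`, as the gradient term is
imaginary; the lower bound on the kernel therefore gives an upper bound. -/
lemma re_symbol_le (hd : 0 < d) (hσ : 0 < σ) (hσ2 : σ < 2) (hν : 0 ≤ ν)
    (hK : Ker d σ ν Λ K) (ξ : Euc d) :
    (symbol σ K ξ).re ≤ ν * (symbol σ (homKernel d σ) ξ).re := by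
  have hre : ∀ {ν Λ : ℝ} {K : Euc d → ℝ}, 0 ≤ ν → Ker d σ ν Λ K →
      Integrable fun y => K y * (sd σ (wave ξ) y 0).re := by
    intro ν Λ K hν hK
    refine (integrable_smul_sd hd hσ hσ2 hν hK (BD_wave ξ 2) 0).re.congr
      (Eventually.of_forall fun y => ?_)
    simp
  rw [re_symbol hd hσ hσ2 hν hK, re_symbol hd hσ hσ2 zero_le_one ker_homKernel,
    ← integral_const_mul]
  refine integral_mono_ae (hre hν hK) ((hre zero_le_one ker_homKernel).const_mul ν) ?_
  filter_upwards [ae_ne_zero hd] with y hy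
  have := mul_le_mul_of_nonpos_right (hK.lower y hy) (re_sd_wave_nonpos (σ := σ) ξ y)
  linarith

lemma re_symbol_homKernel_nonpos (hd : 0 < d) (hσ : 0 < σ) (hσ2 : σ < 2) (ξ : Euc d) :
    (symbol σ (homKernel d σ) ξ).re ≤ 0 := by
  rw [re_symbol hd hσ hσ2 zero_le_one ker_homKernel]
  exact integral_nonpos fun y => mul_nonpos_of_nonneg_of_nonpos (homKernel_nonneg y)
    (re_sd_wave_nonpos ξ y)

lemma im_symbol_homKernel (hd : 0 < d) (hσ : 0 < σ) (hσ2 : σ < 2) (ξ : Euc d) :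
    (symbol σ (homKernel d σ) ξ).im = 0 := by
  have hi := integrable_smul_sd hd hσ hσ2 zero_le_one ker_homKernel (BD_wave ξ 2) 0
  have := integral_im hi
  simp only [RCLike.im_to_complex] at this
  unfold symbol LL
  rw [← this]
  refine integral_eq_zero_of_odd fun y => ?_
  rw [sd_wave, sd_wave, homKernel_neg, chi_neg, map_neg, wave_zero, phase_apply]
  simp only [wave, inner_neg_right, Complex.real_smul, Complex.mul_im, Complex.sub_im,
    Complex.sub_re, Complex.mul_re, Complex.ofReal_re, Complex.ofReal_im, Complex.exp_ofReal_mul_I_im,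
    Complex.exp_ofReal_mul_I_re, Complex.I_re, Complex.I_im, Complex.one_re, Complex.one_im,
    Complex.neg_im, Complex.neg_re, mul_neg, Real.sin_neg]
  ring

/-- Coercivity on the Fourier side: the real part of the symbol and `-lam` have the same sign and
add up. It yields invertibility and both `L_2` estimates. -/
lemma le_norm_symbol_sub (hd : 0 < d) (hσ : 0 < σ) (hσ2 : σ < 2) (hν : 0 ≤ ν)
    (hK : Ker d σ ν Λ K) (lam : ℝ) (ξ : Euc d) :
    lam + ν * ‖symbol σ (homKernel d σ) ξ‖ ≤ ‖symbol σ K ξ - lam‖ := by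
  have h1 := re_symbol_le hd hσ hσ2 hν hK ξ
  have h2 : ‖symbol σ (homKernel d σ) ξ‖ = -(symbol σ (homKernel d σ) ξ).re := by
    have e : symbol σ (homKernel d σ) ξ = ((symbol σ (homKernel d σ) ξ).re : ℂ) :=
      Complex.ext (by simp) (by simp [im_symbol_homKernel hd hσ hσ2 ξ])
    rw [e, Complex.norm_real, Real.norm_eq_abs, Complex.ofReal_re,
      abs_of_nonpos (re_symbol_homKernel_nonpos hd hσ hσ2 ξ)]
  have h3 := Complex.abs_re_le_norm (symbol σ K ξ - lam)
  have h4 := neg_abs_le (symbol σ K ξ - lam).re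
  rw [Complex.sub_re, Complex.ofReal_re] at h3 h4
  rw [h2]
  linarith

end wave

/-! ### Plancherel's theorem and smoothness of Fourier integrals. -/

section plancherel

variable {d : ℕ}

lemma fourier_eq_wave (g : Euc d → ℂ) (x : Euc d) : 𝓕 g x = ∫ ξ, wave ξ x * g ξ := by
  rw [Real.fourier_eq']
  rfl

lemma continuous_fourier {g : Euc d → ℂ} (hg : Integrable g) : Continuous (𝓕 g) :=
  VectorFourier.fourierIntegral_continuous Real.continuous_fourierChar
    (by exact continuous_inner) hg

/-- Plancherel's theorem for functions in `L_1 ∩ L_2`. -/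
lemma eLpNorm_fourier {g : Euc d → ℂ} (h1 : Integrable g) (h2 : MemLp g 2) :
    eLpNorm (𝓕 g) 2 volume = eLpNorm g 2 volume := by
  obtain ⟨G, hG⟩ : ∃ G : Lp ℂ 2 (volume : Measure (Euc d)), G = h2.toLp g := ⟨_, rfl⟩
  -- The `L_2` transform agrees with the Fourier integral: test both against smooth compactly
  -- supported functions and move the transform to the test function.
  have hae : ∀ᵐ x, (𝓕 G : Lp ℂ 2 (volume : Measure (Euc d))) x = 𝓕 g x := by
    refine ae_eq_of_integral_contDiff_smul_eq
      ((Lp.memLp (𝓕 G)).locallyIntegrable (by norm_num))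
      (continuous_fourier h1).locallyIntegrable fun φ hφ hφc => ?_
    have hφc' : HasCompactSupport (fun x => (φ x : ℂ)) := hφc.comp_left (g := Complex.ofReal) (by simp)
    have hφ' : ContDiff ℝ ∞ (fun x => (φ x : ℂ)) := Complex.ofRealCLM.contDiff.comp hφ
    obtain ⟨ψ, hψ⟩ : ∃ ψ : 𝓢(Euc d, ℂ), ∀ x, ψ x = (φ x : ℂ) :=
      ⟨hφc'.toSchwartzMap hφ', fun x => rfl⟩
    have e1 := DFunLike.congr_fun (Lp.fourier_toTemperedDistribution_eq G) ψ
    rw [TemperedDistribution.fourier_apply, Lp.toTemperedDistribution_apply,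
      Lp.toTemperedDistribution_apply] at e1
    have e2 : ∫ x, (𝓕 ψ) x • G x = ∫ x, (𝓕 ψ) x • g x := by
      refine integral_congr_ae ?_
      filter_upwards [h2.coeFn_toLp] with x hx
      rw [hG, hx]
    have e3 : ∫ x, (𝓕 ψ) x • g x = ∫ x, ψ x • 𝓕 g x := by
      have := VectorFourier.integral_fourierIntegral_smul_eq_flip (L := innerₗ (Euc d))
        (μ := volume) (ν := volume) Real.continuous_fourierChar continuous_inner ψ.integrable h1
      rw [SchwartzMap.fourier_coe]
      simpa using! this
    rw [e2, e3] at e1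
    simp only [hψ] at e1
    simpa using! e1.symm
  rw [← eLpNorm_congr_ae hae]
  have e : ‖𝓕 G‖ = ‖G‖ := Lp.norm_fourier_eq G
  rw [Lp.norm_def, Lp.norm_def, ENNReal.toReal_eq_toReal_iff' (Lp.eLpNorm_ne_top _)
    (Lp.eLpNorm_ne_top _)] at e
  rw [e, hG]
  exact eLpNorm_congr_ae h2.coeFn_toLp

lemma BD_fourier {g : Euc d → ℂ} (hm : AEStronglyMeasurable g volume)
    (hg : ∀ n : ℕ, Integrable (fun ξ => ‖ξ‖ ^ n * ‖g ξ‖)) (n : ℕ) : ∃ C, BD n C (𝓕 g) := by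
  refine ⟨∑ k ∈ Finset.range (n + 1), ∫ v, ‖VectorFourier.fourierPowSMulRight (innerSL ℝ) g v k‖,
    ?_, fun k hk x => ?_⟩
  · have := Real.contDiff_fourier (f := g) (N := n) fun k _ => hg k
    exact_mod_cast this
  · rw [Real.iteratedFDeriv_fourier (N := n) (fun k _ => hg k) hm (by exact_mod_cast hk)]
    have h1 : ‖𝓕 (fun v => VectorFourier.fourierPowSMulRight (innerSL ℝ) g v k) x‖ ≤
        ∫ v, ‖VectorFourier.fourierPowSMulRight (innerSL ℝ) g v k‖ :=
      VectorFourier.norm_fourierIntegral_le_integral_norm _ _ _ _ _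
    exact h1.trans (Finset.single_le_sum
      (f := fun k => ∫ v, ‖VectorFourier.fourierPowSMulRight (innerSL ℝ) g v k‖)
      (fun k _ => integral_nonneg fun _ => norm_nonneg _) (Finset.mem_range.2 (by omega)))

end plancherel

end Nonlocal

end

noncomputable section

namespace Nonlocal

open scoped FourierTransform

/-! ### Fourier multipliers and solvability in `L_2`. -/

section solution

variable {d : ℕ} {σ ν Λ : ℝ} {K : Euc d → ℝ} {g : Euc d → ℂ}

lemma integrable_wave_mul (hg : Integrable g) (x : Euc d) :
    Integrable (fun ξ => wave ξ x * g ξ) := by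
  refine hg.bdd_mul (c := 1) ?_ (Eventually.of_forall fun ξ => (norm_wave ξ x).le)
  exact (continuous_wave.comp (continuous_id.prodMk continuous_const)).aestronglyMeasurable

lemma hasFDerivAt_fourier_wave (hm : AEStronglyMeasurable g volume)
    (hg : ∀ n : ℕ, Integrable (fun ξ => ‖ξ‖ ^ n * ‖g ξ‖)) (x : Euc d) :
    Integrable (fun ξ => g ξ • wave ξ x • phase ξ) ∧
    HasFDerivAt (𝓕 g) (∫ ξ, g ξ • wave ξ x • phase ξ) x := by
  have hg0 : Integrable g := by
    have := hg 0
    simp only [pow_zero, one_mul] at this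
    exact (integrable_norm_iff hm).1 this
  have e : 𝓕 g = fun x => ∫ ξ, g ξ * wave ξ x := by
    ext1 x
    rw [fourier_eq_wave]
    congr 1; ext ξ; ring
  have hmeas : AEStronglyMeasurable (fun ξ => g ξ • wave ξ x • phase ξ) volume := by
    refine hm.smul (Continuous.aestronglyMeasurable ?_)
    have h1 : Continuous fun ξ : Euc d => wave ξ x :=
      continuous_wave.comp (continuous_id.prodMk continuous_const)
    have h2 : Continuous (phase : Euc d → Euc d →L[ℝ] ℂ) := by unfold phase; fun_prop
    exact h1.smul h2
  have hb : ∀ ξ x : Euc d, ‖g ξ • wave ξ x • phase ξ‖ ≤ 2 * Real.pi * (‖ξ‖ ^ 1 * ‖g ξ‖) := by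
    intro ξ x
    rw [norm_smul, norm_smul, norm_wave, one_mul, pow_one]
    have := norm_phase_le ξ
    have h2 := mul_le_mul_of_nonneg_left this (norm_nonneg (g ξ))
    linarith
  refine ⟨((hg 1).const_mul _).mono' hmeas (Eventually.of_forall fun ξ => hb ξ x), ?_⟩
  rw [e]
  refine hasFDerivAt_integral_of_dominated_of_fderiv_le (𝕜 := ℝ) (s := univ)
    (F := fun x ξ => g ξ * wave ξ x) (F' := fun x ξ => g ξ • wave ξ x • phase ξ) univ_mem
    (Eventually.of_forall fun x => ?_) ?_ hmeas
    (Eventually.of_forall fun ξ x _ => hb ξ x) ((hg 1).const_mul _)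
    (Eventually.of_forall fun ξ x _ => (hasFDerivAt_wave ξ x).const_mul (g ξ))
  · simpa only [mul_comm] using (integrable_wave_mul hg0 x).1
  · simpa only [mul_comm] using integrable_wave_mul hg0 x

lemma sd_fourier (hm : AEStronglyMeasurable g volume)
    (hg : ∀ n : ℕ, Integrable (fun ξ => ‖ξ‖ ^ n * ‖g ξ‖)) (y x : Euc d) :
    sd σ (𝓕 g) y x = ∫ ξ, g ξ * sd σ (wave ξ) y x := by
  have hg0 : Integrable g := by
    have := hg 0
    simp only [pow_zero, one_mul] at this
    exact (integrable_norm_iff hm).1 this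
  obtain ⟨hi, hd⟩ := hasFDerivAt_fourier_wave hm hg x
  have i1 := integrable_wave_mul hg0 (x + y)
  have i2 := integrable_wave_mul hg0 x
  have i3 := (hi.apply_continuousLinearMap y).smul (chi d σ y)
  have e : sd σ (𝓕 g) y x =
    𝓕 g (x + y) - 𝓕 g x - chi d σ y • fderiv ℝ (𝓕 g) x y := rfl
  rw [e, hd.fderiv, fourier_eq_wave, fourier_eq_wave, ContinuousLinearMap.integral_apply hi,
    ← integral_smul, ← integral_sub i1 i2]
  refine (integral_sub (i1.sub i2) i3).symm.trans ?_
  congr 1; ext ξ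
  simp only [sd, Pi.sub_apply, fderiv_wave, _root_.smul_apply, smul_eq_mul, Complex.real_smul,
    Pi.smul_apply]
  ring

/-- The non-local operator is a Fourier multiplier. -/
lemma LL_fourier (hd : 0 < d) (hσ : 0 < σ) (hσ2 : σ < 2) (hν : 0 ≤ ν)
    (hK : Ker d σ ν Λ K) (hm : AEStronglyMeasurable g volume)
    (hg : ∀ n : ℕ, Integrable (fun ξ => ‖ξ‖ ^ n * ‖g ξ‖)) (x : Euc d) :
    LL σ K (𝓕 g) x = 𝓕 (fun ξ => symbol σ K ξ * g ξ) x := by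
  have e1 : LL σ K (𝓕 g) x = ∫ y, ∫ ξ, K y • (g ξ * sd σ (wave ξ) y x) := by
    unfold LL
    congr 1; ext1 y
    rw [sd_fourier hm hg, integral_smul]
  have e2 : 𝓕 (fun ξ => symbol σ K ξ * g ξ) x = ∫ ξ, ∫ y, K y • (g ξ * sd σ (wave ξ) y x) := by
    rw [fourier_eq_wave]
    congr 1; ext1 ξ
    rw [← mul_assoc, ← LL_wave, mul_comm, LL, ← integral_const_mul]
    congr 1; ext1 y
    rw [mul_smul_comm]
  rw [e1, e2]
  refine integral_integral_swap ?_
  have hpi := Real.pi_pos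
  have hb : Integrable (fun ξ : Euc d => ‖g ξ‖ * (1 + 2 * Real.pi * ‖ξ‖) ^ 2) := by
    have := ((hg 0).add ((hg 1).const_mul (4 * Real.pi))).add ((hg 2).const_mul (4 * Real.pi ^ 2))
    refine this.congr (Eventually.of_forall fun ξ => ?_)
    simp only [Pi.add_apply]
    ring
  refine Integrable.mono' (g := fun p : Euc d × Euc d => 4 * Λ *
    ((wt σ p.1 * homKernel d σ p.1) * (‖g p.2‖ * (1 + 2 * Real.pi * ‖p.2‖) ^ 2)))
    (((integrable_wt hd hσ hσ2).mul_prod hb).const_mul _) ?_ ?_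
  · refine hK.aem.aestronglyMeasurable.comp_fst.smul (hm.comp_snd.mul ?_)
    have h := (aestronglyMeasurable_sd_wave (d := d) (σ := σ) x (μ := volume.prod volume)).prod_swap
    exact h
  · have a1 : ∀ᵐ p : Euc d × Euc d, p.1 ≠ 0 :=
      Measure.quasiMeasurePreserving_fst.ae (ae_ne_zero hd)
    filter_upwards [a1] with p hp
    have h1 := norm_smul_sd_le hσ hν hK (BD_wave p.2 2) x hp
    simp only [Function.uncurry]
    rw [← mul_smul_comm, norm_mul]
    have h2 := mul_le_mul_of_nonneg_left h1 (norm_nonneg (g p.2))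
    linarith

lemma eLpNorm_le_of_norm_le {f g : Euc d → ℂ} {c : ℝ} (h : ∀ x, c * ‖f x‖ ≤ ‖g x‖)
    (hc : 0 ≤ c) :
    ENNReal.ofReal c * eLpNorm f 2 volume ≤ eLpNorm g 2 volume := by
  have e : ENNReal.ofReal c * eLpNorm f 2 volume = eLpNorm ((c : ℂ) • f) 2 volume := by
    rw [eLpNorm_const_smul, ← ofReal_norm, Complex.norm_real, Real.norm_of_nonneg hc]
  rw [e]
  refine eLpNorm_mono fun x => ?_
  rw [Pi.smul_apply, norm_smul, Complex.norm_real, Real.norm_of_nonneg hc]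
  exact h x

/-- Solvability of `L w - λ w = h` with the a priori estimate in `L_2`. -/
lemma exists_solution (hd : 0 < d) (hσ : 0 < σ) (hσ2 : σ < 2) (hν : 0 < ν)
    (hK : Ker d σ ν Λ K) {lam : ℝ} (hlam : 0 < lam) {h : Euc d → ℝ} (hh : ContDiff ℝ ∞ h)
    (hhc : HasCompactSupport h) :
    ∃ w : Euc d → ℝ, (∀ n, ∃ C, BD n C w) ∧ (∀ x, LL σ K w x - lam * w x = h x) ∧
      ENNReal.ofReal lam * eLpNorm w 2 volume ≤ eLpNorm h 2 volume ∧
      ENNReal.ofReal ν * eLpNorm (LL σ (homKernel d σ) w) 2 volume ≤ eLpNorm h 2 volume := by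
  have hc' : HasCompactSupport (fun x => (h x : ℂ)) := hhc.comp_left (g := Complex.ofReal) (by simp)
  have hs' : ContDiff ℝ ∞ (fun x => (h x : ℂ)) := Complex.ofRealCLM.contDiff.comp hh
  obtain ⟨φ, hφ⟩ : ∃ φ : 𝓢(Euc d, ℂ), ∀ x, φ x = (h x : ℂ) :=
    ⟨hc'.toSchwartzMap hs', fun x => rfl⟩
  -- The solution is sought as the forward transform of a density, since `wave` is the kernel of
  -- `𝓕`; hence the data are transformed by the inverse.
  obtain ⟨H, hH⟩ : ∃ H : 𝓢(Euc d, ℂ), H = 𝓕⁻ φ := ⟨_, rfl⟩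
  have hFH : ∀ x, 𝓕 (⇑H) x = (h x : ℂ) := by
    intro x
    rw [← SchwartzMap.fourier_coe, hH, FourierTransform.fourier_fourierInv_eq, hφ]
  have hlow := le_norm_symbol_sub hd hσ hσ2 hν.le hK lam
  have hlow1 : ∀ ξ, lam ≤ ‖symbol σ K ξ - lam‖ := fun ξ => by
    have : 0 ≤ ν * ‖symbol σ (homKernel d σ) ξ‖ := by positivity
    linarith [hlow ξ]
  have hlow2 : ∀ ξ, ν * ‖symbol σ (homKernel d σ) ξ‖ ≤ ‖symbol σ K ξ - lam‖ := fun ξ => by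
    linarith [hlow ξ]
  have hne : ∀ ξ, symbol σ K ξ - lam ≠ 0 := fun ξ => norm_pos_iff.1 (hlam.trans_le (hlow1 ξ))
  obtain ⟨g, hg⟩ : ∃ g : Euc d → ℂ, g = fun ξ => (symbol σ K ξ - lam)⁻¹ * H ξ := ⟨_, rfl⟩
  have hgH : ∀ ξ, (symbol σ K ξ - lam) * g ξ = H ξ := fun ξ => by
    rw [hg]; exact mul_inv_cancel_left₀ (hne ξ) _
  have hgn : ∀ ξ, ‖symbol σ K ξ - lam‖ * ‖g ξ‖ = ‖H ξ‖ := fun ξ => by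
    rw [← norm_mul, hgH]
  have hgl : ∀ ξ, lam * ‖g ξ‖ ≤ ‖H ξ‖ := fun ξ => by
    rw [← hgn]; exact mul_le_mul_of_nonneg_right (hlow1 ξ) (norm_nonneg _)
  have hgs : ∀ ξ, ν * ‖symbol σ (homKernel d σ) ξ * g ξ‖ ≤ ‖H ξ‖ := fun ξ => by
    rw [← hgn, norm_mul, ← mul_assoc]
    exact mul_le_mul_of_nonneg_right (hlow2 ξ) (norm_nonneg _)
  have hsm : AEStronglyMeasurable (symbol σ K) volume := aestronglyMeasurable_symbol hK.aem
  have hgm : AEStronglyMeasurable g volume := by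
    rw [hg]
    exact (hsm.aemeasurable.sub aemeasurable_const).inv.aestronglyMeasurable.mul
      H.continuous.aestronglyMeasurable
  have hsgm : AEStronglyMeasurable (fun ξ => symbol σ (homKernel d σ) ξ * g ξ) volume :=
    (aestronglyMeasurable_symbol measurable_homKernel.aemeasurable).mul hgm
  -- The density is dominated by a Schwartz function, so all its moments are finite and its
  -- transform is smooth with bounded derivatives, without any smoothness of the symbol.
  have hgi : ∀ n : ℕ, Integrable (fun ξ => ‖ξ‖ ^ n * ‖g ξ‖) := by
    intro n
    refine ((H.integrable_pow_mul volume n).const_mul lam⁻¹).mono'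
      ((by fun_prop : Continuous fun ξ : Euc d => ‖ξ‖ ^ n).aestronglyMeasurable.mul hgm.norm)
      (Eventually.of_forall fun ξ => ?_)
    rw [norm_mul, norm_norm, Real.norm_of_nonneg (by positivity)]
    have := mul_le_mul_of_nonneg_left (hgl ξ) (by positivity : 0 ≤ lam⁻¹ * ‖ξ‖ ^ n)
    calc ‖ξ‖ ^ n * ‖g ξ‖ = lam⁻¹ * ‖ξ‖ ^ n * (lam * ‖g ξ‖) := by field_simp
      _ ≤ _ := this
      _ = _ := by ring
  have hg0 : Integrable g := by
    have := hgi 0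
    simp only [pow_zero, one_mul] at this
    exact (integrable_norm_iff hgm).1 this
  have hsg0 : Integrable (fun ξ => symbol σ (homKernel d σ) ξ * g ξ) := by
    refine (H.integrable.norm.const_mul ν⁻¹).mono' hsgm (Eventually.of_forall fun ξ => ?_)
    rw [inv_mul_eq_div, le_div_iff₀ hν, mul_comm]
    exact hgs ξ
  have hHL : MemLp (⇑H) 2 volume := H.memLp 2
  have hgL : MemLp g 2 volume := by
    refine hHL.of_le_mul (c := lam⁻¹) hgm (Eventually.of_forall fun ξ => ?_)
    rw [inv_mul_eq_div, le_div_iff₀ hlam, mul_comm]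
    exact hgl ξ
  have hsgL : MemLp (fun ξ => symbol σ (homKernel d σ) ξ * g ξ) 2 volume := by
    refine hHL.of_le_mul (c := ν⁻¹) hsgm (Eventually.of_forall fun ξ => ?_)
    rw [inv_mul_eq_div, le_div_iff₀ hν, mul_comm]
    exact hgs ξ
  have hHh : eLpNorm (⇑H) 2 volume = eLpNorm h 2 volume := by
    rw [← eLpNorm_fourier H.integrable hHL]
    refine eLpNorm_congr_norm_ae (Eventually.of_forall fun x => ?_)
    rw [hFH, Complex.norm_real]
  obtain ⟨C₂, hC₂⟩ := BD_fourier hgm hgi 2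
  have hre : ∀ {ν Λ : ℝ} {K : Euc d → ℝ}, 0 ≤ ν → Ker d σ ν Λ K → ∀ x,
      LL σ K (fun x => (𝓕 g x).re) x = (LL σ K (𝓕 g) x).re := fun hν hK x =>
    LL_clm_comp hd hσ hσ2 hν hK hC₂ Complex.reCLM x
  refine ⟨fun x => (𝓕 g x).re, fun n => ?_, fun x => ?_, ?_, ?_⟩
  · obtain ⟨C, hC⟩ := BD_fourier hgm hgi n
    exact ⟨_, hC.clm_comp Complex.reCLM⟩
  · have hsi : Integrable (fun ξ => symbol σ K ξ * g ξ) := by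
      have := H.integrable.add (hg0.const_mul (lam : ℂ))
      refine this.congr (Eventually.of_forall fun ξ => ?_)
      simp only [Pi.add_apply]
      rw [← hgH]; ring
    have e : LL σ K (𝓕 g) x - lam * 𝓕 g x = h x := by
      rw [LL_fourier hd hσ hσ2 hν.le hK hgm hgi, ← hFH, fourier_eq_wave, fourier_eq_wave,
        fourier_eq_wave, ← integral_const_mul, ← integral_sub (integrable_wave_mul hsi x)
          ((integrable_wave_mul hg0 x).const_mul _)]
      congr 1; ext1 ξ
      rw [← hgH]; ring
    rw [hre hν.le hK]
    have := congrArg Complex.re e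
    simpa using this
  · have h1 : eLpNorm (fun x => (𝓕 g x).re) 2 volume ≤ eLpNorm (𝓕 g) 2 volume :=
      eLpNorm_mono fun x => Complex.abs_re_le_norm _
    rw [eLpNorm_fourier hg0 hgL] at h1
    calc _ ≤ ENNReal.ofReal lam * eLpNorm g 2 volume := by gcongr
      _ ≤ eLpNorm (⇑H) 2 volume := eLpNorm_le_of_norm_le hgl hlam.le
      _ = _ := hHh
  · have h1 : eLpNorm (LL σ (homKernel d σ) fun x => (𝓕 g x).re) 2 volume ≤
        eLpNorm (𝓕 (fun ξ => symbol σ (homKernel d σ) ξ * g ξ)) 2 volume := by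
      refine eLpNorm_mono fun x => ?_
      rw [hre zero_le_one ker_homKernel, LL_fourier hd hσ hσ2 zero_le_one ker_homKernel hgm hgi]
      exact Complex.abs_re_le_norm _
    rw [eLpNorm_fourier hsg0 hsgL] at h1
    calc _ ≤ ENNReal.ofReal ν * eLpNorm (fun ξ => symbol σ (homKernel d σ) ξ * g ξ) 2 volume := by
          gcongr
      _ ≤ eLpNorm (⇑H) 2 volume := eLpNorm_le_of_norm_le hgs hν.le
      _ = _ := hHh

end solution

end Nonlocal

end

noncomputable section

namespace Nonlocal

open scoped NNReal

/-! ### Tails, averages and maximal functions. -/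

section averages

variable {d : ℕ} {σ : ℝ}

lemma lintegral_comp_smul {G : Euc d → ℝ≥0∞} (hG : Measurable G) {S : ℝ} (hS : 0 < S) :
    ∫⁻ y, G (S • y) = ENNReal.ofReal ((S ^ d)⁻¹) * ∫⁻ y, G y := by
  have h := Measure.map_addHaar_smul (volume : Measure (Euc d)) hS.ne'
  rw [← lintegral_map hG (measurable_const_smul S), h, lintegral_smul_measure,
    finrank_euclideanSpace, Fintype.card_fin, abs_of_pos (by positivity), smul_eq_mul]

lemma setLIntegral_ball_le_maximalFn (g : Euc d → ℝ) {ρ : ℝ} (hρ : 0 < ρ) :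
    ∫⁻ y in ball 0 ρ, ‖g y‖ₑ ≤ volume (ball (0 : Euc d) ρ) * maximalFn d g 0 := by
  have h : ⨍⁻ y in ball 0 ρ, ‖g y‖ₑ ∂volume ≤ maximalFn d g 0 :=
    le_iSup₂_of_le ρ hρ le_rfl
  rw [setLAverage_eq, ENNReal.div_le_iff (measure_ball_pos _ _ hρ).ne' measure_ball_lt_top.ne] at h
  rwa [mul_comm]

lemma volume_ball_eq {S : ℝ} (hS : 0 < S) :
    volume (ball (0 : Euc d) S) = ENNReal.ofReal (S ^ d) * volume (ball (0 : Euc d) 1) := by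
  have := Measure.addHaar_ball_mul_of_pos (volume : Measure (Euc d)) 0 hS 1
  rwa [mul_one, finrank_euclideanSpace, Fintype.card_fin] at this

lemma ofReal_inv_mul_ofReal {S : ℝ} (hS : 0 < S) :
    ENNReal.ofReal S⁻¹ * ENNReal.ofReal S = 1 := by
  rw [← ENNReal.ofReal_mul (by positivity), inv_mul_cancel₀ hS.ne', ENNReal.ofReal_one]

lemma setLIntegral_comp_smul_le_maximalFn {g : Euc d → ℝ} (hg : Measurable g) {S ρ : ℝ}
    (hS : 0 < S) (hρ : 0 < ρ) :
    ∫⁻ y in ball 0 ρ, ‖g (S • y)‖ₑ ≤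
      ENNReal.ofReal (ρ ^ d) * volume (ball (0 : Euc d) 1) * maximalFn d g 0 := by
  have e : ∫⁻ y in ball 0 ρ, ‖g (S • y)‖ₑ =
      ∫⁻ y : Euc d, (ball (0 : Euc d) (S * ρ)).indicator (fun z => ‖g z‖ₑ) (S • y) := by
    rw [← lintegral_indicator measurableSet_ball]
    congr 1; ext1 y
    simp only [indicator, mem_ball_zero_iff, norm_smul, Real.norm_eq_abs, abs_of_pos hS,
      mul_lt_mul_iff_right₀ hS]
  rw [e, lintegral_comp_smul (hg.enorm.indicator measurableSet_ball) hS,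
    lintegral_indicator measurableSet_ball]
  calc _ ≤ ENNReal.ofReal ((S ^ d)⁻¹) * (volume (ball (0 : Euc d) (S * ρ)) * maximalFn d g 0) := by
        gcongr
        exact setLIntegral_ball_le_maximalFn g (by positivity)
    _ = (ENNReal.ofReal ((S ^ d)⁻¹) * ENNReal.ofReal (S ^ d)) *
        (ENNReal.ofReal (ρ ^ d) * volume (ball (0 : Euc d) 1) * maximalFn d g 0) := by
        rw [volume_ball_eq (by positivity), mul_pow, ENNReal.ofReal_mul (by positivity)]
        ring
    _ = _ := by rw [ofReal_inv_mul_ofReal (by positivity), one_mul]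

lemma exists_nnreal_coe {x : ℝ≥0∞} (hx : x ≠ ⊤) : ∃ C : ℝ≥0, (C : ℝ≥0∞) = x :=
  ⟨x.toNNReal, ENNReal.coe_toNNReal hx⟩

/-- It suffices to keep the term with the least `k` such that `|y| < 2^k`; minimality gives `2^k ≤ 2
(1 + |y|)`. -/
lemma om_le_tsum (hσ : 0 < σ) (y : Euc d) :
    ENNReal.ofReal (om d σ y) ≤ ∑' k : ℕ, (ball (0 : Euc d) (2 ^ k)).indicator
      (fun _ => ENNReal.ofReal (2 ^ ((d : ℝ) + σ) * ((2 : ℝ) ^ k) ^ (-((d : ℝ) + σ)))) y := by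
  have hs : 0 < (d : ℝ) + σ := by positivity
  obtain ⟨k, hk1, hk2⟩ : ∃ k : ℕ, ‖y‖ < 2 ^ k ∧ (2 : ℝ) ^ k ≤ 2 * (1 + ‖y‖) := by
    have hex : ∃ k : ℕ, ‖y‖ < (2 : ℝ) ^ k := pow_unbounded_of_one_lt _ (by norm_num)
    classical
    refine ⟨Nat.find hex, Nat.find_spec hex, ?_⟩
    have h0 := norm_nonneg y
    rcases Nat.eq_zero_or_pos (Nat.find hex) with h | h
    · rw [h, pow_zero]; linarith
    · have := Nat.find_min hex (Nat.sub_one_lt h.ne')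
      have e : (2 : ℝ) ^ Nat.find hex = 2 * 2 ^ (Nat.find hex - 1) := by
        rw [← pow_succ', Nat.sub_add_cancel h]
      rw [e]
      linarith
  refine le_trans ?_ (ENNReal.le_tsum k)
  rw [indicator_of_mem (by simpa using hk1)]
  refine ENNReal.ofReal_le_ofReal ?_
  unfold om
  rw [Real.rpow_neg (by positivity), Real.rpow_neg (by positivity), ← div_eq_mul_inv,
    inv_eq_one_div, div_le_div_iff₀ (by positivity) (by positivity), one_mul,
    ← Real.mul_rpow (by norm_num) (by positivity)]
  exact Real.rpow_le_rpow (by positivity) hk2 hs.le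

/-- Weighted tails are controlled by the maximal function. -/
lemma exists_lintegral_om_le_maximalFn (hσ : 0 < σ) :
    ∃ C : ℝ≥0, ∀ g : Euc d → ℝ, Measurable g → ∀ S : ℝ, 0 < S →
      ∫⁻ y, ‖g (S • y)‖ₑ * ENNReal.ofReal (om d σ y) ≤ C * maximalFn d g 0 := by
  have hlt : ENNReal.ofReal ((2 : ℝ) ^ (-σ)) < 1 := by
    rw [ENNReal.ofReal_lt_one]
    exact Real.rpow_lt_one_of_one_lt_of_neg (by norm_num) (by linarith)
  obtain ⟨C, hC⟩ := exists_nnreal_coe (x := ENNReal.ofReal (2 ^ ((d : ℝ) + σ)) *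
      volume (ball (0 : Euc d) 1) * (1 - ENNReal.ofReal ((2 : ℝ) ^ (-σ)))⁻¹) (by
    refine ENNReal.mul_ne_top (ENNReal.mul_ne_top ENNReal.ofReal_ne_top measure_ball_lt_top.ne) ?_
    exact ENNReal.inv_ne_top.2 (tsub_pos_of_lt hlt).ne')
  refine ⟨C, fun g hg S hS => ?_⟩
  have hgS : Measurable fun y : Euc d => ‖g (S • y)‖ₑ :=
    (hg.comp (measurable_const_smul S)).enorm
  calc ∫⁻ y, ‖g (S • y)‖ₑ * ENNReal.ofReal (om d σ y)
      ≤ ∫⁻ y, ∑' k : ℕ, ‖g (S • y)‖ₑ * (ball (0 : Euc d) (2 ^ k)).indicator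
        (fun _ => ENNReal.ofReal (2 ^ ((d : ℝ) + σ) * ((2 : ℝ) ^ k) ^ (-((d : ℝ) + σ)))) y := by
        refine lintegral_mono fun y => ?_
        rw [ENNReal.tsum_mul_left]
        gcongr
        exact om_le_tsum hσ y
    _ = ∑' k : ℕ, ENNReal.ofReal (2 ^ ((d : ℝ) + σ) * ((2 : ℝ) ^ k) ^ (-((d : ℝ) + σ))) *
        ∫⁻ y in ball (0 : Euc d) (2 ^ k), ‖g (S • y)‖ₑ := by
        have hmk : ∀ k : ℕ, AEMeasurable (fun y : Euc d => ‖g (S • y)‖ₑ *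
            (ball (0 : Euc d) (2 ^ k)).indicator (fun _ => ENNReal.ofReal
              (2 ^ ((d : ℝ) + σ) * ((2 : ℝ) ^ k) ^ (-((d : ℝ) + σ)))) y) volume := fun k =>
          (hgS.mul (measurable_const.indicator measurableSet_ball)).aemeasurable
        rw [lintegral_tsum hmk]
        refine tsum_congr fun k => ?_
        rw [← lintegral_const_mul _ hgS, ← lintegral_indicator measurableSet_ball]
        congr 1; ext1 y
        by_cases hy : y ∈ ball (0 : Euc d) (2 ^ k)
        · rw [indicator_of_mem hy, indicator_of_mem hy, mul_comm]
        · rw [indicator_of_notMem hy, indicator_of_notMem hy, mul_zero]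
    _ ≤ ∑' k : ℕ, ENNReal.ofReal (2 ^ ((d : ℝ) + σ)) * volume (ball (0 : Euc d) 1) *
        maximalFn d g 0 * ENNReal.ofReal ((2 : ℝ) ^ (-σ)) ^ k := by
        refine ENNReal.tsum_le_tsum fun k => ?_
        refine (mul_le_mul_right (setLIntegral_comp_smul_le_maximalFn hg hS
          (by positivity : (0 : ℝ) < 2 ^ k)) _).trans (le_of_eq ?_)
        -- The volume of the dyadic ball cancels `2^(-kd)` and leaves a geometric series of ratio
        -- `2^(-σ)`.
        have e : (2 : ℝ) ^ ((d : ℝ) + σ) * ((2 : ℝ) ^ k) ^ (-((d : ℝ) + σ)) * (2 ^ k) ^ d =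
            2 ^ ((d : ℝ) + σ) * (2 ^ (-σ)) ^ k := by
          have h2 : (0 : ℝ) < 2 ^ k := by positivity
          rw [mul_assoc, ← Real.rpow_natCast (2 ^ k) d, ← Real.rpow_add h2,
            ← Real.rpow_natCast 2 k, ← Real.rpow_mul (by norm_num), ← Real.rpow_natCast _ k,
            ← Real.rpow_mul (by norm_num)]
          congr 2; ring
        rw [← ENNReal.ofReal_pow (by positivity)]
        calc _ = ENNReal.ofReal (2 ^ ((d : ℝ) + σ) * ((2 : ℝ) ^ k) ^ (-((d : ℝ) + σ)) *
              (2 ^ k) ^ d) * (volume (ball (0 : Euc d) 1) * maximalFn d g 0) := by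
              rw [ENNReal.ofReal_mul (by positivity) (q := (2 ^ k) ^ d)]; ring
          _ = _ := by
              rw [e, ENNReal.ofReal_mul (by positivity)]; ring
    _ = _ := by
        rw [ENNReal.tsum_mul_left, ENNReal.tsum_geometric, hC]; ring

lemma ofReal_tail (hσ : 0 < σ) {g : Euc d → ℝ} {C : ℝ} (hg : Continuous g) (hC : ∀ x, |g x| ≤ C)
    (S : ℝ) : ENNReal.ofReal (tail d σ fun x => g (S • x)) =
      ∫⁻ y, ‖g (S • y)‖ₑ * ENNReal.ofReal (om d σ y) := by
  have hgS : Continuous fun x : Euc d => g (S • x) := by fun_prop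
  unfold tail
  rw [ofReal_integral_eq_lintegral_ofReal
    (integrable_mul_om hσ hgS.aestronglyMeasurable fun x => hC _)
    (Eventually.of_forall fun y => mul_nonneg (abs_nonneg _) (om_nonneg y))]
  congr 1; ext1 y
  rw [ENNReal.ofReal_mul (abs_nonneg _), Real.enorm_eq_ofReal_abs]

lemma eLpNorm_two (g : Euc d → ℝ) (μ : Measure (Euc d)) :
    eLpNorm g 2 μ = (∫⁻ x, ‖g x‖ₑ ^ (2 : ℝ) ∂μ) ^ (1 / 2 : ℝ) := by
  rw [eLpNorm_eq_lintegral_rpow_enorm_toReal (by norm_num) (by norm_num)]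
  simp

lemma holderConjugate_two : (2 : ℝ).HolderConjugate 2 := by
  rw [Real.holderConjugate_iff]; norm_num

lemma exists_lintegral_om_le_eLpNorm (hσ : 0 < σ) :
    ∃ C : ℝ≥0, ∀ g : Euc d → ℝ, Measurable g → ∀ S : ℝ, 0 < S →
      ∫⁻ y, ‖g (S • y)‖ₑ * ENNReal.ofReal (om d σ y) ≤
        C * (ENNReal.ofReal ((S ^ d)⁻¹) ^ (1 / 2 : ℝ) * eLpNorm g 2 volume) := by
  have hfin : ∫⁻ y : Euc d, ENNReal.ofReal (om d σ y) ^ (2 : ℝ) ≠ ⊤ := by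
    refine ne_top_of_le_ne_top (b := ∫⁻ y : Euc d, ENNReal.ofReal (om d σ y)) ?_ ?_
    · exact ((integrable_om hσ).lintegral_lt_top).ne
    · refine lintegral_mono fun y => ?_
      have h1 : ENNReal.ofReal (om d σ y) ≤ 1 := by
        rw [ENNReal.ofReal_le_one]
        unfold om
        refine Real.rpow_le_one_of_one_le_of_nonpos (by linarith [norm_nonneg y]) ?_
        have : 0 < (d : ℝ) + σ := by positivity
        linarith
      calc ENNReal.ofReal (om d σ y) ^ (2 : ℝ) ≤ ENNReal.ofReal (om d σ y) ^ (1 : ℝ) :=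
            ENNReal.rpow_le_rpow_of_exponent_ge h1 (by norm_num)
        _ = _ := ENNReal.rpow_one _
  obtain ⟨C, hC⟩ := exists_nnreal_coe (ENNReal.rpow_ne_top_of_nonneg
    (by norm_num : (0 : ℝ) ≤ 1 / 2) hfin)
  refine ⟨C, fun g hg S hS => ?_⟩
  have hgS : Measurable fun y : Euc d => ‖g (S • y)‖ₑ :=
    (hg.comp (measurable_const_smul S)).enorm
  have h1 := ENNReal.lintegral_mul_le_Lp_mul_Lq volume holderConjugate_two hgS.aemeasurable
    (measurable_om (d := d) (σ := σ)).ennreal_ofReal.aemeasurable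
  simp only [Pi.mul_apply] at h1
  refine h1.trans (le_of_eq ?_)
  rw [hC, eLpNorm_two, lintegral_comp_smul (G := fun y => ‖g y‖ₑ ^ (2 : ℝ))
    (hg.enorm.pow_const _) hS, ENNReal.mul_rpow_of_nonneg _ _ (by norm_num)]
  ring

lemma enorm_rpow_two (t : ℝ) : ‖t‖ₑ ^ (2 : ℝ) = ‖t ^ 2‖ₑ := by
  rw [ENNReal.rpow_two, enorm_pow]

/-- Cauchy–Schwarz with the weight split into two square roots, then the previous maximal bound for
`g^2`. -/
lemma exists_lintegral_om_le_maximalFn_sq (hσ : 0 < σ) :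
    ∃ C : ℝ≥0, ∀ g : Euc d → ℝ, Measurable g → ∀ S : ℝ, 0 < S →
      ∫⁻ y, ‖g (S • y)‖ₑ * ENNReal.ofReal (om d σ y) ≤
        C * maximalFn d (fun x => g x ^ 2) 0 ^ (1 / 2 : ℝ) := by
  obtain ⟨C₁, hC₁⟩ := exists_lintegral_om_le_maximalFn (d := d) hσ
  have hfin : ∫⁻ y : Euc d, ENNReal.ofReal (om d σ y) ≠ ⊤ :=
    ((integrable_om hσ).lintegral_lt_top).ne
  obtain ⟨C, hC⟩ := exists_nnreal_coe (x := (C₁ : ℝ≥0∞) ^ (1 / 2 : ℝ) *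
    (∫⁻ y : Euc d, ENNReal.ofReal (om d σ y)) ^ (1 / 2 : ℝ)) (ENNReal.mul_ne_top
      (ENNReal.rpow_ne_top_of_nonneg (by norm_num) ENNReal.coe_ne_top)
      (ENNReal.rpow_ne_top_of_nonneg (by norm_num) hfin))
  refine ⟨C, fun g hg S hS => ?_⟩
  have hgS : Measurable fun y : Euc d => ‖g (S • y)‖ₑ :=
    (hg.comp (measurable_const_smul S)).enorm
  have hom := (measurable_om (d := d) (σ := σ)).ennreal_ofReal
  have hsplit : ∀ x : ℝ≥0∞, x ^ (1 / 2 : ℝ) * x ^ (1 / 2 : ℝ) = x := fun x => by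
    rw [← ENNReal.rpow_add_of_nonneg _ _ (by norm_num) (by norm_num)]; norm_num
  have hsq : ∀ x : ℝ≥0∞, (x ^ (1 / 2 : ℝ)) ^ (2 : ℝ) = x := fun x => by
    rw [← ENNReal.rpow_mul]; norm_num
  have h1 := ENNReal.lintegral_mul_le_Lp_mul_Lq volume holderConjugate_two
    (f := fun y : Euc d => ‖g (S • y)‖ₑ * ENNReal.ofReal (om d σ y) ^ (1 / 2 : ℝ))
    (g := fun y : Euc d => ENNReal.ofReal (om d σ y) ^ (1 / 2 : ℝ))
    (hgS.mul (hom.pow_const _)).aemeasurable (hom.pow_const _).aemeasurable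
  simp only [Pi.mul_apply, mul_assoc, hsplit, hsq, ENNReal.mul_rpow_of_nonneg _ _ zero_le_two,
    enorm_rpow_two] at h1
  refine h1.trans ?_
  have h2 := hC₁ (fun x => g x ^ 2) (hg.pow_const 2) S hS
  calc _ ≤ (C₁ * maximalFn d (fun x => g x ^ 2) 0) ^ (1 / 2 : ℝ) *
        (∫⁻ y : Euc d, ENNReal.ofReal (om d σ y)) ^ (1 / 2 : ℝ) := by gcongr
    _ = _ := by
      rw [ENNReal.mul_rpow_of_nonneg _ _ (by norm_num), hC]; ring

lemma exists_eLpNorm_le_maximalFn :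
    ∃ C : ℝ≥0, ∀ f h : Euc d → ℝ, ∀ S : ℝ, 0 < S → (∀ x, |h x| ≤ |f x|) →
      (∀ x, 4 * S ≤ ‖x‖ → h x = 0) →
      eLpNorm h 2 volume ≤ C * (ENNReal.ofReal (S ^ d) ^ (1 / 2 : ℝ) *
        maximalFn d (fun x => f x ^ 2) 0 ^ (1 / 2 : ℝ)) := by
  obtain ⟨C, hC⟩ := exists_nnreal_coe (x := (ENNReal.ofReal (4 ^ d) *
    volume (ball (0 : Euc d) 1)) ^ (1 / 2 : ℝ)) (ENNReal.rpow_ne_top_of_nonneg (by norm_num)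
      (ENNReal.mul_ne_top ENNReal.ofReal_ne_top measure_ball_lt_top.ne))
  refine ⟨C, fun f h S hS hle h0 => ?_⟩
  rw [eLpNorm_two, hC, ← ENNReal.mul_rpow_of_nonneg _ _ (by norm_num),
    ← ENNReal.mul_rpow_of_nonneg _ _ (by norm_num)]
  refine ENNReal.rpow_le_rpow ?_ (by norm_num)
  calc ∫⁻ x, ‖h x‖ₑ ^ (2 : ℝ) ≤ ∫⁻ x, (ball (0 : Euc d) (4 * S)).indicator
        (fun x => ‖f x ^ 2‖ₑ) x := by
        refine lintegral_mono fun x => ?_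
        by_cases hx : x ∈ ball (0 : Euc d) (4 * S)
        · rw [indicator_of_mem hx, ← enorm_rpow_two]
          refine ENNReal.rpow_le_rpow ?_ (by norm_num)
          rw [Real.enorm_eq_ofReal_abs, Real.enorm_eq_ofReal_abs]
          exact ENNReal.ofReal_le_ofReal (hle x)
        · rw [indicator_of_notMem hx, h0 x (by simpa using hx)]
          simp
    _ = ∫⁻ x in ball (0 : Euc d) (4 * S), ‖f x ^ 2‖ₑ := lintegral_indicator measurableSet_ball _
    _ ≤ _ := setLIntegral_ball_le_maximalFn (fun x => f x ^ 2) (by positivity)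
    _ = _ := by
      rw [volume_ball_eq (by positivity), mul_pow, ENNReal.ofReal_mul (by positivity)]
      ring

lemma exists_setLAverage_le_eLpNorm :
    ∃ C : ℝ≥0, ∀ g : Euc d → ℝ, Measurable g → ∀ r : ℝ, 0 < r →
      ⨍⁻ y in ball (0 : Euc d) r, ‖g y‖ₑ ∂volume ≤
        C * (ENNReal.ofReal ((r ^ d)⁻¹) ^ (1 / 2 : ℝ) * eLpNorm g 2 volume) := by
  have hV := (measure_ball_pos volume (0 : Euc d) one_pos).ne'
  have hV' : volume (ball (0 : Euc d) 1) ≠ ⊤ := measure_ball_lt_top.ne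
  obtain ⟨C, hC⟩ := exists_nnreal_coe (x := (volume (ball (0 : Euc d) 1))⁻¹ ^ (1 / 2 : ℝ))
    (ENNReal.rpow_ne_top_of_nonneg (by norm_num) (ENNReal.inv_ne_top.2 hV))
  refine ⟨C, fun g hg r hr => ?_⟩
  have hB := (measure_ball_pos volume (0 : Euc d) hr).ne'
  have hB' : volume (ball (0 : Euc d) r) ≠ ⊤ := measure_ball_lt_top.ne
  have h1 := ENNReal.lintegral_mul_le_Lp_mul_Lq (volume.restrict (ball (0 : Euc d) r))
    holderConjugate_two hg.enorm.aemeasurable (aemeasurable_const (b := (1 : ℝ≥0∞)))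
  simp only [Pi.mul_apply, mul_one, ENNReal.one_rpow, lintegral_const, one_mul,
    Measure.restrict_apply_univ] at h1
  have h2 : ∫⁻ y in ball (0 : Euc d) r, ‖g y‖ₑ ^ (2 : ℝ) ≤ ∫⁻ y, ‖g y‖ₑ ^ (2 : ℝ) :=
    setLIntegral_le_lintegral _ _
  have h3 : ENNReal.ofReal ((r ^ d)⁻¹) = (ENNReal.ofReal (r ^ d))⁻¹ :=
    ENNReal.ofReal_inv_of_pos (by positivity)
  have h4 : (C : ℝ≥0∞) * ENNReal.ofReal ((r ^ d)⁻¹) ^ (1 / 2 : ℝ) =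
      (volume (ball (0 : Euc d) r))⁻¹ ^ (1 / 2 : ℝ) := by
    rw [hC, h3, ← ENNReal.mul_rpow_of_nonneg _ _ (by norm_num), volume_ball_eq hr,
      ENNReal.mul_inv (Or.inr hV') (Or.inr hV)]
    congr 1; ring
  rw [setLAverage_eq, ENNReal.div_le_iff hB hB', ← mul_assoc, h4, eLpNorm_two]
  refine h1.trans ?_
  calc _ ≤ (∫⁻ y, ‖g y‖ₑ ^ (2 : ℝ)) ^ (1 / 2 : ℝ) *
        volume (ball (0 : Euc d) r) ^ (1 / 2 : ℝ) := by gcongr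
    _ = _ := by
      have h5 : (volume (ball (0 : Euc d) r))⁻¹ ^ (1 / 2 : ℝ) * volume (ball (0 : Euc d) r) =
          volume (ball (0 : Euc d) r) ^ (1 / 2 : ℝ) := by
        conv_lhs => rw [← ENNReal.rpow_one (volume (ball (0 : Euc d) r)), ← ENNReal.rpow_neg_one,
          ← ENNReal.rpow_mul, ← ENNReal.rpow_mul, ← ENNReal.rpow_add _ _ hB hB']
        norm_num
      rw [mul_right_comm, h5, mul_comm]

/-- The mean may be replaced by any constant at the cost of a factor `2`. -/
lemma meanOsc_le (g : Euc d → ℝ) (hg : Continuous g) {r : ℝ} (hr : 0 < r) (a : ℝ) :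
    meanOsc d g r ≤ 2 * ⨍⁻ y in ball (0 : Euc d) r, ‖g y - a‖ₑ ∂volume := by
  have hB := (measure_ball_pos volume (0 : Euc d) hr).ne'
  have hB' : volume (ball (0 : Euc d) r) ≠ ⊤ := measure_ball_lt_top.ne
  have hi : IntegrableOn g (ball (0 : Euc d) r) :=
    (hg.continuousOn.integrableOn_compact (isCompact_closedBall 0 r)).mono_set
      ball_subset_closedBall
  have hV := volume_real_ball_pos hr (0 : Euc d)
  have havg : ‖a - ⨍ y in ball (0 : Euc d) r, g y‖ₑ ≤
      ⨍⁻ y in ball (0 : Euc d) r, ‖g y - a‖ₑ ∂volume := by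
    have e : a - ⨍ y in ball (0 : Euc d) r, g y =
        -((volume.real (ball (0 : Euc d) r))⁻¹ * ∫ y in ball (0 : Euc d) r, (g y - a)) := by
      rw [integral_sub hi (integrableOn_const hB'), setIntegral_const, setAverage_eq, smul_eq_mul,
        smul_eq_mul]
      field_simp
      ring
    rw [e, enorm_neg, enorm_mul, setLAverage_eq, ENNReal.div_eq_inv_mul]
    have e2 : ‖(volume.real (ball (0 : Euc d) r))⁻¹‖ₑ = (volume (ball (0 : Euc d) r))⁻¹ := by
      rw [Real.enorm_eq_ofReal (by positivity), ENNReal.ofReal_inv_of_pos hV,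
        measureReal_def, ENNReal.ofReal_toReal hB']
    rw [e2]
    gcongr
    exact enorm_integral_le_lintegral_enorm _
  unfold meanOsc
  calc ⨍⁻ x in ball (0 : Euc d) r, ‖g x - ⨍ y in ball 0 r, g y‖ₑ ∂volume
      ≤ ⨍⁻ x in ball (0 : Euc d) r, (‖g x - a‖ₑ + ‖a - ⨍ y in ball 0 r, g y‖ₑ) ∂volume := by
        refine lintegral_mono fun x => ?_
        have : g x - ⨍ y in ball (0 : Euc d) r, g y =
          (g x - a) + (a - ⨍ y in ball (0 : Euc d) r, g y) := by ring
        rw [this]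
        exact enorm_add_le _ _
    _ = ⨍⁻ x in ball (0 : Euc d) r, ‖g x - a‖ₑ ∂volume + ‖a - ⨍ y in ball 0 r, g y‖ₑ := by
        rw [setLAverage_eq, setLAverage_eq, lintegral_add_right _ measurable_const,
          lintegral_const, Measure.restrict_apply_univ, ENNReal.add_div,
          ENNReal.mul_div_cancel_right hB hB']
    _ ≤ _ := by rw [two_mul]; gcongr

/-- The mean oscillation of a perturbation of a function with small oscillation. -/
lemma exists_meanOsc_add_le :
    ∃ C : ℝ≥0, ∀ v w : Euc d → ℝ, Continuous v → Continuous w → ∀ r : ℝ, 0 < r → ∀ X : ℝ≥0∞,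
      (∀ y : Euc d, ‖y‖ ≤ r → ENNReal.ofReal |v y - v 0| ≤ X) →
      meanOsc d (fun x => v x + w x) r ≤
        2 * (X + C * (ENNReal.ofReal ((r ^ d)⁻¹) ^ (1 / 2 : ℝ) * eLpNorm w 2 volume)) := by
  obtain ⟨C, hC⟩ := exists_setLAverage_le_eLpNorm (d := d)
  refine ⟨C, fun v w hv hw r hr X hX => ?_⟩
  have hB := (measure_ball_pos volume (0 : Euc d) hr).ne'
  have hB' : volume (ball (0 : Euc d) r) ≠ ⊤ := measure_ball_lt_top.ne
  refine (meanOsc_le _ (by fun_prop) hr (v 0)).trans ?_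
  gcongr
  refine le_trans ?_ (add_le_add_right (hC w hw.measurable r hr) X)
  have hX' : ∫⁻ y in ball (0 : Euc d) r, X = X * volume (ball (0 : Euc d) r) := by
    rw [lintegral_const, Measure.restrict_apply_univ]
  have e : X = (∫⁻ y in ball (0 : Euc d) r, X) / volume (ball (0 : Euc d) r) := by
    rw [hX', ENNReal.mul_div_cancel_right hB hB']
  rw [e, setLAverage_eq, setLAverage_eq, ← ENNReal.add_div, ← lintegral_add_left measurable_const]
  gcongr ?_ / _
  refine setLIntegral_mono' measurableSet_ball fun y hy => ?_
  have h1 : v y + w y - v 0 = (v y - v 0) + w y := by ring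
  rw [h1]
  refine (enorm_add_le _ _).trans ?_
  gcongr
  rw [Real.enorm_eq_ofReal_abs]
  exact hX y (mem_ball_zero_iff.1 hy).le

end averages

end Nonlocal

end

noncomputable section

namespace Nonlocal

open scoped NNReal

/-! ### Decomposition of the solution and the oscillation estimates. -/

section oscillation

variable {d : ℕ} {σ : ℝ}

lemma maximalFn_const_mul (c : ℝ) (g : Euc d → ℝ) (x : Euc d) :
    maximalFn d (fun y => c * g y) x = ‖c‖ₑ * maximalFn d g x := by
  unfold maximalFn
  simp_rw [ENNReal.mul_iSup, laverage, enorm_mul]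
  congr 1; ext1 r; congr 1; ext1 _
  exact lintegral_const_mul' _ _ enorm_ne_top

lemma meanOsc_const_mul (c : ℝ) (g : Euc d → ℝ) (r : ℝ) :
    meanOsc d (fun y => c * g y) r = ‖c‖ₑ * meanOsc d g r := by
  unfold meanOsc
  simp_rw [average, integral_const_mul, ← mul_sub, laverage, enorm_mul]
  exact lintegral_const_mul' _ _ enorm_ne_top

/-- Away from the support, the operator with homogeneous kernel is controlled by the tail. -/
lemma abs_LL_homKernel_le_tail (hσ : 0 < σ) {f g : Euc d → ℝ} {B S : ℝ} (hf : Continuous f)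
    (hB : ∀ x, |f x| ≤ B) (hgf : ∀ x, |g x| ≤ |f x|) (hS : 0 < S)
    (hg0 : ∀ x ∈ ball (0 : Euc d) (2 * S), g x = 0) {x : Euc d} (hx : x ∈ ball (0 : Euc d) S) :
    |LL σ (homKernel d σ) g x| ≤ S ^ (-σ) * (3 ^ ((d : ℝ) + σ) * tail d σ (fun y => f (S • y))) := by
  rw [mem_ball_zero_iff] at hx
  have hev : g =ᶠ[𝓝 x] fun _ => 0 := by
    filter_upwards [isOpen_ball.mem_nhds (mem_ball_zero_iff.2 (by linarith : ‖x‖ < 2 * S))]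
      with y hy using hg0 y hy
  have hfd : fderiv ℝ g x = 0 := by rw [hev.fderiv_eq]; simp
  have hgx : g x = 0 := hev.eq_of_nhds
  set G : Euc d → ℝ := fun z => |f (S • z)| * om d σ z with hG
  have hfS : Continuous fun z : Euc d => f (S • z) := by fun_prop
  have hGi : Integrable G := integrable_mul_om hσ hfS.aestronglyMeasurable fun z => hB _
  have hGi' : Integrable fun y : Euc d => G (S⁻¹ • (x + y)) :=
    (hGi.comp_smul (inv_ne_zero hS.ne')).comp_add_left x
  have hint : ∫ y : Euc d, G (S⁻¹ • (x + y)) = S ^ d * tail d σ (fun y => f (S • y)) := by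
    rw [integral_add_left_eq_self (fun y => G (S⁻¹ • y)) x,
      Measure.integral_comp_inv_smul (volume : Measure (Euc d)) G S]
    simp [abs_of_pos hS, tail, hG]
  calc |LL σ (homKernel d σ) g x|
      ≤ ∫ y : Euc d, S ^ (-((d : ℝ) + σ)) * 3 ^ ((d : ℝ) + σ) * G (S⁻¹ • (x + y)) := by
        rw [← Real.norm_eq_abs]
        refine norm_integral_le_of_norm_le (hGi'.const_mul _) (Eventually.of_forall fun y => ?_)
        simp only [sd, hgx, hfd, zero_apply, mul_zero, sub_zero, smul_eq_mul,
          norm_mul, Real.norm_eq_abs, abs_of_nonneg (homKernel_nonneg y), hG,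
          smul_inv_smul₀ hS.ne']
        by_cases hy : x + y ∈ ball (0 : Euc d) (2 * S)
        · rw [hg0 _ hy, abs_zero, mul_zero]
          have := om_nonneg (σ := σ) (S⁻¹ • (x + y))
          positivity
        -- From `|x| < S` and `|x + y| ≥ 2S` follows `S + |x + y| ≤ 3 |y|`, the source of the power
        -- of `3`.
        rw [mem_ball_zero_iff, not_lt] at hy
        have hxy := norm_add_le x y
        have hy0 : 0 < ‖y‖ := by linarith
        have hk : homKernel d σ y ≤
            S ^ (-((d : ℝ) + σ)) * 3 ^ ((d : ℝ) + σ) * om d σ (S⁻¹ • (x + y)) := by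
          have e : S ^ (-((d : ℝ) + σ)) * 3 ^ ((d : ℝ) + σ) * om d σ (S⁻¹ • (x + y)) =
              ((S + ‖x + y‖) / 3) ^ (-((d : ℝ) + σ)) := by
            rw [om, norm_smul, norm_inv, Real.norm_eq_abs, abs_of_pos hS,
              ← inv_inv ((3 : ℝ) ^ ((d : ℝ) + σ)), ← Real.rpow_neg (by norm_num),
              ← Real.inv_rpow (by norm_num), ← Real.mul_rpow hS.le (by norm_num),
              ← Real.mul_rpow (by positivity) (by positivity)]
            congr 1; field_simp
          rw [e]
          exact Real.rpow_le_rpow_of_nonpos (by positivity) (by linarith) (by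
            have : (0 : ℝ) ≤ d := Nat.cast_nonneg d
            linarith)
        calc _ ≤ (S ^ (-((d : ℝ) + σ)) * 3 ^ ((d : ℝ) + σ) * om d σ (S⁻¹ • (x + y))) *
              |f (x + y)| :=
              mul_le_mul hk (hgf _) (abs_nonneg _) ((homKernel_nonneg y).trans hk)
          _ = _ := by ring
    _ = _ := by
        rw [integral_const_mul, hint, neg_add, Real.rpow_add hS, Real.rpow_neg hS.le (d : ℝ),
          Real.rpow_natCast]
        field_simp

/-- The bookkeeping shared by the two estimates: `v` has a Hölder bound at scale `2κr`, `w` an `L_2`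
bound. It is used with `B = 0` for `λu` and with `B = 3^(d+σ)` for the operator with homogeneous
kernel. -/
lemma exists_meanOsc_le_of_decomp (hσ : 0 < σ) {α N B : ℝ} (hα : 0 < α) (hN : 0 ≤ N)
    (hB : 0 ≤ B) (C₀ : ℝ≥0) :
    ∃ D : ℝ≥0, ∀ r κ : ℝ, 0 < r → 2 ≤ κ → ∀ f u v w : Euc d → ℝ, Continuous f → Continuous u →
      Continuous v → Continuous w → ∀ A : ℝ, (∀ x, |f x| ≤ A) → (∀ x, |v x| ≤ A) →
      (∀ x, u x = v x + w x) →
      (∀ y, ‖y‖ ≤ 2 * κ * r / 4 → |v y - v 0| ≤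
        N * (tail d σ (fun x => v ((2 * κ * r) • x)) + B * tail d σ (fun x => f ((2 * κ * r) • x))) *
          (‖y‖ / (2 * κ * r)) ^ α) →
      eLpNorm w 2 volume ≤ C₀ * (ENNReal.ofReal ((2 * κ * r) ^ d) ^ (1 / 2 : ℝ) *
        maximalFn d (fun x => f x ^ 2) 0 ^ (1 / 2 : ℝ)) →
      meanOsc d u r ≤ D * (ENNReal.ofReal (κ ^ (-α)) * maximalFn d u 0 +
        ENNReal.ofReal (κ ^ ((d : ℝ) / 2)) * maximalFn d (fun x => f x ^ 2) 0 ^ (1 / 2 : ℝ)) := by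
  obtain ⟨C₁, hC₁⟩ := exists_lintegral_om_le_maximalFn (d := d) hσ
  obtain ⟨C₂, hC₂⟩ := exists_lintegral_om_le_eLpNorm (d := d) hσ
  obtain ⟨C₃, hC₃⟩ := exists_lintegral_om_le_maximalFn_sq (d := d) hσ
  obtain ⟨C₆, hC₆⟩ := exists_meanOsc_add_le (d := d)
  set N' : ℝ≥0 := N.toNNReal
  set B' : ℝ≥0 := B.toNNReal
  set C₇ : ℝ≥0 := Real.toNNReal (2 ^ ((d : ℝ) / 2))
  refine ⟨2 * (N' * C₁ + N' * (C₂ * C₀ + B' * C₃) + C₆ * C₀ * C₇), ?_⟩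
  intro r κ hr hκ f u v w hf hu hv hw A hfA hvA huvw hosc hw2
  have hκ0 : 0 < κ := by linarith
  set S : ℝ := 2 * κ * r with hSdef
  have hS : 0 < S := by positivity
  set Mf := maximalFn d (fun x => f x ^ 2) 0 ^ (1 / 2 : ℝ)
  set Mu := maximalFn d u 0
  set Ka := ENNReal.ofReal (κ ^ (-α))
  set Kd := ENNReal.ofReal (κ ^ ((d : ℝ) / 2))
  have hKad : Ka ≤ Kd := by
    refine ENNReal.ofReal_le_ofReal (Real.rpow_le_rpow_of_exponent_le (by linarith) ?_)
    have : (0 : ℝ) ≤ d := Nat.cast_nonneg d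
    linarith
  -- Rescaling gives `S^(-d/2)`, cancelling the `S^(d/2)` in the `L_2` bound of `w`.
  have hTw : ∫⁻ y, ‖w (S • y)‖ₑ * ENNReal.ofReal (om d σ y) ≤ C₂ * C₀ * Mf := by
    refine (hC₂ w hw.measurable S hS).trans ?_
    calc _ ≤ C₂ * (ENNReal.ofReal ((S ^ d)⁻¹) ^ (1 / 2 : ℝ) *
          (C₀ * (ENNReal.ofReal (S ^ d) ^ (1 / 2 : ℝ) * Mf))) := by gcongr
      _ = C₂ * C₀ * Mf * (ENNReal.ofReal ((S ^ d)⁻¹) * ENNReal.ofReal (S ^ d)) ^ (1 / 2 : ℝ) := by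
          rw [ENNReal.mul_rpow_of_nonneg _ _ (by norm_num)]; ring
      _ = _ := by
          rw [← ENNReal.ofReal_mul (by positivity), inv_mul_cancel₀ (by positivity)]; simp
  have hTv : ∫⁻ y, ‖v (S • y)‖ₑ * ENNReal.ofReal (om d σ y) ≤ C₁ * Mu + C₂ * C₀ * Mf := by
    refine le_trans ?_ (add_le_add (hC₁ u hu.measurable S hS) hTw)
    have huS : Continuous fun y : Euc d => u (S • y) := by fun_prop
    have hm : Measurable fun y : Euc d => ‖u (S • y)‖ₑ * ENNReal.ofReal (om d σ y) :=
      huS.measurable.enorm.mul measurable_om.ennreal_ofReal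
    rw [← lintegral_add_left hm]
    refine lintegral_mono fun y => ?_
    rw [← add_mul]
    gcongr
    have : v (S • y) = u (S • y) - w (S • y) := by rw [huvw]; ring
    rw [this]
    exact enorm_sub_le
  have hX : ∀ y : Euc d, ‖y‖ ≤ r → ENNReal.ofReal |v y - v 0| ≤
      N' * (C₁ * Mu + C₂ * C₀ * Mf + B' * (C₃ * Mf)) * Ka := by
    intro y hy
    have hpow : (‖y‖ / S) ^ α ≤ κ ^ (-α) := by
      rw [Real.rpow_neg hκ0.le, ← Real.inv_rpow hκ0.le]
      refine Real.rpow_le_rpow (by positivity) ?_ hα.le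
      rw [div_le_iff₀ hS, hSdef]
      have : κ⁻¹ * (2 * κ * r) = 2 * r := by field_simp
      linarith
    -- Here `κ ≥ 2` places `B_r` inside the region where the Hölder bound is valid.
    have hyS : ‖y‖ ≤ S / 4 := by rw [hSdef]; nlinarith
    have ht : 0 ≤ tail d σ (fun x => v (S • x)) := tail_nonneg _
    have ht' : 0 ≤ tail d σ (fun x => f (S • x)) := tail_nonneg _
    calc ENNReal.ofReal |v y - v 0| ≤ ENNReal.ofReal (N * (tail d σ (fun x => v (S • x)) +
          B * tail d σ (fun x => f (S • x))) * κ ^ (-α)) :=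
          ENNReal.ofReal_le_ofReal ((hosc y hyS).trans (by gcongr))
      _ = N' * ((∫⁻ y, ‖v (S • y)‖ₑ * ENNReal.ofReal (om d σ y)) +
          B' * ∫⁻ y, ‖f (S • y)‖ₑ * ENNReal.ofReal (om d σ y)) * Ka := by
          rw [ENNReal.ofReal_mul (by positivity), ENNReal.ofReal_mul hN,
            ENNReal.ofReal_add ht (by positivity), ENNReal.ofReal_mul hB, ofReal_tail hσ hv hvA,
            ofReal_tail hσ hf hfA]
          rfl
      _ ≤ _ := by
          gcongr
          exact hC₃ f hf.measurable S hS
  have hrS : ENNReal.ofReal ((r ^ d)⁻¹) ^ (1 / 2 : ℝ) * eLpNorm w 2 volume ≤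
      C₀ * C₇ * Kd * Mf := by
    calc _ ≤ ENNReal.ofReal ((r ^ d)⁻¹) ^ (1 / 2 : ℝ) *
          (C₀ * (ENNReal.ofReal (S ^ d) ^ (1 / 2 : ℝ) * Mf)) := by gcongr
      _ = C₀ * Mf * (ENNReal.ofReal ((r ^ d)⁻¹) * ENNReal.ofReal (S ^ d)) ^ (1 / 2 : ℝ) := by
          rw [ENNReal.mul_rpow_of_nonneg _ _ (by norm_num)]; ring
      _ = C₀ * Mf * (C₇ * Kd) := by
          congr 1
          change _ = ENNReal.ofReal _ * ENNReal.ofReal _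
          rw [← ENNReal.ofReal_mul (by positivity), ← ENNReal.ofReal_mul (by positivity),
            ENNReal.ofReal_rpow_of_nonneg (by positivity) (by norm_num)]
          congr 1
          have : (r ^ d)⁻¹ * S ^ d = (2 * κ) ^ (d : ℝ) := by
            rw [Real.rpow_natCast, hSdef, mul_pow (2 * κ)]; field_simp
          rw [this, ← Real.rpow_mul (by positivity), Real.mul_rpow (by norm_num) hκ0.le]
          ring_nf
      _ = _ := by ring
  have hu' : u = fun x => v x + w x := funext huvw
  calc meanOsc d u r ≤ 2 * (N' * (C₁ * Mu + C₂ * C₀ * Mf + B' * (C₃ * Mf)) * Ka +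
        C₆ * (ENNReal.ofReal ((r ^ d)⁻¹) ^ (1 / 2 : ℝ) * eLpNorm w 2 volume)) := by
        conv_lhs => rw [hu']
        exact hC₆ v w hv hw r hr _ hX
    _ ≤ 2 * (N' * (C₁ * Mu + C₂ * C₀ * Mf + B' * (C₃ * Mf)) * Ka + C₆ * (C₀ * C₇ * Kd * Mf)) := by
        gcongr
    _ = 2 * (N' * C₁ * (Ka * Mu) + N' * (C₂ * C₀ + B' * C₃) * (Ka * Mf) +
        C₆ * C₀ * C₇ * (Kd * Mf)) := by ring
    _ ≤ 2 * ((N' * C₁ + N' * (C₂ * C₀ + B' * C₃) + C₆ * C₀ * C₇) * (Ka * Mu) +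
        (N' * C₁ + N' * (C₂ * C₀ + B' * C₃) + C₆ * C₀ * C₇) * (Kd * Mf)) := by
        have h1 : Ka * Mf ≤ Kd * Mf := by gcongr
        calc _ ≤ 2 * (N' * C₁ * (Ka * Mu) + N' * (C₂ * C₀ + B' * C₃) * (Kd * Mf) +
              C₆ * C₀ * C₇ * (Kd * Mf)) := by gcongr
          _ ≤ 2 * (N' * C₁ * (Ka * Mu) + N' * (C₂ * C₀ + B' * C₃) * (Kd * Mf) +
              C₆ * C₀ * C₇ * (Kd * Mf)) + 2 * ((N' * (C₂ * C₀ + B' * C₃) + C₆ * C₀ * C₇) *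
              (Ka * Mu) + N' * C₁ * (Kd * Mf)) := le_self_add
          _ = _ := by ring
    _ = _ := by push_cast; ring

lemma IsSmoothBounded.exists_bd {u : Euc d → ℝ} (hu : IsSmoothBounded d u) (n : ℕ) :
    ∃ C, BD n C u := by
  choose C hC using hu.2
  refine ⟨∑ k ∈ Finset.range (n + 1), C k, hu.1.of_le (by exact_mod_cast le_top), fun k hk x => ?_⟩
  exact (hC k x).trans (Finset.single_le_sum (f := C)
    (fun j _ => (norm_nonneg _).trans (hC j 0)) (Finset.mem_range.2 (by omega)))

/-- The mean oscillation estimates for a solution and for its operator with homogeneous kernel. -/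
lemma exists_meanOsc_le (hd : 0 < d) (hσ : 0 < σ) (hσ2 : σ < 2) {ν Λ α : ℝ} (hν : 0 < ν)
    (hΛ : 0 < Λ) (hα : 0 < α) (hα1 : α < 1) (hασ : α < σ) :
    ∃ D : ℝ≥0, ∀ K : Euc d → ℝ, Ker d σ ν Λ K → ∀ lam r κ : ℝ, 0 < lam → 0 < r → 2 ≤ κ →
      ∀ f u : Euc d → ℝ, ContDiff ℝ ∞ f → (∀ n, ∃ C, BD n C u) →
      (∀ x, LL σ K u x - lam * u x = f x) →
      meanOsc d (fun x => lam * u x) r ≤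
        D * (ENNReal.ofReal (κ ^ (-α)) * maximalFn d (fun x => lam * u x) 0 +
          ENNReal.ofReal (κ ^ ((d : ℝ) / 2)) * maximalFn d (fun x => f x ^ 2) 0 ^ (1 / 2 : ℝ)) ∧
      meanOsc d (LL σ (homKernel d σ) u) r ≤
        D * (ENNReal.ofReal (κ ^ (-α)) * maximalFn d (LL σ (homKernel d σ) u) 0 +
          ENNReal.ofReal (κ ^ ((d : ℝ) / 2)) * maximalFn d (fun x => f x ^ 2) 0 ^ (1 / 2 : ℝ)) := by
  obtain ⟨N, hN, hol⟩ := exists_holder hd hσ hσ2 hν hΛ hα hα1 hασ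
  obtain ⟨C₄, hC₄⟩ := exists_eLpNorm_le_maximalFn (d := d)
  obtain ⟨D₁, hD₁⟩ := exists_meanOsc_le_of_decomp (d := d) (B := 0) hσ hα hN.le le_rfl C₄
  obtain ⟨D₂, hD₂⟩ := exists_meanOsc_le_of_decomp (d := d) (B := 3 ^ ((d : ℝ) + σ)) hσ hα hN.le
    (by positivity) (ν⁻¹.toNNReal * C₄)
  refine ⟨D₁ + D₂, fun K hK lam r κ hlam hr hκ f u hf hu hLu => ?_⟩
  set S : ℝ := 2 * κ * r with hSdef
  have hS : 0 < S := by positivity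
  have hker : Ker d σ 1 1 (homKernel d σ) := ker_homKernel
  have hLbd : ∀ {z : Euc d → ℝ}, (∀ n, ∃ C, BD n C z) →
      ∀ n, ∃ C, BD n C (LL σ K z - lam • z) := fun hz n => by
    obtain ⟨C, hC⟩ := hz (n + 3)
    exact ⟨_, (hC.LL hd hσ hσ2 hν.le hK).sub ((hC.mono le_rfl (by omega)).const_smul lam)⟩
  -- The inner radius `2 * S` leaves a gap of width `S` around `B_S`, needed for
  -- `abs_LL_homKernel_le_tail`.
  let η : ContDiffBump (0 : Euc d) := ⟨2 * S, 4 * S, by positivity, by linarith⟩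
  obtain ⟨w, hw, hLw, hw2, hs2⟩ := exists_solution hd hσ hσ2 hν hK hlam
    (h := fun x => η x * f x) (η.contDiff.mul hf) η.hasCompactSupport.mul_right
  have hh2 := hC₄ f (fun x => η x * f x) S hS
    (fun x => by
      rw [abs_mul, abs_of_nonneg η.nonneg]
      exact mul_le_of_le_one_left (abs_nonneg _) η.le_one)
    (fun x hx => by
      rw [η.zero_of_le_dist (by rw [dist_zero_right]; exact hx), zero_mul])
  set v : Euc d → ℝ := u - w with hvdef
  have hv : ∀ n, ∃ C, BD n C v := fun n => by
    obtain ⟨C, hC⟩ := hu n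
    obtain ⟨C', hC'⟩ := hw n
    exact ⟨_, hC.sub hC'⟩
  obtain ⟨Cu, hCu⟩ := hu 4
  obtain ⟨Cw, hCw⟩ := hw 4
  -- The nonlocal operator costs three derivatives, and the Hölder estimate for its image asks for
  -- two more.
  obtain ⟨Cv, hCv⟩ := hv 5
  have hCv4 : BD 4 Cv v := hCv.mono le_rfl (by norm_num)
  have hCv2 : BD 2 Cv v := hCv.mono le_rfl (by norm_num)
  have hCu2 : BD 2 Cu u := hCu.mono le_rfl (by norm_num)
  have hCw2 : BD 2 Cw w := hCw.mono le_rfl (by norm_num)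
  set g : Euc d → ℝ := LL σ K v - lam • v with hgdef
  have hg : ∀ x, g x = f x - η x * f x := fun x => by
    rw [hgdef, ← hLw, ← hLu]
    simp only [Pi.sub_apply, Pi.smul_apply, smul_eq_mul]
    rw [hvdef, LL_sub hd hσ hσ2 hν.le hK hCu2 hCw2, Pi.sub_apply]
    ring
  have hgf : ∀ x, |g x| ≤ |f x| := fun x => by
    have : g x = (1 - η x) * f x := by rw [hg]; ring
    rw [this, abs_mul, abs_of_nonneg (sub_nonneg.2 η.le_one)]
    exact mul_le_of_le_one_left (abs_nonneg _) (by linarith [η.nonneg (x := x)])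
  have hg0 : ∀ x ∈ ball (0 : Euc d) (2 * S), g x = 0 := fun x hx => by
    rw [hg, η.one_of_mem_closedBall (ball_subset_closedBall hx)]; ring
  obtain ⟨Cf, hCf⟩ := hLbd hu 0
  have hfe : LL σ K u - lam • u = f := funext hLu
  rw [hfe] at hCf
  have hfb : ∀ x, |f x| ≤ Cf := hCf.norm_le
  constructor
  · refine (hD₁ r κ hr hκ f (fun x => lam * u x) (lam • v) (lam • w) hf.continuous
      (hCu.continuous.const_smul lam) (hCv.continuous.const_smul lam)
      (hCw.continuous.const_smul lam) (max Cf (|lam| * Cv)) (fun x => (hfb x).trans (le_max_left _ _))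
      (fun x => ((hCv.const_smul lam).norm_le x).trans (le_max_right _ _))
      (fun x => by simp [hvdef, mul_sub]) (fun y hy => ?_) ?_).trans (by gcongr; simp)
    · have := hol K hK lam 0 _ S hlam.le le_rfl hS (lam • v) (hCv2.const_smul lam) (fun x hx => by
        rw [LL_smul]
        have := hg0 x (ball_subset_ball (by linarith) hx)
        simp only [hgdef, Pi.sub_apply, Pi.smul_apply, smul_eq_mul] at this ⊢
        rw [← mul_sub, this]; simp) y hy
      simpa using this
    · rw [eLpNorm_const_smul, Real.enorm_of_nonneg hlam.le]
      exact hw2.trans hh2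
  · obtain ⟨Cp, hCp⟩ : ∃ C, BD 2 C (LL σ (homKernel d σ) v) :=
      ⟨_, BD.LL (n := 2) hd hσ hσ2 zero_le_one hker hCv⟩
    have hqc : ∀ {z : Euc d → ℝ} {C : ℝ}, BD 4 C z → Continuous (LL σ (homKernel d σ) z) :=
      fun hz => (BD.LL (n := 1) hd hσ hσ2 zero_le_one hker hz).continuous
    refine (hD₂ r κ hr hκ f (LL σ (homKernel d σ) u) (LL σ (homKernel d σ) v)
      (LL σ (homKernel d σ) w) hf.continuous (hqc hCu) hCp.continuous (hqc hCw)
      (max Cf Cp) (fun x => (hfb x).trans (le_max_left _ _))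
      (fun x => (hCp.norm_le x).trans (le_max_right _ _))
      (fun x => ?_) (fun y hy => ?_) ?_).trans (by gcongr; simp)
    · rw [hvdef, LL_sub hd hσ hσ2 zero_le_one hker hCu2 hCw2]; ring
    · have := hol K hK lam (S ^ (-σ) * (3 ^ ((d : ℝ) + σ) * tail d σ (fun y => f (S • y)))) _ S
        hlam.le (mul_nonneg (by positivity) (mul_nonneg (by positivity) (tail_nonneg _))) hS _ hCp
        (fun x hx => by
          -- Commutation: the image of `v` solves the same equation, with the image of `g` on the
          -- right.
          have e : LL σ K (LL σ (homKernel d σ) v) x - lam * LL σ (homKernel d σ) v x =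
              LL σ (homKernel d σ) g x := by
            rw [hgdef, LL_sub hd hσ hσ2 zero_le_one hker
              (BD.LL (n := 2) hd hσ hσ2 hν.le hK hCv) (hCv2.const_smul lam), LL_smul,
              LL_comm hd hσ hσ2 hν.le zero_le_one hK hker hCv4, smul_eq_mul]
          rw [e]
          exact abs_LL_homKernel_le_tail hσ hf.continuous hfb hgf hS hg0 hx) y hy
      -- The factor `S^σ` of the scaled Hölder estimate cancels the `S^(-σ)` of the tail bound.
      rwa [← mul_assoc, ← Real.rpow_add hS, add_neg_cancel, Real.rpow_zero, one_mul] at this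
    · have e : (ENNReal.ofReal ν⁻¹) * ENNReal.ofReal ν = 1 := by
        rw [← ENNReal.ofReal_mul (by positivity), inv_mul_cancel₀ hν.ne', ENNReal.ofReal_one]
      rw [ENNReal.coe_mul, mul_assoc]
      calc _ = ENNReal.ofReal ν⁻¹ * (ENNReal.ofReal ν *
            eLpNorm (LL σ (homKernel d σ) w) 2 volume) := by rw [← mul_assoc, e, one_mul]
        _ ≤ _ := by
            refine mul_le_mul_right (hs2.trans hh2) _

end oscillation

end Nonlocal

end

/-! ### The mean oscillation estimate. -/

theorem proposition5p5 (d : ℕ) (hd : 0 < d) (σ ν Λ α : ℝ) (hσ : 0 < σ) (hσ2 : σ < 2)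
    (hν : 0 < ν) (hνΛ : ν ≤ Λ) (hα : 0 < α) (hα1 : α < min 1 σ) :
    ∃ N : ℝ, 0 < N ∧
      ∀ K : EuclideanSpace ℝ (Fin d) → ℝ, Nonlocal.IsKernel d σ ν Λ K →
      ∀ lam r κ : ℝ, 0 < lam → 0 < r → 2 ≤ κ →
      ∀ f u : EuclideanSpace ℝ (Fin d) → ℝ,
        ContDiff ℝ ∞ f → MemLp f ⊤ volume →
        Nonlocal.MemBesselTwo d σ u → Nonlocal.IsSmoothBounded d u →
        (∀ x, Nonlocal.nonlocalOp d σ K u x - lam * u x = f x) →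
        ENNReal.ofReal lam * Nonlocal.meanOsc d u r
            + Nonlocal.meanOsc d (Nonlocal.fracLaplacian d σ u) r
          ≤ ENNReal.ofReal (N * κ ^ (-α)) *
              (ENNReal.ofReal lam * Nonlocal.maximalFn d u 0
                + Nonlocal.maximalFn d (Nonlocal.fracLaplacian d σ u) 0)
            + ENNReal.ofReal (N * κ ^ ((d : ℝ) / 2)) *
                Nonlocal.maximalFn d (fun x => f x ^ 2) 0 ^ ((1 : ℝ) / 2) := by
  have h2 : 0 < 2 - σ := by linarith
  obtain ⟨D, hD⟩ := Nonlocal.exists_meanOsc_le hd hσ hσ2 (mul_pos h2 hν)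
    (mul_pos h2 (hν.trans_le hνΛ)) hα (hα1.trans_le (min_le_left _ _))
    (hα1.trans_le (min_le_right _ _))
  set c : ℝ := -(Nonlocal.fracConst d σ)⁻¹ with hc
  -- The square function term occurs in both estimates, with weights `1` and `|c|`; the last `1`
  -- only ensures positivity.
  refine ⟨D * (1 + |c|) + 1, by positivity, ?_⟩
  intro K hK lam r κ hlam hr hκ f u hf _ _ hu hLu
  have hκ0 : 0 < κ := by linarith
  obtain ⟨h₁, h₂⟩ := hD K (hK.ker hd hσ hσ2 hν hνΛ) lam r κ hlam hr hκ f u hf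
    (fun n => hu.exists_bd n) (fun x => by rw [← Nonlocal.nonlocalOp_eq_LL]; exact hLu x)
  obtain ⟨C, hC⟩ := hu.exists_bd 2
  have hfrac : Nonlocal.fracLaplacian d σ u =
      fun x => c * Nonlocal.LL σ (Nonlocal.homKernel d σ) u x := funext fun x => by
    rw [Nonlocal.fracLaplacian_eq_LL hd hσ hσ2 hC, hc, neg_mul]
  rw [Nonlocal.meanOsc_const_mul, Nonlocal.maximalFn_const_mul, Real.enorm_of_nonneg hlam.le] at h₁
  rw [hfrac, Nonlocal.meanOsc_const_mul, Nonlocal.maximalFn_const_mul,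
    ENNReal.ofReal_mul (by positivity), ENNReal.ofReal_mul (by positivity)]
  set Mf := Nonlocal.maximalFn d (fun x => f x ^ 2) 0 ^ ((1 : ℝ) / 2)
  set Mu := ENNReal.ofReal lam * Nonlocal.maximalFn d u 0
  set Mq := Nonlocal.maximalFn d (Nonlocal.LL σ (Nonlocal.homKernel d σ) u) 0
  set Ka := ENNReal.ofReal (κ ^ (-α))
  set Kd := ENNReal.ofReal (κ ^ ((d : ℝ) / 2))
  have hN : (D : ℝ≥0∞) * (1 + ‖c‖ₑ) ≤ ENNReal.ofReal (D * (1 + |c|) + 1) := by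
    rw [Real.enorm_eq_ofReal_abs, ← ENNReal.ofReal_one, ← ENNReal.ofReal_add zero_le_one
      (abs_nonneg c), ← ENNReal.ofReal_coe_nnreal, ← ENNReal.ofReal_mul D.coe_nonneg]
    exact ENNReal.ofReal_le_ofReal (by linarith)
  have hN' : (D : ℝ≥0∞) ≤ ENNReal.ofReal (D * (1 + |c|) + 1) :=
    le_trans (le_mul_of_one_le_right' le_self_add) hN
  calc _ ≤ D * (Ka * Mu + Kd * Mf) + ‖c‖ₑ * (D * (Ka * Mq + Kd * Mf)) := by gcongr
    _ = D * (Ka * Mu) + D * (Ka * (‖c‖ₑ * Mq)) + D * (1 + ‖c‖ₑ) * (Kd * Mf) := by ring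
    _ ≤ ENNReal.ofReal (D * (1 + |c|) + 1) * (Ka * Mu) +
        ENNReal.ofReal (D * (1 + |c|) + 1) * (Ka * (‖c‖ₑ * Mq)) +
        ENNReal.ofReal (D * (1 + |c|) + 1) * (Kd * Mf) := by gcongr
    _ = _ := by ring
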